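/- A planar map is a $2$-cell embedding of a finite connected planar multigraph on the sphere, considered up to orientation-preserving homeomorphism. It is rooted if one of its edges is distinguished and oriented (the root edge); by convention the map that consists of a single vertex, which has no edge, also counts as rooted. The face to the right of the root edge is called the outer face. A map is simple if it has no loops and no multiple edges. A simple rooted map is outerplanar if every vertex lies on the boundary of the outer face, and it is bipartite if its vertices can be coloured with two colours such that the ends of every edge receive different colours. For $n \ge 1$ let $|\mathcal{M}_n^{\mathrm{out}}|$ be the number of rooted simple outerplanar maps with $n$ vertices, and let $|\mathcal{M}_n^{\mathrm{bip}}|$ be the number of those among them that are bipartite. (Vertices are unlabelled; rooted maps are identified if an orientation-preserving homeomorphism takes one to the other and root edge to root edge, with its orientation.) Then, as $n \to \infty$, \[ |\mathcal{M}_n^{\mathrm{out}}| \sim \frac{8^n\, n^{-3/2}}{36\sqrt{\pi}} \qquad\text{and}\qquad |\mathcal{M}_n^{\mathrm{bip}}| \sim \frac{(2\sqrt{3}-3)\sqrt{2}}{9\sqrt{\pi(\sqrt{3}-1)}}\,(3\sqrt{3}-5)^{-n}\, n^{-3/2}, \] where $a_n \sim b_n$ means $a_n/b_n \to 1$. -/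

import Mathlib

open Filter Asymptotics

/-- A finite map (cellularly embedded multigraph) on an oriented closed surface, given by its
vertices, its darts (edges with a direction), and the cyclic order of the darts around every vertex.
Loops and multiple edges are allowed. -/
structure CombMap where
  /-- vertices -/
  Vertex : Type
  /-- darts, i.e. oriented edges; every edge carries exactly two of them -/
  Dart : Type
  finite_vertex : Finite Vertex
  finite_dart : Finite Dart
  /-- the vertex from which a dart starts -/
  origin : Dart → Vertex
  /-- the same edge with the opposite direction -/
  rev : Equiv.Perm Dart
  /-- the next dart, in counterclockwise order, around the origin -/
  rot : Equiv.Perm Dart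
  rev_rev : ∀ d, rev (rev d) = d
  rev_ne : ∀ d, rev d ≠ d
  /-- the darts that start from a given vertex form one cycle of the rotation -/
  origin_eq_iff : ∀ d e, origin d = origin e ↔ rot.SameCycle d e

namespace CombMap

/-- the end point of a dart -/
def target (M : CombMap) (d : M.Dart) : M.Vertex := M.origin (M.rev d)

/-- The next dart on the boundary walk of the face to the right of a dart: at the end point,
turn right as sharply as possible. Every dart lies on the boundary walk of exactly one face,
the face to its right, so that the boundary walks are the cycles of this permutation. -/
def faceNext (M : CombMap) : Equiv.Perm M.Dart := M.rot * M.rev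

/-- The simple graph in which two distinct vertices are adjacent if some edge joins them. -/
def graph (M : CombMap) : SimpleGraph M.Vertex :=
  SimpleGraph.fromRel fun u v => ∃ d, M.origin d = u ∧ M.target d = v

/-- number of vertices -/
noncomputable def numVertices (M : CombMap) : ℕ := Nat.card M.Vertex

/-- number of edges -/
noncomputable def numEdges (M : CombMap) : ℕ :=
  Nat.card (Quotient (Equiv.Perm.SameCycle.setoid M.rev))

open Classical in
/-- Number of faces (of a connected map): one for every boundary walk. The map that consists of a
single vertex has one face, whose boundary contains no dart. -/
noncomputable def numFaces (M : CombMap) : ℕ :=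
  if IsEmpty M.Dart then 1 else Nat.card (Quotient (Equiv.Perm.SameCycle.setoid M.faceNext))

/-- A planar map: connected, and on the sphere, i.e. of Euler characteristic two. -/
def IsPlanar (M : CombMap) : Prop :=
  M.graph.Connected ∧ M.numVertices + M.numFaces = M.numEdges + 2

/-- no loops and no multiple edges -/
def IsSimple (M : CombMap) : Prop :=
  (∀ d, M.target d ≠ M.origin d) ∧
    ∀ d e, M.origin d = M.origin e → M.target d = M.target e → d = e

/-- The vertices can be coloured with two colours such that the ends of each edge differ. -/
def IsBipartite (M : CombMap) : Prop :=
  ∃ c : M.Vertex → Bool, ∀ d, c (M.origin d) ≠ c (M.target d)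

end CombMap

/-- A rooted planar map. The root is one of the darts; only the map without edges, which is a single
vertex, has no root dart, and it counts as rooted. -/
structure RootedMap extends CombMap where
  planar : toCombMap.IsPlanar
  root : Option Dart
  root_eq_none_iff : root = none ↔ IsEmpty Dart

namespace RootedMap

/-- Every vertex lies on the boundary of the outer face, which is the face to the right of the root
edge. (For the map that is a single vertex there is nothing to check.) -/
def IsOuterplanar (M : RootedMap) : Prop :=
  ∀ r ∈ M.root, ∀ v, ∃ d, M.faceNext.SameCycle r d ∧ M.origin d = v

/-- Orientation-preserving isomorphism of rooted maps. -/
structure Iso (M N : RootedMap) where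
  vertexEquiv : M.Vertex ≃ N.Vertex
  dartEquiv : M.Dart ≃ N.Dart
  map_origin : ∀ d, N.origin (dartEquiv d) = vertexEquiv (M.origin d)
  map_rev : ∀ d, N.rev (dartEquiv d) = dartEquiv (M.rev d)
  map_rot : ∀ d, N.rot (dartEquiv d) = dartEquiv (M.rot d)
  map_root : N.root = M.root.map dartEquiv

/-- the identity -/
def Iso.refl (M : RootedMap) : Iso M M where
  vertexEquiv := Equiv.refl _
  dartEquiv := Equiv.refl _
  map_origin _ := rfl
  map_rev _ := rfl
  map_rot _ := rfl
  map_root := by simp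

/-- the inverse -/
def Iso.symm {M N : RootedMap} (f : Iso M N) : Iso N M where
  vertexEquiv := f.vertexEquiv.symm
  dartEquiv := f.dartEquiv.symm
  map_origin d := by
    rw [Equiv.eq_symm_apply, ← f.map_origin, Equiv.apply_symm_apply]
  map_rev d := by
    rw [Equiv.eq_symm_apply, ← f.map_rev, Equiv.apply_symm_apply]
  map_rot d := by
    rw [Equiv.eq_symm_apply, ← f.map_rot, Equiv.apply_symm_apply]
  map_root := by
    rw [f.map_root, Option.map_map]
    simp

/-- the composition -/
def Iso.trans {M N P : RootedMap} (f : Iso M N) (g : Iso N P) : Iso M P where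
  vertexEquiv := f.vertexEquiv.trans g.vertexEquiv
  dartEquiv := f.dartEquiv.trans g.dartEquiv
  map_origin d := by simp [g.map_origin, f.map_origin]
  map_rev d := by simp [g.map_rev, f.map_rev]
  map_rot d := by simp [g.map_rot, f.map_rot]
  map_root := by
    rw [g.map_root, f.map_root, Option.map_map]
    rfl

/-- Rooted maps are considered up to isomorphism. -/
def isoSetoid : Setoid RootedMap where
  r M N := Nonempty (Iso M N)
  iseqv :=
    ⟨fun M => ⟨Iso.refl M⟩, fun ⟨f⟩ => ⟨f.symm⟩, fun ⟨f⟩ ⟨g⟩ => ⟨f.trans g⟩⟩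

/-- the number of maps in `S`, counted up to isomorphism -/
noncomputable def countUpToIso (S : Set RootedMap) : ℕ :=
  Set.ncard ((Quotient.mk isoSetoid) '' S)

/-- the rooted simple outerplanar maps with `n` vertices -/
def outerplanarMaps (n : ℕ) : Set RootedMap :=
  {M | M.IsSimple ∧ M.IsOuterplanar ∧ M.numVertices = n}

/-- the bipartite rooted simple outerplanar maps with `n` vertices -/
def bipartiteOuterplanarMaps (n : ℕ) : Set RootedMap :=
  {M | M ∈ outerplanarMaps n ∧ M.IsBipartite}

end RootedMap

/-!
Number the vertices of a rooted simple outerplanar map `0, …, n - 1` in the order in which the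
boundary walk of the outer face, which starts with the root, first visits them, and draw them in
this order on a circle. The edges then form a noncrossing graph in which every vertex but `0` has a
smaller neighbour (`IsGood`). This encodes the map: for `2 ≤ n`, the isomorphism classes of maps
with `n` vertices correspond to the good edge sets (`RootedMap.countUpToIso_eq`).

* The graph is noncrossing (`CombMap.VisitOrder.noncrossing`). Multiply the rotation by the
  transpositions that join the cycles of all vertices at their corners on the outer face. The
  result is one cycle `c` of all darts, and the outer face is split into `n` cycles, so that
  `c * rev` has `F + n - 1` cycles. By Euler's formula this is `E + 1`, the largest possible number
  of cycles for the involution `rev` of `2 * E` points, and it is attained only if the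
  chords `{d, rev d}` do not cross (`Equiv.Perm.noncrossing_of_numCycles`). That there are no
  crossings also forces the rotation around each vertex to be the cyclic order of the neighbours.
* Conversely, a good edge set with this rotation is a planar map (`IsGood.isPlanar_modelMap`), whose
  inner faces correspond to the edges `u < v` such that `v` has a smaller neighbour beyond `u`, and
  whose outer face visits the vertices in their order (`IsGood.sameCycle_root_start`).
* The walk around the outer face can be recovered from the map, so that isomorphic maps come from
  the same edge set (`IsGood.eq_of_iso`).

A good edge set is built by adding the vertices one by one. A new vertex is joined to a nonempty set
of visible vertices, those below no edge; the visible vertices beyond the smallest one chosen are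
hidden, and the new vertex becomes visible. Successive visible vertices are adjacent. Hence, in the
bipartite case, the vertices chosen have to agree in the parity of their position, and in both
cases the number of choices that hide `m` vertices is `2 ^ ⌊m / d⌋`, with `d = 1` for all maps and
`d = 2` for the bipartite ones. The number of visible vertices is thus a path with steps
`1 - m ≤ 1`, which are counted by `Φ = ∑ 2 ^ ⌊m / d⌋ t ^ m`, and the ballot theorem gives
`[t ^ (N - 1)] Φ ^ N / (1 - t) ^ 2 / N` for the number of maps with `N + 1` vertices
(`card_goodSets`).

The asymptotics of this coefficient come from Cauchy's integral over the circle `|t| = τ` through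
the saddle point, where `τ Φ'(τ) = Φ(τ)`, and Laplace's method (`tendsto_coeff_pow_mul`). For `d = 1`,
`Φ = 1 / (1 - 2 t)`, `τ = 1 / 4` and `τ / Φ(τ) = 1 / 8`; for `d = 2`,
`Φ = (1 + t) / (1 - 2 t ^ 2)`, `τ = (√3 - 1) / 2` and `τ / Φ(τ) = 3 √3 - 5`.
-/

/-! ### Cycles of permutations and noncrossing involutions -/

namespace Equiv.Perm

variable {D : Type*}

/-- The number of cycles of a permutation, fixed points included. -/
noncomputable def numCycles (σ : Perm D) : ℕ :=
  Nat.card (Quotient (SameCycle.setoid σ))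

theorem sameCycle_of_pow_apply {σ : Perm D} {x y : D} (k : ℕ) (h : (σ ^ k) x = y) :
    σ.SameCycle x y := ⟨k, by simpa using h⟩

/-- A set that is closed under a permutation of a finite type is a union of cycles. -/
theorem SameCycle.mem_of_forall_apply_mem [Finite D] {σ : Perm D} {s : Set D}
    (hs : ∀ x ∈ s, σ x ∈ s) {x y : D} (h : σ.SameCycle x y) (hx : x ∈ s) : y ∈ s := by
  obtain ⟨k, -, hk⟩ := h.exists_pow_eq'
  have : ∀ k : ℕ, (σ ^ k) x ∈ s := fun k => by
    induction k with
    | zero => simpa using hx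
    | succ k ih => rw [pow_succ', mul_apply]; exact hs _ ih
  exact hk ▸ this k

theorem numCycles_eq_one {σ : Perm D} (a : D) (h : ∀ x, σ.SameCycle a x) :
    σ.numCycles = 1 := by
  rw [numCycles, Nat.card_eq_one_iff_unique]
  refine ⟨⟨fun p q => ?_⟩, ⟨⟦a⟧⟩⟩
  induction p using Quotient.inductionOn
  induction q using Quotient.inductionOn
  exact Quotient.sound ((h _).symm.trans (h _))

/-- The cycle of `a` in `swap a b * σ` starts like the one in `σ`, until it meets `a` or `b`. -/
theorem swap_mul_pow_apply [DecidableEq D] {σ : Perm D} {a b : D} {k : ℕ}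
    (hk : ∀ i, 0 < i → i < k → (σ ^ i) a ≠ a ∧ (σ ^ i) a ≠ b) :
    ∀ i < k, ((swap a b * σ) ^ i) a = (σ ^ i) a := by
  intro i hi
  induction i with
  | zero => simp
  | succ i ih =>
    have := hk (i + 1) (by omega) hi
    rw [pow_succ', mul_apply, ih (by omega), mul_apply, ← mul_apply σ, ← pow_succ',
      swap_apply_of_ne_of_ne this.1 this.2]

/-- Multiplication by a transposition of points of the same cycle splits the cycle. -/
theorem SameCycle.not_swap_mul [Finite D] [DecidableEq D] {σ : Perm D} {a b : D} (hab : a ≠ b)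
    (h : σ.SameCycle a b) : ¬ (swap a b * σ).SameCycle a b := by
  classical
  have hex : ∃ k, (σ ^ k) a = b := by
    obtain ⟨k, -, hk⟩ := h.exists_pow_eq'
    exact ⟨k, hk⟩
  set k := Nat.find hex with hk
  have hkb : (σ ^ k) a = b := Nat.find_spec hex
  have hmin : ∀ i < k, (σ ^ i) a ≠ b := fun i hi => Nat.find_min hex hi
  have hk0 : 0 < k := by
    rcases Nat.eq_zero_or_pos k with h0 | h0
    · rw [h0] at hkb; exact absurd hkb (by simpa using hab)
    · exact h0
  have hne : ∀ i, 0 < i → i < k → (σ ^ i) a ≠ a ∧ (σ ^ i) a ≠ b := fun i h0 hi => by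
    refine ⟨fun h => ?_, hmin i hi⟩
    refine hmin (k - i) (by omega) ?_
    rw [← hkb]
    conv_rhs => rw [show k = k - i + i by omega, pow_add, mul_apply, h]
  have hp := swap_mul_pow_apply hne
  intro hs
  have : b ∈ {x | ∃ i < k, (σ ^ i) a = x} := by
    refine hs.mem_of_forall_apply_mem ?_ ⟨0, hk0, by simp⟩
    rintro _ ⟨i, hi, rfl⟩
    rcases Nat.lt_or_ge (i + 1) k with h1 | h1
    · refine ⟨i + 1, h1, ?_⟩
      rw [← hp _ h1, ← hp _ hi, pow_succ', mul_apply]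
    · refine ⟨0, hk0, ?_⟩
      have : i + 1 = k := by omega
      rw [mul_apply, ← mul_apply σ, ← pow_succ', this, hkb]
      simp
  obtain ⟨i, hi, h⟩ := this
  exact hmin i hi h

/-- Multiplication by a transposition of points of two cycles joins the cycles. -/
theorem sameCycle_swap_mul [Finite D] [DecidableEq D] {σ : Perm D} {a b : D}
    (h : ¬ σ.SameCycle a b) : (swap a b * σ).SameCycle a b := by
  classical
  have hex : ∃ k, 0 < k ∧ (σ ^ k) a = a := ⟨orderOf σ, orderOf_pos σ, by simp [pow_orderOf_eq_one]⟩
  set k := Nat.find hex with hk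
  obtain ⟨hk0, hka⟩ := Nat.find_spec hex
  have hne : ∀ i, 0 < i → i < k → (σ ^ i) a ≠ a ∧ (σ ^ i) a ≠ b := fun i h0 hi =>
    ⟨fun h => Nat.find_min hex hi ⟨h0, h⟩, fun h' => h (sameCycle_of_pow_apply i h')⟩
  refine sameCycle_of_pow_apply k ?_
  have := swap_mul_pow_apply hne (k - 1) (by omega)
  rw [show k = k - 1 + 1 by omega, pow_succ', mul_apply, this, mul_apply, ← mul_apply σ,
    ← pow_succ', show k - 1 + 1 = k by omega, hka]
  simp

theorem numCycles_swap_mul_of_not_sameCycle [Finite D] [DecidableEq D] {σ : Perm D} {a b : D}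
    (h : ¬ σ.SameCycle a b) : (swap a b * σ).numCycles + 1 = σ.numCycles := by
  classical
  set τ := swap a b * σ with hτ
  have hab : τ.SameCycle a b := sameCycle_swap_mul h
  -- the cycles of `τ` are those of `σ`, with the cycle of `b` absorbed by that of `a`
  have hστ : ∀ x y, σ.SameCycle x y → τ.SameCycle x y := by
    intro x y hxy
    refine hxy.mem_of_forall_apply_mem (s := {y | τ.SameCycle x y}) ?_ (SameCycle.refl _ _)
    intro z hz
    refine SameCycle.trans hz ?_
    rw [← sameCycle_apply_left]
    by_cases h1 : σ z = a
    · rw [hτ, mul_apply, h1, swap_apply_left]; exact hab.symm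
    by_cases h2 : σ z = b
    · rw [hτ, mul_apply, h2, swap_apply_right]; exact hab
    rw [hτ, mul_apply, swap_apply_of_ne_of_ne h1 h2]
  let f : D → Quotient (SameCycle.setoid σ) := fun x => if σ.SameCycle x b then ⟦a⟧ else ⟦x⟧
  have hf : ∀ x, f (τ x) = f x := by
    intro x
    have hx : f (σ x) = f x := by
      simp only [f, sameCycle_apply_left]
      split_ifs
      · rfl
      · exact Quotient.sound (sameCycle_apply_left.2 (SameCycle.refl _ _))
    have hfab : f a = f b := by simp [f, SameCycle.refl]
    rw [← hx, hτ, mul_apply]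
    by_cases h1 : σ x = a
    · rw [h1, swap_apply_left, hfab]
    by_cases h2 : σ x = b
    · rw [h2, swap_apply_right, hfab]
    rw [swap_apply_of_ne_of_ne h1 h2]
  have hf' : ∀ x y, τ.SameCycle x y → f x = f y := fun x y hxy =>
    (hxy.mem_of_forall_apply_mem (s := {y | f x = f y}) (fun z hz => hz.trans (hf z).symm)) rfl
  have hfb : ∀ x, f x ≠ ⟦b⟧ := by
    intro x hx
    simp only [f] at hx
    split_ifs at hx with h1
    · exact h (Quotient.exact hx)
    · exact h1 (Quotient.exact hx)
  let F : Quotient (SameCycle.setoid τ) → {q : Quotient (SameCycle.setoid σ) // q ≠ ⟦b⟧} :=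
    Quotient.lift (fun x => ⟨f x, hfb x⟩) fun x y hxy => Subtype.ext (hf' x y hxy)
  have hF : Function.Bijective F := by
    constructor
    · intro p q hpq
      induction p using Quotient.inductionOn with | _ x
      induction q using Quotient.inductionOn with | _ y
      have hxy : f x = f y := congrArg Subtype.val hpq
      have key : ∀ x, ∃ x', τ.SameCycle x x' ∧ f x = ⟦x'⟧ := by
        intro x
        by_cases h1 : σ.SameCycle x b
        · exact ⟨a, (hστ _ _ h1).trans hab.symm, by simp [f, h1]⟩
        · exact ⟨x, SameCycle.refl _ _, by simp [f, h1]⟩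
      obtain ⟨x', hx', hx⟩ := key x
      obtain ⟨y', hy', hy⟩ := key y
      rw [hx, hy] at hxy
      exact Quotient.sound (hx'.trans ((hστ _ _ (Quotient.exact hxy)).trans hy'.symm))
    · rintro ⟨q, hq⟩
      induction q using Quotient.inductionOn with | _ x
      refine ⟨⟦x⟧, Subtype.ext ?_⟩
      have : ¬ σ.SameCycle x b := fun h => hq (Quotient.sound h)
      simp [F, f, this]
  have hc := Nat.card_congr (Equiv.ofBijective F hF)
  rw [numCycles, numCycles, hc]
  have := Fintype.ofFinite (Quotient (SameCycle.setoid σ))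
  simp only [Nat.card_eq_fintype_card, Fintype.card_subtype_compl, Fintype.card_unique]
  have : 0 < Fintype.card (Quotient (SameCycle.setoid σ)) := Fintype.card_pos_iff.2 ⟨⟦b⟧⟩
  omega

theorem numCycles_swap_mul_of_sameCycle [Finite D] [DecidableEq D] {σ : Perm D} {a b : D}
    (hab : a ≠ b) (h : σ.SameCycle a b) : (swap a b * σ).numCycles = σ.numCycles + 1 := by
  have := numCycles_swap_mul_of_not_sameCycle (h.not_swap_mul hab)
  rwa [← mul_assoc, swap_mul_self, one_mul, eq_comm] at this

theorem mul_swap_eq [DecidableEq D] (σ : Perm D) (a b : D) :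
    σ * swap a b = swap (σ a) (σ b) * σ := by
  rw [swap_apply_apply, inv_mul_cancel_right]

theorem numCycles_mul_swap_of_sameCycle [Finite D] [DecidableEq D] {σ : Perm D} {a b : D}
    (hab : a ≠ b) (h : σ.SameCycle a b) : (σ * swap a b).numCycles = σ.numCycles + 1 := by
  rw [mul_swap_eq]
  exact numCycles_swap_mul_of_sameCycle (by simpa using hab) (by simpa using h)

theorem numCycles_mul_swap_of_not_sameCycle [Finite D] [DecidableEq D] {σ : Perm D} {a b : D}
    (h : ¬ σ.SameCycle a b) : (σ * swap a b).numCycles + 1 = σ.numCycles := by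
  rw [mul_swap_eq]
  exact numCycles_swap_mul_of_not_sameCycle (by simpa using h)

theorem numCycles_mul_swap_le [Finite D] [DecidableEq D] (σ : Perm D) (a b : D) :
    (σ * swap a b).numCycles ≤ σ.numCycles + 1 := by
  by_cases hab : a = b
  · subst hab
    rw [swap_self, ← one_def, mul_one]
    omega
  by_cases h : σ.SameCycle a b
  · exact (numCycles_mul_swap_of_sameCycle hab h).le
  · have := numCycles_mul_swap_of_not_sameCycle h
    omega

/-- An involution is a product of transpositions, one for every two points that it moves; each of
them creates at most one cycle. -/
theorem numCycles_mul_involution_le [Fintype D] [DecidableEq D] (σ : Perm D) (α : Perm D)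
    (hα : ∀ x, α (α x) = x) : 2 * (σ * α).numCycles ≤ 2 * σ.numCycles + α.support.card := by
  induction hn : α.support.card using Nat.strong_induction_on generalizing σ α with
  | _ n ih =>
  by_cases h1 : α = 1
  · subst h1; simp
  obtain ⟨a, ha⟩ : ∃ a, α a ≠ a := by
    by_contra! h
    exact h1 (Equiv.ext h)
  set b := α a with hb
  have hba : α b = a := hα a
  set β := swap a b * α with hβ
  have hβs : β.support = α.support \ {a, b} := by
    ext x
    simp only [mem_support, Finset.mem_sdiff, Finset.mem_insert, Finset.mem_singleton, hβ,
      mul_apply]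
    by_cases hxa : x = a
    · subst hxa; simp [← hb]
    by_cases hxb : x = b
    · subst hxb; simp [hba]
    have h1 : α x ≠ a := fun h => hxb (by rw [← hα x, h])
    have h2 : α x ≠ b := fun h => hxa (by rw [← hα x, h, hba])
    rw [swap_apply_of_ne_of_ne h1 h2]
    simp [hxa, hxb]
  have hsub : ({a, b} : Finset D) ⊆ α.support := by
    intro x hx
    simp only [Finset.mem_insert, Finset.mem_singleton] at hx
    rcases hx with rfl | rfl
    · simpa using ha
    · simpa [hba] using ha.symm
  have hcard : β.support.card + 2 = α.support.card := by
    rw [hβs, Finset.card_sdiff_of_subset hsub, Finset.card_pair ha.symm]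
    have := Finset.card_le_card hsub
    rw [Finset.card_pair ha.symm] at this
    omega
  have hβi : ∀ x, β (β x) = x := by
    intro x
    simp only [hβ, mul_apply]
    by_cases hxa : x = a
    · subst hxa; simp [← hb]
    by_cases hxb : x = b
    · subst hxb; simp [hba]
    have h1 : α x ≠ a := fun h => hxb (by rw [← hα x, h])
    have h2 : α x ≠ b := fun h => hxa (by rw [← hα x, h, hba])
    rw [swap_apply_of_ne_of_ne h1 h2, hα, swap_apply_of_ne_of_ne hxa hxb]
  have h3 := ih _ (by omega) (σ * swap a b) β hβi rfl
  have h4 : σ * swap a b * β = σ * α := by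
    rw [hβ, mul_assoc, ← mul_assoc (swap a b), swap_mul_self, one_mul]
  rw [h4] at h3
  have h5 := numCycles_mul_swap_le σ a b
  omega

/-- Let `c` be a cyclic permutation, which maps every point except the last one to its successor.
If the product of `c` with an involution `α` has as many cycles as it can have, namely
`|D| / 2 + 1`, then the chords `{x, α x}` do not cross. -/
theorem noncrossing_of_numCycles [Fintype D] [LinearOrder D] {c α : Perm D}
    (hc : ∀ x y, x < y → x < c x ∧ c x ≤ y) (hα : ∀ x, α (α x) = x)
    (hcard : Fintype.card D + 2 ≤ 2 * (c * α).numCycles) {a x : D}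
    (hax : a < x) (hxb : x < α a) (hby : α a < α x) : False := by
  have hone : c.numCycles = 1 := by
    have : Nonempty D := ⟨a⟩
    obtain ⟨m, hm⟩ := Finite.exists_min (id : D → D)
    refine numCycles_eq_one m fun z => ?_
    -- the largest point of the cycle of `m` below `z` is `z`, or else its successor is larger
    have hz : (Finset.univ.filter fun w => c.SameCycle m w ∧ w ≤ z).Nonempty :=
      ⟨m, by simpa [SameCycle.refl] using hm z⟩
    obtain ⟨w, hw, hmax⟩ := Finset.exists_max_image _ id hz
    simp only [Finset.mem_filter, Finset.mem_univ, true_and, id] at hw hmax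
    rcases hw.2.eq_or_lt with h | h
    · exact h ▸ hw.1
    · have := hc w z h
      exact absurd (hmax (c w) ⟨sameCycle_apply_right.2 hw.1, this.2⟩) (not_le.2 this.1)
  set b := α a with hb
  set y := α x with hy
  have hba : α b = a := hα a
  have hyx : α y = x := hα x
  have hab : a < b := hax.trans hxb
  have hxy : x < y := hxb.trans hby
  have h1 : (c * swap a b).numCycles ≤ 2 := by
    have := numCycles_mul_swap_le c a b
    omega
  have h2 : ¬ (c * swap a b).SameCycle x y := by
    intro h
    have := h.mem_of_forall_apply_mem (s := {z | a < z ∧ z ≤ b}) ?_ ⟨hax, hxb.le⟩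
    · exact absurd this.2 (not_le.2 hby)
    · rintro z ⟨hz1, hz2⟩
      rcases hz2.eq_or_lt with rfl | hz2
      · rw [mul_apply, swap_apply_right]
        exact hc _ _ hab
      · rw [mul_apply, swap_apply_of_ne_of_ne hz1.ne' hz2.ne]
        exact ⟨hz1.trans (hc _ _ hz2).1, (hc _ _ hz2).2⟩
  have h3 := numCycles_mul_swap_of_not_sameCycle h2
  -- the remaining chords
  set β := swap x y * (swap a b * α) with hβ
  have hne : ∀ z, z ≠ a → z ≠ b → z ≠ x → z ≠ y → β z = α z := by
    intro z h1 h2 h3 h4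
    have e1 : α z ≠ a := fun h => h2 (by rw [← hα z, h])
    have e2 : α z ≠ b := fun h => h1 (by rw [← hα z, h, hba])
    have e3 : α z ≠ x := fun h => h4 (by rw [← hα z, h])
    have e4 : α z ≠ y := fun h => h3 (by rw [← hα z, h, hyx])
    rw [hβ, mul_apply, mul_apply, swap_apply_of_ne_of_ne e1 e2, swap_apply_of_ne_of_ne e3 e4]
  have hβa : β a = a := by
    rw [hβ, mul_apply, mul_apply, ← hb, swap_apply_right,
      swap_apply_of_ne_of_ne hax.ne (hax.trans hxy).ne]
  have hβb : β b = b := by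
    rw [hβ, mul_apply, mul_apply, hba, swap_apply_left,
      swap_apply_of_ne_of_ne hxb.ne' hby.ne]
  have hβx : β x = x := by
    rw [hβ, mul_apply, mul_apply, ← hy, swap_apply_of_ne_of_ne (hax.trans hxy).ne' hby.ne',
      swap_apply_right]
  have hβy : β y = y := by
    rw [hβ, mul_apply, mul_apply, hyx, swap_apply_of_ne_of_ne hax.ne' hxb.ne,
      swap_apply_left]
  have hβi : ∀ z, β (β z) = z := by
    intro z
    by_cases h1 : z = a
    · rw [h1, hβa, hβa]
    by_cases h2 : z = b
    · rw [h2, hβb, hβb]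
    by_cases h3 : z = x
    · rw [h3, hβx, hβx]
    by_cases h4 : z = y
    · rw [h4, hβy, hβy]
    have e1 : α z ≠ a := fun h => h2 (by rw [← hα z, h])
    have e2 : α z ≠ b := fun h => h1 (by rw [← hα z, h, hba])
    have e3 : α z ≠ x := fun h => h4 (by rw [← hα z, h])
    have e4 : α z ≠ y := fun h => h3 (by rw [← hα z, h, hyx])
    rw [hne z h1 h2 h3 h4, hne _ e1 e2 e3 e4, hα]
  have hsupp : β.support.card + 4 ≤ Fintype.card D := by
    have hd : ({a, x, b, y} : Finset D).card = 4 := by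
      rw [Finset.card_insert_of_notMem, Finset.card_insert_of_notMem, Finset.card_pair hby.ne]
      · simp [hxb.ne, hxy.ne]
      · simp [hax.ne, hab.ne, (hax.trans hxy).ne]
    rw [← hd, ← Finset.card_union_of_disjoint]
    · exact Finset.card_le_univ _
    · rw [Finset.disjoint_right]
      intro z hz
      simp only [Finset.mem_insert, Finset.mem_singleton] at hz
      rcases hz with rfl | rfl | rfl | rfl <;> simpa
  have h5 := numCycles_mul_involution_le (c * swap a b * swap x y) β hβi
  have h6 : c * swap a b * swap x y * β = c * α := by
    rw [hβ]
    simp only [mul_assoc]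
    rw [← mul_assoc (swap x y) (swap x y), swap_mul_self, one_mul, ← mul_assoc (swap a b),
      swap_mul_self, one_mul]
  rw [h6] at h5
  omega

/-- The product of transpositions `swap (s 0) (s 1) * ⋯ * swap (s 0) (s j)`. -/
def swapProd [DecidableEq D] (s : ℕ → D) : ℕ → Perm D
  | 0 => 1
  | j + 1 => swapProd s j * swap (s 0) (s (j + 1))

theorem swapProd_apply_of_ne [DecidableEq D] {s : ℕ → D} {j : ℕ} {x : D}
    (h : ∀ i ≤ j, x ≠ s i) : swapProd s j x = x := by
  induction j with
  | zero => rfl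
  | succ j ih =>
    rw [swapProd, mul_apply, swap_apply_of_ne_of_ne (h 0 (by omega)) (h _ le_rfl),
      ih fun i hi => h i (by omega)]

theorem swapProd_apply_zero [DecidableEq D] {s : ℕ → D} {j : ℕ}
    (hs : ∀ i k, i < k → k ≤ j → s i ≠ s k) : swapProd s j (s 0) = s j := by
  cases j with
  | zero => rfl
  | succ j =>
    rw [swapProd, mul_apply, swap_apply_left]
    exact swapProd_apply_of_ne fun i hi => (hs i (j + 1) (by omega) le_rfl).symm

theorem swapProd_apply_succ [DecidableEq D] {s : ℕ → D} {j : ℕ}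
    (hs : ∀ i k, i < k → k ≤ j → s i ≠ s k) {i : ℕ} (hi : i < j) :
    swapProd s j (s (i + 1)) = s i := by
  induction j with
  | zero => omega
  | succ j ih =>
    have hs' : ∀ i k, i < k → k ≤ j → s i ≠ s k := fun i k h1 h2 => hs i k h1 (by omega)
    rw [swapProd, mul_apply]
    rcases (Nat.lt_succ_iff.1 hi).eq_or_lt with rfl | hi'
    · rw [swap_apply_right]
      exact swapProd_apply_zero hs'
    · rw [swap_apply_of_ne_of_ne (hs 0 (i + 1) (by omega) (by omega)).symm
        (hs (i + 1) (j + 1) (by omega) le_rfl), ih hs' hi']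

/-- If a cycle of `ψ` visits `s 0, s 1, …, s j` in this order, then multiplication by the product of
transpositions splits it into `j + 1` cycles. -/
theorem numCycles_swapProd_mul [Finite D] [DecidableEq D] {s : ℕ → D} {t : ℕ → ℕ} {w : ℕ → D}
    {j : ℕ} (ψ : Perm D) (ht : ∀ i < j, t i < t (i + 1)) (ht0 : t 0 = 0)
    (hs : ∀ i ≤ j, s i = w (t i)) (hw : ∀ k ≤ t j, ∀ l ≤ t j, w k = w l → k = l)
    (hψ : ∀ k < t j, ψ (w k) = w (k + 1)) :
    (swapProd s j * ψ).numCycles = ψ.numCycles + j := by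
  induction j generalizing ψ with
  | zero => simp [swapProd]
  | succ j ih =>
    have h1 : t j < t (j + 1) := ht j (by omega)
    have hpow : ∀ k ≤ t (j + 1), (ψ ^ k) (w 0) = w k := fun k hk => by
      induction k with
      | zero => rfl
      | succ k ihk => rw [pow_succ', mul_apply, ihk (by omega), hψ k (by omega)]
    have hs0 : s 0 = w 0 := by rw [hs 0 (by omega), ht0]
    have hsj := hs (j + 1) le_rfl
    have hsame : ψ.SameCycle (s 0) (s (j + 1)) :=
      sameCycle_of_pow_apply (t (j + 1)) (by rw [hs0, hsj, hpow _ le_rfl])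
    have hne : s 0 ≠ s (j + 1) := fun h => by
      have := hw 0 (by omega) (t (j + 1)) le_rfl (by rw [← hs0, ← hsj, h])
      omega
    rw [swapProd, mul_assoc, ih _ (fun i hi => ht i (by omega)) (fun i hi => hs i (by omega))
      (fun k hk l hl => hw k (by omega) l (by omega)), numCycles_swap_mul_of_sameCycle hne hsame]
    · ring
    · intro k hk
      rw [mul_apply, hψ k (by omega), swap_apply_of_ne_of_ne]
      · rw [hs0]
        intro h
        have := hw (k + 1) (by omega) 0 (by omega) h
        omega
      · rw [hsj]
        intro h
        have := hw (k + 1) (by omega) _ le_rfl h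
        omega

/-- A fixed point free involution has half as many cycles as there are points. -/
theorem two_mul_numCycles_involution [Finite D] {α : Perm D} (hα : ∀ x, α (α x) = x)
    (hα' : ∀ x, α x ≠ x) : 2 * α.numCycles = Nat.card D := by
  classical
  have := Fintype.ofFinite D
  have hsame : ∀ x y, α.SameCycle x y ↔ y = x ∨ y = α x := by
    intro x y
    constructor
    · intro h
      refine h.mem_of_forall_apply_mem (s := {y | y = x ∨ y = α x}) ?_ (Or.inl rfl)
      rintro z (rfl | rfl)
      · exact Or.inr rfl
      · exact Or.inl (hα _)
    · rintro (rfl | rfl)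
      · exact SameCycle.refl _ _
      · exact sameCycle_apply_right.2 (SameCycle.refl _ _)
  have := Fintype.ofFinite (Quotient (SameCycle.setoid α))
  rw [numCycles, Nat.card_eq_fintype_card, Nat.card_eq_fintype_card, ← Finset.card_univ (α := D),
    Finset.card_eq_sum_card_fiberwise (f := fun x => (⟦x⟧ : Quotient (SameCycle.setoid α)))
      (t := Finset.univ) (fun _ _ => Finset.mem_coe.2 (Finset.mem_univ _)),
    Finset.sum_const_nat (m := 2), Finset.card_univ, mul_comm]
  intro q _
  induction q using Quotient.inductionOn with | _ x
  have : (Finset.univ.filter fun a => (⟦a⟧ : Quotient (SameCycle.setoid α)) = ⟦x⟧) = {x, α x} := by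
    ext y
    simp only [Finset.mem_filter, Finset.mem_univ, true_and, Finset.mem_insert,
      Finset.mem_singleton]
    rw [← hsame, sameCycle_comm]
    exact ⟨fun h => Quotient.exact h, fun h => Quotient.sound h⟩
  rw [this, Finset.card_pair (hα' x).symm]

end Equiv.Perm

/-! ### Laplace's method and coefficients of large powers -/

open MeasureTheory Topology in
/-- Laplace's method for the integral of a large power of `ψ` over the circle: the mass concentrates
at `0`, where `ψ` has the expansion `1 - s θ² + o(θ²)`. -/
theorem tendsto_sqrt_mul_integral_pow {ψ g : ℝ → ℂ} {c s : ℝ} (hc : 0 < c)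
    (hψ : Continuous ψ) (hg : Continuous g)
    (hb : ∀ θ, |θ| ≤ Real.pi → ‖ψ θ‖ ≤ Real.exp (-c * θ ^ 2))
    (hs : Tendsto (fun θ : ℝ => (ψ θ - 1) / (θ : ℂ) ^ 2) (𝓝[≠] 0) (𝓝 (-s : ℂ))) :
    Tendsto (fun N : ℕ => (√N : ℂ) * ∫ θ in (-Real.pi)..Real.pi, ψ θ ^ N * g θ) atTop
      (𝓝 (√(Real.pi / s) * g 0)) := by
  obtain ⟨C, hC⟩ : ∃ C, ∀ θ ∈ Set.Icc (-Real.pi) Real.pi, ‖g θ‖ ≤ C :=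
    isCompact_Icc.exists_bound_of_continuousOn hg.continuousOn
  have hC0 : 0 ≤ C := (norm_nonneg _).trans (hC 0 ⟨by linarith [Real.pi_pos], Real.pi_pos.le⟩)
  have hψ0 : ψ 0 = 1 := by
    have h1 : Tendsto (fun θ : ℝ => (ψ θ - 1) / (θ : ℂ) ^ 2 * (θ : ℂ) ^ 2) (𝓝[≠] 0) (𝓝 0) := by
      have : Tendsto (fun θ : ℝ => (θ : ℂ) ^ 2) (𝓝[≠] 0) (𝓝 0) := by
        have : Continuous fun θ : ℝ => (θ : ℂ) ^ 2 := by fun_prop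
        simpa using (this.tendsto 0).mono_left nhdsWithin_le_nhds
      simpa using hs.mul this
    have h2 : Tendsto (fun θ : ℝ => ψ θ - 1) (𝓝[≠] 0) (𝓝 0) := by
      refine h1.congr' ?_
      filter_upwards [self_mem_nhdsWithin] with θ hθ
      have : (θ : ℂ) ≠ 0 := by simpa using hθ
      field_simp
    have h3 : Tendsto (fun θ : ℝ => ψ θ - 1) (𝓝[≠] 0) (𝓝 (ψ 0 - 1)) :=
      (hψ.tendsto 0).mono_left nhdsWithin_le_nhds |>.sub_const 1
    exact sub_eq_zero.1 (tendsto_nhds_unique h3 h2)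
  -- after the substitution `θ = x / √N`
  set F : ℕ → ℝ → ℂ := fun N => (Set.Ioc (-Real.pi * √N) (Real.pi * √N)).indicator
    fun x => ψ (x / √N) ^ N * g (x / √N) with hF
  have hint : ∀ N : ℕ, 0 < N →
      (√N : ℂ) * ∫ θ in (-Real.pi)..Real.pi, ψ θ ^ N * g θ = ∫ x, F N x := by
    intro N hN
    have hN' : (0 : ℝ) < √N := Real.sqrt_pos.2 (by exact_mod_cast hN)
    have := intervalIntegral.integral_comp_div (a := -Real.pi * √N) (b := Real.pi * √N)
      (fun θ => ψ θ ^ N * g θ) hN'.ne'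
    rw [mul_div_cancel_right₀ _ hN'.ne', mul_div_cancel_right₀ _ hN'.ne'] at this
    rw [hF]
    simp only
    rw [integral_indicator measurableSet_Ioc, ← intervalIntegral.integral_of_le, this,
      Complex.real_smul]
    nlinarith [Real.pi_pos]
  have hlim : Tendsto (fun N => ∫ x, F N x) atTop
      (𝓝 (∫ x : ℝ, Complex.exp (-s * x ^ 2) * g 0)) := by
    refine tendsto_integral_of_dominated_convergence
      (fun x => Real.exp (-c * x ^ 2) * C) ?_ ?_ ?_ ?_
    · intro N
      exact (((by fun_prop : Continuous fun x : ℝ => ψ (x / √N) ^ N * g (x / √N))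
        ).aestronglyMeasurable).indicator measurableSet_Ioc
    · exact (integrable_exp_neg_mul_sq hc).mul_const C
    · intro N
      refine Eventually.of_forall fun x => ?_
      simp only [hF]
      rw [Set.indicator_apply]
      split_ifs with hx
      · have hN : 0 < √(N : ℝ) := by
          by_contra h
          have : √(N : ℝ) = 0 := le_antisymm (not_lt.1 h) (Real.sqrt_nonneg _)
          simp [this] at hx
        have hN0 : (N : ℝ) ≠ 0 := fun h => by simp [h] at hN
        have hx1 : -Real.pi ≤ x / √N := by rw [le_div_iff₀ hN]; exact hx.1.le
        have hx2 : x / √N ≤ Real.pi := by rw [div_le_iff₀ hN]; exact hx.2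
        rw [norm_mul, norm_pow]
        refine mul_le_mul ?_ (hC _ ⟨hx1, hx2⟩) (norm_nonneg _) (Real.exp_pos _).le
        refine (pow_le_pow_left₀ (norm_nonneg _) (hb _ (abs_le.2 ⟨hx1, hx2⟩)) N).trans_eq ?_
        rw [← Real.exp_nat_mul, div_pow, Real.sq_sqrt (Nat.cast_nonneg _)]
        congr 1
        field_simp
      · rw [norm_zero]
        exact mul_nonneg (Real.exp_pos _).le hC0
    · refine Eventually.of_forall fun x => ?_
      have hsq : Tendsto (fun N : ℕ => √(N : ℝ)) atTop atTop :=
        Real.tendsto_sqrt_atTop.comp tendsto_natCast_atTop_atTop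
      have hx0 : Tendsto (fun N : ℕ => x / √(N : ℝ)) atTop (𝓝 0) := hsq.const_div_atTop x
      have hpow : Tendsto (fun N : ℕ => ψ (x / √(N : ℝ)) ^ N) atTop
          (𝓝 (Complex.exp (-s * x ^ 2))) := by
        by_cases hx : x = 0
        · simp [hx, hψ0]
        have h1 : Tendsto (fun N : ℕ => (N : ℂ) * (ψ (x / √(N : ℝ)) - 1)) atTop
            (𝓝 (-s * x ^ 2)) := by
          have h2 : Tendsto (fun N : ℕ => x / √(N : ℝ)) atTop (𝓝[≠] 0) := by
            refine tendsto_nhdsWithin_iff.2 ⟨hx0, ?_⟩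
            filter_upwards [eventually_gt_atTop 0] with N hN
            have : √(N : ℝ) ≠ 0 := (Real.sqrt_pos.2 (by exact_mod_cast hN)).ne'
            simp [hx, this]
          refine ((hs.comp h2).mul_const ((x : ℂ) ^ 2)).congr' ?_
          filter_upwards [eventually_gt_atTop 0] with N hN
          have h3 : √(N : ℝ) ≠ 0 := (Real.sqrt_pos.2 (by exact_mod_cast hN)).ne'
          have h4 : ((√(N : ℝ) : ℝ) : ℂ) ^ 2 = N := by
            rw [← Complex.ofReal_pow, Real.sq_sqrt (Nat.cast_nonneg _), Complex.ofReal_natCast]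
          have hx' : (x : ℂ) ≠ 0 := by exact_mod_cast hx
          have h5 : ((√(N : ℝ) : ℝ) : ℂ) ≠ 0 := by exact_mod_cast h3
          simp only [Function.comp]
          rw [← h4, Complex.ofReal_div, div_pow]
          field_simp
        have := Complex.tendsto_one_add_pow_exp_of_tendsto h1
        simpa using this
      have hgl : Tendsto (fun N : ℕ => g (x / √(N : ℝ))) atTop (𝓝 (g 0)) :=
        (hg.tendsto 0).comp hx0
      refine (hpow.mul hgl).congr' ?_
      filter_upwards [(hsq.const_mul_atTop Real.pi_pos).eventually_gt_atTop |x|] with N hN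
      simp only [hF]
      rw [Set.indicator_of_mem]
      have := abs_lt.1 hN
      exact ⟨by linarith [this.1], this.2.le⟩
  have hval : ∫ x : ℝ, Complex.exp (-s * x ^ 2) * g 0 = √(Real.pi / s) * g 0 := by
    rw [integral_mul_const, ← integral_gaussian, ← integral_complex_ofReal]
    congr 2
    ext x
    push_cast
    rfl
  rw [← hval]
  refine hlim.congr' ?_
  filter_upwards [eventually_gt_atTop 0] with N hN
  exact (hint N hN).symm

/-- The power series `F` converges absolutely on the circle of radius `τ`, to the function `f`. -/
def PowerSeries.HasSumOnCircle (F : PowerSeries ℝ) (τ : ℝ) (f : ℂ → ℂ) : Prop :=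
  (Summable fun k => ‖F.coeff k * τ ^ k‖) ∧
    ∀ z : ℂ, ‖z‖ = τ → HasSum (fun k => (F.coeff k : ℂ) * z ^ k) (f z)

namespace PowerSeries.HasSumOnCircle

variable {F G : PowerSeries ℝ} {τ : ℝ} {f g : ℂ → ℂ}

theorem norm_coeff_mul_pow {z : ℂ} (hz : ‖z‖ = τ) (k : ℕ) :
    ‖(F.coeff k : ℂ) * z ^ k‖ = ‖F.coeff k * τ ^ k‖ := by
  rw [norm_mul, norm_pow, hz, norm_mul, norm_pow, Complex.norm_real, Real.norm_of_nonneg (r := τ)]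
  exact hz ▸ norm_nonneg z

theorem mul (hF : F.HasSumOnCircle τ f) (hG : G.HasSumOnCircle τ g) :
    (F * G).HasSumOnCircle τ (fun z => f z * g z) := by
  constructor
  · refine (summable_norm_sum_mul_antidiagonal_of_summable_norm hF.1 hG.1).congr fun n => ?_
    rw [coeff_mul, Finset.sum_mul]
    congr 1
    refine Finset.sum_congr rfl fun kl hkl => ?_
    rw [← Finset.HasAntidiagonal.mem_antidiagonal.1 hkl, pow_add]
    ring
  · intro z hz
    have h1 : Summable fun k => ‖(F.coeff k : ℂ) * z ^ k‖ := by
      simpa only [norm_coeff_mul_pow hz] using hF.1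
    have h2 : Summable fun k => ‖(G.coeff k : ℂ) * z ^ k‖ := by
      simpa only [norm_coeff_mul_pow hz] using hG.1
    have h3 := tsum_mul_tsum_eq_tsum_sum_antidiagonal_of_summable_norm h1 h2
    have h4 := (summable_norm_sum_mul_antidiagonal_of_summable_norm h1 h2).of_norm.hasSum
    rw [← h3, (hF.2 z hz).tsum_eq, (hG.2 z hz).tsum_eq] at h4
    refine h4.congr_fun fun n => ?_
    rw [coeff_mul, Complex.ofReal_sum, Finset.sum_mul]
    refine Finset.sum_congr rfl fun kl hkl => ?_
    rw [← Finset.HasAntidiagonal.mem_antidiagonal.1 hkl, pow_add, Complex.ofReal_mul]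
    ring

theorem one : (1 : PowerSeries ℝ).HasSumOnCircle τ (fun _ => 1) := by
  constructor
  · refine summable_of_ne_finset_zero (s := {0}) fun k hk => ?_
    rw [coeff_one, if_neg (by simpa using hk)]
    simp
  · intro z _
    convert hasSum_ite_eq (0 : ℕ) (1 : ℂ) using 2 with k
    rw [coeff_one]
    split_ifs with h <;> simp [h]

theorem pow (hF : F.HasSumOnCircle τ f) (n : ℕ) :
    (F ^ n).HasSumOnCircle τ (fun z => f z ^ n) := by
  induction n with
  | zero => simpa using one
  | succ n ih => simpa only [pow_succ] using ih.mul hF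

open MeasureTheory in
/-- Cauchy's formula for the coefficients. -/
theorem integral_eq (hF : F.HasSumOnCircle τ f) (hτ : 0 ≤ τ) (n : ℕ) :
    ∫ θ in (-Real.pi)..Real.pi, f (τ * Complex.exp (θ * Complex.I)) *
        Complex.exp (-(n * (θ * Complex.I))) = 2 * Real.pi * F.coeff n * τ ^ n := by
  have hz : ∀ θ : ℝ, ‖(τ : ℂ) * Complex.exp (θ * Complex.I)‖ = τ := fun θ => by
    rw [norm_mul, Complex.norm_exp_ofReal_mul_I, mul_one, Complex.norm_real,
      Real.norm_of_nonneg hτ]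
  have he : ∀ θ : ℝ, ‖Complex.exp (-(n * (θ * Complex.I)))‖ = 1 := fun θ => by
    rw [show -((n : ℂ) * (θ * Complex.I)) = ((-n * θ : ℝ) : ℂ) * Complex.I by push_cast; ring]
    exact Complex.norm_exp_ofReal_mul_I _
  have h1 := intervalIntegral.hasSum_integral_of_dominated_convergence
    (μ := volume) (a := -Real.pi) (b := Real.pi)
    (F := fun k θ => (F.coeff k : ℂ) * (τ * Complex.exp (θ * Complex.I)) ^ k *
      Complex.exp (-(n * (θ * Complex.I))))
    (f := fun θ => f (τ * Complex.exp (θ * Complex.I)) * Complex.exp (-(n * (θ * Complex.I))))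
    (fun k _ => ‖F.coeff k * τ ^ k‖)
    (fun k => (by fun_prop : Continuous _).aestronglyMeasurable)
    (fun k => Eventually.of_forall fun θ _ => by
      rw [norm_mul, he, mul_one, norm_coeff_mul_pow (hz θ)])
    (Eventually.of_forall fun _ _ => hF.1)
    (by simp)
    (Eventually.of_forall fun θ _ => (hF.2 _ (hz θ)).mul_right _)
  have h2 : ∀ k, ∫ θ in (-Real.pi)..Real.pi, (F.coeff k : ℂ) *
      (τ * Complex.exp (θ * Complex.I)) ^ k * Complex.exp (-(n * (θ * Complex.I))) =
        if k = n then (2 * Real.pi * F.coeff n * τ ^ n : ℂ) else 0 := by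
    intro k
    have h3 : ∀ θ : ℝ, (F.coeff k : ℂ) * (τ * Complex.exp (θ * Complex.I)) ^ k *
        Complex.exp (-(n * (θ * Complex.I))) =
          F.coeff k * τ ^ k * Complex.exp (((k : ℂ) - n) * Complex.I * θ) := by
      intro θ
      rw [mul_pow, ← Complex.exp_nat_mul, mul_assoc, mul_assoc, ← Complex.exp_add, mul_assoc]
      congr 3
      ring
    simp only [h3]
    rw [intervalIntegral.integral_const_mul]
    split_ifs with hkn
    · subst hkn
      simp
      ring
    · have hkn' : ((k : ℂ) - n) ≠ 0 := sub_ne_zero.2 (by exact_mod_cast hkn)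
      rw [integral_exp_mul_complex (mul_ne_zero hkn' Complex.I_ne_zero)]
      have : Complex.exp (((k : ℂ) - n) * Complex.I * Real.pi) =
          Complex.exp (((k : ℂ) - n) * Complex.I * (-Real.pi : ℝ)) := by
        rw [Complex.exp_eq_exp_iff_exists_int]
        refine ⟨(k : ℤ) - n, ?_⟩
        push_cast
        ring
      rw [this, sub_self, zero_div, mul_zero]
  simp only [h2] at h1
  exact h1.unique (hasSum_ite_eq n _)

end PowerSeries.HasSumOnCircle

open Topology in
/-- Coefficients of large powers: the saddle point method for the coefficient of `t ^ (N - 1)` in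
`Φ ^ N * H`. The saddle point equation for `τ` is hidden in `hs`: the expansion of
`φ (τ e^{iθ}) / φ τ * e^{-iθ}` at `θ = 0` has no linear term. -/
theorem tendsto_coeff_pow_mul {Φ H : PowerSeries ℝ} {τ c s : ℝ} {φ h : ℂ → ℂ} (hτ : 0 < τ)
    (hΦ : Φ.HasSumOnCircle τ φ) (hH : H.HasSumOnCircle τ h) (hc : 0 < c) (hφ0 : φ τ ≠ 0)
    (hφ : Continuous fun θ : ℝ => φ (τ * Complex.exp (θ * Complex.I)))
    (hh : Continuous fun θ : ℝ => h (τ * Complex.exp (θ * Complex.I)))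
    (hb : ∀ θ : ℝ, |θ| ≤ Real.pi →
      ‖φ (τ * Complex.exp (θ * Complex.I)) / φ τ‖ ≤ Real.exp (-c * θ ^ 2))
    (hs : Tendsto (fun θ : ℝ => (φ (τ * Complex.exp (θ * Complex.I)) / φ τ *
      Complex.exp (-(θ * Complex.I)) - 1) / (θ : ℂ) ^ 2) (𝓝[≠] 0) (𝓝 (-s : ℂ))) :
    Tendsto (fun N : ℕ => (√N : ℂ) * (((Φ ^ N * H).coeff (N - 1) : ℝ) * (τ / φ τ) ^ N)) atTop
      (𝓝 (τ * h τ * √(Real.pi / s) / (2 * Real.pi))) := by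
  have hpi : (Real.pi : ℂ) ≠ 0 := by exact_mod_cast Real.pi_ne_zero
  have hτ' : (τ : ℂ) ≠ 0 := by exact_mod_cast hτ.ne'
  have h1 := tendsto_sqrt_mul_integral_pow (c := c) (s := s)
    (ψ := fun θ => φ (τ * Complex.exp (θ * Complex.I)) / φ τ * Complex.exp (-(θ * Complex.I)))
    (g := fun θ => h (τ * Complex.exp (θ * Complex.I)) * Complex.exp (θ * Complex.I)) hc
    ((hφ.div_const _).mul (by fun_prop)) (hh.mul (by fun_prop)) (fun θ hθ => by
      rw [norm_mul, show -((θ : ℂ) * Complex.I) = ((-θ : ℝ) : ℂ) * Complex.I by push_cast; ring,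
        Complex.norm_exp_ofReal_mul_I, mul_one]
      exact hb θ hθ) hs
  have h2 := h1.mul_const ((τ : ℂ) / (2 * Real.pi))
  convert h2.congr' ?_ using 2
  · simp
    ring
  filter_upwards [eventually_gt_atTop 0] with N hN
  have h3 := ((hΦ.pow N).mul hH).integral_eq hτ.le (N - 1)
  have h4 : ∀ θ : ℝ, (φ (τ * Complex.exp (θ * Complex.I)) / φ τ *
      Complex.exp (-(θ * Complex.I))) ^ N *
        (h (τ * Complex.exp (θ * Complex.I)) * Complex.exp (θ * Complex.I)) =
      ((φ τ)⁻¹) ^ N * (φ (τ * Complex.exp (θ * Complex.I)) ^ N *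
        h (τ * Complex.exp (θ * Complex.I)) * Complex.exp (-((N - 1 : ℕ) * (θ * Complex.I)))) := by
    intro θ
    have : Complex.exp (-((N - 1 : ℕ) * (θ * Complex.I))) =
        Complex.exp (-(θ * Complex.I)) ^ N * Complex.exp (θ * Complex.I) := by
      rw [← Complex.exp_nat_mul, ← Complex.exp_add]
      congr 1
      rw [Nat.cast_sub hN]
      push_cast
      ring
    rw [this, mul_pow, div_eq_mul_inv, mul_pow]
    ring
  simp only [h4]
  rw [intervalIntegral.integral_const_mul, h3, div_pow, inv_pow]
  have h5 : (τ : ℂ) ^ N = τ ^ (N - 1) * τ := by rw [← pow_succ, Nat.sub_add_cancel hN]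
  rw [h5]
  field_simp

/-! ### Asymptotics of the two coefficient sequences -/

/-- The generating function `∑ 2 ^ ⌊m / d⌋ t ^ m` of the steps of the paths that encode the maps. -/
noncomputable def stepSeries (d : ℕ) : PowerSeries ℝ := PowerSeries.mk fun m => 2 ^ (m / d)

/-- The power series of `1 / (1 - t) ^ 2`. -/
noncomputable def weightSeries : PowerSeries ℝ := PowerSeries.mk fun m => (m : ℝ) + 1

theorem hasSumOnCircle_weightSeries {τ : ℝ} (h0 : 0 ≤ τ) (h1 : τ < 1) :
    weightSeries.HasSumOnCircle τ fun z => (1 - z)⁻¹ * (1 - z)⁻¹ := by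
  have hg : (PowerSeries.mk fun _ => (1 : ℝ)).HasSumOnCircle τ fun z => (1 - z)⁻¹ := by
    constructor
    · simpa [abs_of_nonneg h0] using summable_geometric_of_lt_one h0 h1
    · intro z hz
      simpa using hasSum_geometric_of_norm_lt_one (hz ▸ h1)
  convert hg.mul hg
  ext m
  simp [weightSeries, PowerSeries.coeff_mul]

theorem hasSumOnCircle_stepSeries_one {τ : ℝ} (h0 : 0 ≤ τ) (h1 : 2 * τ < 1) :
    (stepSeries 1).HasSumOnCircle τ fun z => (1 - 2 * z)⁻¹ := by
  constructor
  · refine (summable_geometric_of_lt_one (r := 2 * τ) (by positivity) h1).congr fun k => ?_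
    rw [stepSeries, PowerSeries.coeff_mk, Nat.div_one, ← mul_pow,
      Real.norm_of_nonneg (by positivity)]
  · intro z hz
    have := hasSum_geometric_of_norm_lt_one (ξ := 2 * z) (by rw [norm_mul, hz]; simpa using h1)
    simpa [stepSeries, mul_pow] using this

theorem hasSumOnCircle_stepSeries_two {τ : ℝ} (h0 : 0 ≤ τ) (h1 : 2 * τ ^ 2 < 1) :
    (stepSeries 2).HasSumOnCircle τ fun z => (1 + z) * (1 - 2 * z ^ 2)⁻¹ := by
  have key : ∀ z : ℂ, ‖z‖ = τ →
      HasSum (fun k => ((stepSeries 2).coeff k : ℂ) * z ^ k) ((1 + z) * (1 - 2 * z ^ 2)⁻¹) := by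
    intro z hz
    have h2 := hasSum_geometric_of_norm_lt_one (ξ := 2 * z ^ 2)
      (by rw [norm_mul, norm_pow, hz]; simpa using h1)
    rw [add_mul, one_mul]
    refine HasSum.even_add_odd ?_ ?_
    · refine h2.congr_fun fun k => ?_
      simp [stepSeries, mul_pow, pow_mul]
    · refine (h2.mul_left z).congr_fun fun k => ?_
      have : (2 * k + 1) / 2 = k := by omega
      simp [stepSeries, mul_pow, pow_mul, pow_succ, this]
      ring
  refine ⟨?_, key⟩
  have := (key τ (by simpa using h0)).summable.norm
  refine this.congr fun k => ?_
  rw [← Complex.norm_real]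
  push_cast
  rfl

open Topology in
/-- The passage from `N` to the number `n = N + 1` of vertices. -/
theorem isEquivalent_of_tendsto {a b : ℕ → ℝ} {L r : ℝ} (hL : L ≠ 0) (hr : 0 < r)
    (hab : ∀ N, 0 < N → a (N + 1) = b N / N)
    (hb : Tendsto (fun N : ℕ => √(N : ℝ) * (b N * r ^ N)) atTop (𝓝 L)) :
    a ~[atTop] fun n : ℕ => L * r * (r ^ n)⁻¹ * (n : ℝ) ^ (-(3 / 2) : ℝ) := by
  rw [isEquivalent_iff_tendsto_one, ← tendsto_add_atTop_iff_nat 1]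
  · have h1 : Tendsto (fun N : ℕ => (1 + 1 / (N : ℝ)) ^ (3 / 2 : ℝ)) atTop (𝓝 1) := by
      have : Tendsto (fun N : ℕ => 1 + 1 / (N : ℝ)) atTop (𝓝 1) := by
        simpa using (tendsto_one_div_atTop_nhds_zero_nat (𝕜 := ℝ)).const_add 1
      simpa using this.rpow_const (p := 3 / 2) (Or.inr (by norm_num))
    have h2 := (hb.div_const L).mul h1
    rw [div_self hL, one_mul] at h2
    refine h2.congr' ?_
    filter_upwards [eventually_gt_atTop 0] with N hN
    have hN' : (0 : ℝ) < N := by exact_mod_cast hN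
    have h3 : (1 + 1 / (N : ℝ)) ^ (3 / 2 : ℝ) = ((N + 1 : ℕ) : ℝ) ^ (3 / 2 : ℝ) / (N * √N) := by
      rw [show 1 + 1 / (N : ℝ) = ((N + 1 : ℕ) : ℝ) / N by push_cast; field_simp,
        Real.div_rpow (by positivity) hN'.le]
      congr 1
      rw [show (3 / 2 : ℝ) = 1 + 1 / 2 by norm_num, Real.rpow_add hN', Real.rpow_one,
        ← Real.sqrt_eq_rpow]
    have h4 : (0 : ℝ) < ((N + 1 : ℕ) : ℝ) ^ (3 / 2 : ℝ) := by positivity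
    have h5 : 0 < √(N : ℝ) := Real.sqrt_pos.2 hN'
    rw [Pi.div_apply, hab N hN, h3, Real.rpow_neg (by positivity), pow_succ]
    field_simp
  · filter_upwards [eventually_gt_atTop 0] with n hn
    have : (0 : ℝ) < n := by exact_mod_cast hn
    positivity

open Topology in
theorem tendsto_exp_mul_I_sub_one_sq_div :
    Tendsto (fun θ : ℝ => (Complex.exp (θ * Complex.I) - 1) ^ 2 / (θ : ℂ) ^ 2) (𝓝[≠] 0)
      (𝓝 (-1)) := by
  have h : HasDerivAt (fun θ : ℝ => Complex.exp (θ * Complex.I)) Complex.I 0 := by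
    have := ((hasDerivAt_id (0 : ℝ)).ofReal_comp.mul_const Complex.I).cexp
    simpa using this
  have := (hasDerivAt_iff_tendsto_slope.1 h).pow 2
  rw [Complex.I_sq] at this
  refine this.congr fun θ => ?_
  simp [slope, div_eq_inv_mul, mul_pow]

theorem norm_one_add_mul_exp_sq (τ θ : ℝ) :
    ‖1 + (τ : ℂ) * Complex.exp (θ * Complex.I)‖ ^ 2 =
      (1 + τ) ^ 2 - 2 * τ * (1 - Real.cos θ) := by
  rw [← Complex.normSq_eq_norm_sq, Complex.normSq_apply]
  simp [Complex.exp_ofReal_mul_I_re, Complex.exp_ofReal_mul_I_im]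
  linear_combination τ ^ 2 * Real.sin_sq_add_cos_sq θ

theorem le_one_sub_cos {θ : ℝ} (h : |θ| ≤ Real.pi) :
    2 / Real.pi ^ 2 * θ ^ 2 ≤ 1 - Real.cos θ := by
  linarith [Real.cos_le_one_sub_mul_cos_sq h]

open Topology in
/-- Here `τ = 1 / 4`; in terms of `u = e^{iθ}`, the quotient `φ (τ u) / φ τ` is `1 / (2 - u)`. -/
theorem tendsto_coeff_stepSeries_one :
    Tendsto (fun N : ℕ => √(N : ℝ) * ((stepSeries 1 ^ N * weightSeries).coeff (N - 1) *
      (1 / 8) ^ N)) atTop (𝓝 (2 / (9 * √Real.pi))) := by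
  have hφτ : (1 - 2 * ((1 / 4 : ℝ) : ℂ))⁻¹ = 2 := by push_cast; norm_num
  have hu : ∀ θ : ℝ, 2 - Complex.exp (θ * Complex.I) ≠ 0 := fun θ h => by
    have := Complex.norm_exp_ofReal_mul_I θ
    rw [← sub_eq_zero.1 h] at this
    norm_num at this
  have hφ : ∀ θ : ℝ, (1 - 2 * (((1 / 4 : ℝ) : ℂ) * Complex.exp (θ * Complex.I)))⁻¹ =
      2 * (2 - Complex.exp (θ * Complex.I))⁻¹ := fun θ => by
    have h1 : 1 - 2 * (((1 / 4 : ℝ) : ℂ) * Complex.exp (θ * Complex.I)) =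
        (2 - Complex.exp (θ * Complex.I)) / 2 := by push_cast; ring
    rw [h1, inv_div, div_eq_mul_inv]
  have hh : ∀ θ : ℝ, 1 - ((1 / 4 : ℝ) : ℂ) * Complex.exp (θ * Complex.I) ≠ 0 := fun θ h => by
    have := congrArg norm (sub_eq_zero.1 h)
    rw [norm_mul, Complex.norm_exp_ofReal_mul_I, Complex.norm_real] at this
    norm_num at this
  have hpi := Real.pi_pos
  have h := tendsto_coeff_pow_mul (Φ := stepSeries 1) (H := weightSeries) (τ := 1 / 4)
    (c := 1 / (2 * Real.pi ^ 2)) (s := 1) (by norm_num)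
    (hasSumOnCircle_stepSeries_one (by norm_num) (by norm_num))
    (hasSumOnCircle_weightSeries (by norm_num) (by norm_num)) (by positivity)
    (by rw [hφτ]; norm_num)
    (by
      simp only [hφ]
      exact continuous_const.mul (Continuous.inv₀ (by fun_prop) hu))
    (by
      have := Continuous.inv₀ (f := fun θ : ℝ => 1 - ((1 / 4 : ℝ) : ℂ) *
        Complex.exp (θ * Complex.I)) (by fun_prop) hh
      exact this.mul this)
    (by
      intro θ hθ
      rw [hφ, hφτ, mul_div_cancel_left₀ _ two_ne_zero, norm_inv]
      rw [inv_le_comm₀ (norm_pos_iff.2 (hu θ)) (Real.exp_pos _), ← Real.exp_neg]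
      refine le_of_sq_le_sq ?_ (norm_nonneg _)
      have h1 := norm_one_add_mul_exp_sq (-1 / 2) θ
      have h2 : 2 - Complex.exp (θ * Complex.I) =
          2 * (1 + ((-1 / 2 : ℝ) : ℂ) * Complex.exp (θ * Complex.I)) := by push_cast; ring
      have h3 := le_one_sub_cos hθ
      have hx : θ ^ 2 / Real.pi ^ 2 ≤ 1 := by
        rw [div_le_one (by positivity)]
        exact sq_le_sq' (by linarith [(abs_le.1 hθ).1]) (abs_le.1 hθ).2
      have hx0 : 0 ≤ θ ^ 2 / Real.pi ^ 2 := by positivity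
      have h4 := (abs_le.1 (Real.abs_exp_sub_one_sub_id_le (x := θ ^ 2 / Real.pi ^ 2)
        (by rwa [abs_of_nonneg hx0]))).2
      rw [h2, norm_mul, mul_pow, h1, ← Real.exp_nat_mul]
      have h5 : ((2 : ℕ) : ℝ) * -(-(1 / (2 * Real.pi ^ 2)) * θ ^ 2) = θ ^ 2 / Real.pi ^ 2 := by
        push_cast
        field_simp
      have h6 : 2 / Real.pi ^ 2 * θ ^ 2 = 2 * (θ ^ 2 / Real.pi ^ 2) := by ring
      rw [h5]
      rw [h6] at h3
      rw [Complex.norm_two]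
      nlinarith)
    (by
      have h1 : Tendsto (fun θ : ℝ => (Complex.exp (θ * Complex.I) *
          (2 - Complex.exp (θ * Complex.I)))⁻¹) (𝓝[≠] 0) (𝓝 1) := by
        have : Continuous fun θ : ℝ => (Complex.exp (θ * Complex.I) *
            (2 - Complex.exp (θ * Complex.I)))⁻¹ :=
          Continuous.inv₀ (by fun_prop) fun θ => mul_ne_zero (Complex.exp_ne_zero _) (hu θ)
        have := (this.tendsto 0).mono_left (nhdsWithin_le_nhds (s := {0}ᶜ))
        norm_num at this
        exact this.congr fun θ => by rw [mul_inv, mul_comm]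
      have := tendsto_exp_mul_I_sub_one_sq_div.mul h1
      simp only [hφ, hφτ, Complex.ofReal_one]
      rw [mul_one] at this
      refine this.congr fun θ => ?_
      have h2 := hu θ
      have h3 := Complex.exp_ne_zero (θ * Complex.I)
      rw [Complex.exp_neg]
      field_simp
      ring)
  rw [hφτ] at h
  have h' := (Complex.continuous_re.tendsto _).comp h
  convert h' using 2 with N
  · simp only [Function.comp]
    rw [show ((1 / 4 : ℝ) : ℂ) / 2 = ((1 / 8 : ℝ) : ℂ) by push_cast; norm_num]
    norm_cast
  · have : ((1 / 4 : ℝ) : ℂ) * ((1 - ((1 / 4 : ℝ) : ℂ))⁻¹ * (1 - ((1 / 4 : ℝ) : ℂ))⁻¹) *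
        (√(Real.pi / 1) : ℝ) / (2 * Real.pi) =
        (((1 / 4) * ((1 - 1 / 4)⁻¹ * (1 - 1 / 4)⁻¹) * √Real.pi / (2 * Real.pi) : ℝ) : ℂ) := by
      push_cast
      rw [div_one]
    rw [this, Complex.ofReal_re]
    have h1 : Real.pi = √Real.pi * √Real.pi := (Real.mul_self_sqrt hpi.le).symm
    have h2 : 0 < √Real.pi := Real.sqrt_pos.2 hpi
    conv_rhs => rw [h1]
    rw [Real.sqrt_mul_self h2.le]
    field_simp
    norm_num

open Topology in
/-- Here `τ = (√3 - 1) / 2`, the positive root of `2 τ ^ 2 + 2 τ = 1`. -/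
theorem tendsto_coeff_stepSeries_two :
    Tendsto (fun N : ℕ => √(N : ℝ) * ((stepSeries 2 ^ N * weightSeries).coeff (N - 1) *
      (3 * √3 - 5) ^ N)) atTop
      (𝓝 ((1 + √3) / 3 * √(2 / (3 * (√3 - 1))) / (2 * √Real.pi))) := by
  have hsq : √3 * √3 = (3 : ℝ) := Real.mul_self_sqrt (by norm_num)
  have hlo : (1.7 : ℝ) < √3 := Real.lt_sqrt_of_sq_lt (by norm_num)
  have hhi : √3 < (1.75 : ℝ) := (Real.sqrt_lt' (by norm_num)).2 (by norm_num)
  set τ : ℝ := (√3 - 1) / 2 with hτ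
  have hτ0 : 0 < τ := by rw [hτ]; linarith
  have hτ1 : τ < 1 := by rw [hτ]; linarith
  -- the saddle point equation
  have hτ2 : 2 * τ ^ 2 = 1 - 2 * τ := by rw [hτ]; linear_combination (1 / 2) * hsq
  have hτ2' : 2 * (τ : ℂ) ^ 2 = 1 - 2 * τ := by exact_mod_cast hτ2
  have hτne : (τ : ℂ) ≠ 0 := by exact_mod_cast hτ0.ne'
  have hτne1 : (1 + τ : ℂ) ≠ 0 := by exact_mod_cast (by linarith : (1 + τ : ℝ) ≠ 0)
  have hpi := Real.pi_pos
  have hφτ : (1 + (τ : ℂ)) * (1 - 2 * (τ : ℂ) ^ 2)⁻¹ = (1 + τ) / (2 * τ) := by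
    rw [hτ2', sub_sub_cancel, div_eq_mul_inv]
  have hu : ∀ θ : ℝ, 1 - 2 * ((τ : ℂ) * Complex.exp (θ * Complex.I)) ^ 2 ≠ 0 := fun θ h => by
    have := congrArg norm (sub_eq_zero.1 h)
    rw [norm_mul, norm_pow, norm_mul, Complex.norm_exp_ofReal_mul_I, Complex.norm_real,
      Real.norm_of_nonneg hτ0.le, Complex.norm_two, norm_one, mul_one, hτ2] at this
    linarith
  have hh : ∀ θ : ℝ, 1 - (τ : ℂ) * Complex.exp (θ * Complex.I) ≠ 0 := fun θ h => by
    have := congrArg norm (sub_eq_zero.1 h)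
    rw [norm_mul, Complex.norm_exp_ofReal_mul_I, Complex.norm_real,
      Real.norm_of_nonneg hτ0.le, norm_one] at this
    linarith
  have h := tendsto_coeff_pow_mul (Φ := stepSeries 2) (H := weightSeries) (τ := τ)
    (c := 2 * τ / ((1 + τ) ^ 2 * Real.pi ^ 2)) (s := 3 / (2 * (1 + τ))) hτ0
    (hasSumOnCircle_stepSeries_two hτ0.le (by linarith))
    (hasSumOnCircle_weightSeries hτ0.le hτ1) (by positivity)
    (by rw [hφτ]; exact div_ne_zero hτne1 (mul_ne_zero two_ne_zero hτne))
    (by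
      exact Continuous.mul (by fun_prop) (Continuous.inv₀ (by fun_prop) hu))
    (by
      have := Continuous.inv₀ (f := fun θ : ℝ => 1 - (τ : ℂ) *
        Complex.exp (θ * Complex.I)) (by fun_prop) hh
      exact this.mul this)
    (by
      intro θ hθ
      have h1 := norm_one_add_mul_exp_sq τ θ
      have h2 := le_one_sub_cos hθ
      have h3 : ‖1 + (τ : ℂ) * Complex.exp (θ * Complex.I)‖ ≤
          (1 + τ) * Real.exp (-(2 * τ / ((1 + τ) ^ 2 * Real.pi ^ 2)) * θ ^ 2) := by
        refine le_of_sq_le_sq ?_ (by positivity)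
        have h4 := Real.add_one_le_exp (-(4 * τ / ((1 + τ) ^ 2 * Real.pi ^ 2)) * θ ^ 2)
        rw [h1, mul_pow, ← Real.exp_nat_mul,
          show ((2 : ℕ) : ℝ) * (-(2 * τ / ((1 + τ) ^ 2 * Real.pi ^ 2)) * θ ^ 2) =
            -(4 * τ / ((1 + τ) ^ 2 * Real.pi ^ 2)) * θ ^ 2 by push_cast; ring]
        refine le_trans ?_ (mul_le_mul_of_nonneg_left h4 (by positivity))
        have h5 : (1 + τ) ^ 2 * (-(4 * τ / ((1 + τ) ^ 2 * Real.pi ^ 2)) * θ ^ 2 + 1) =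
            (1 + τ) ^ 2 - 2 * τ * (2 / Real.pi ^ 2 * θ ^ 2) := by
          field_simp
          ring
        rw [h5]
        nlinarith
      have h6 : 2 * τ ≤ ‖1 - 2 * ((τ : ℂ) * Complex.exp (θ * Complex.I)) ^ 2‖ := by
        refine le_trans ?_ (norm_sub_norm_le _ _)
        rw [norm_mul, norm_pow, norm_mul, Complex.norm_exp_ofReal_mul_I, Complex.norm_real,
          Real.norm_of_nonneg hτ0.le, Complex.norm_two, norm_one, mul_one, hτ2]
        linarith
      have h7 : ‖(1 + (τ : ℂ)) / (2 * τ)‖ = (1 + τ) / (2 * τ) := by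
        rw [show (1 + (τ : ℂ)) / (2 * τ) = (((1 + τ) / (2 * τ) : ℝ) : ℂ) by push_cast; rfl,
          Complex.norm_real, Real.norm_of_nonneg (by positivity)]
      rw [hφτ, norm_div, norm_mul, norm_inv, h7, div_le_iff₀ (by positivity), ← div_eq_mul_inv]
      refine (div_le_div₀ (by positivity) h3 (by positivity) h6).trans_eq ?_
      field_simp)
    (by
      have h1 : Tendsto (fun θ : ℝ => (τ : ℂ) * (Complex.exp (θ * Complex.I) + 2) *
          (Complex.exp (θ * Complex.I) * (1 + τ) *
          (1 - 2 * ((τ : ℂ) * Complex.exp (θ * Complex.I)) ^ 2))⁻¹) (𝓝[≠] 0)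
          (𝓝 (3 / (2 * (1 + τ)))) := by
        have : Continuous fun θ : ℝ => (τ : ℂ) * (Complex.exp (θ * Complex.I) + 2) *
            (Complex.exp (θ * Complex.I) * (1 + τ) *
            (1 - 2 * ((τ : ℂ) * Complex.exp (θ * Complex.I)) ^ 2))⁻¹ :=
          Continuous.mul (by fun_prop) (Continuous.inv₀ (by fun_prop) fun θ =>
            mul_ne_zero (mul_ne_zero (Complex.exp_ne_zero _) hτne1) (hu θ))
        have := (this.tendsto 0).mono_left (nhdsWithin_le_nhds (s := {0}ᶜ))
        convert this using 2
        simp only [Complex.ofReal_zero, zero_mul, Complex.exp_zero, mul_one, one_mul]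
        rw [hτ2', sub_sub_cancel]
        field_simp
        norm_num
      have := tendsto_exp_mul_I_sub_one_sq_div.mul h1
      simp only [hφτ]
      push_cast
      rw [neg_one_mul] at this
      refine this.congr fun θ => ?_
      have h2 := hu θ
      have h3 := Complex.exp_ne_zero (θ * Complex.I)
      rw [Complex.exp_neg]
      set u := Complex.exp (θ * Complex.I) with hu'
      have h4 : (1 + τ * u) * (1 - 2 * (τ * u) ^ 2)⁻¹ / ((1 + τ) / (2 * τ)) * u⁻¹ - 1 =
          (u - 1) ^ 2 * (τ * (u + 2) * (u * (1 + τ) * (1 - 2 * (τ * u) ^ 2))⁻¹) := by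
        obtain ⟨w, hw⟩ : ∃ w, w = 1 - 2 * (τ * u) ^ 2 := ⟨_, rfl⟩
        rw [← hw] at h2 ⊢
        field_simp
        -- both sides are `τ (u - 1)² (u + 2)`, by the saddle point equation
        linear_combination (u ^ 3 * τ + u) * hτ2' - (1 + τ) * u * hw
      rw [h4]
      ring)
  rw [hφτ] at h
  have h' := (Complex.continuous_re.tendsto _).comp h
  convert h' using 2 with N
  · simp only [Function.comp]
    have : (τ : ℂ) / ((1 + τ) / (2 * τ)) = ((3 * √3 - 5 : ℝ) : ℂ) := by
      have : τ / ((1 + τ) / (2 * τ)) = 3 * √3 - 5 := by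
        field_simp
        rw [hτ]
        linear_combination -hsq
      rw [← this]
      push_cast
      rfl
    rw [this]
    norm_cast
  · have : (τ : ℂ) * ((1 - (τ : ℂ))⁻¹ * (1 - (τ : ℂ))⁻¹) *
        (√(Real.pi / (3 / (2 * (1 + τ)))) : ℝ) / (2 * Real.pi) =
        ((τ * ((1 - τ)⁻¹ * (1 - τ)⁻¹) * √(Real.pi / (3 / (2 * (1 + τ)))) /
          (2 * Real.pi) : ℝ) : ℂ) := by
      push_cast
      rfl
    rw [this, Complex.ofReal_re]
    have h1 : Real.pi = √Real.pi * √Real.pi := (Real.mul_self_sqrt hpi.le).symm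
    have h2 : 0 < √Real.pi := Real.sqrt_pos.2 hpi
    have h3 : Real.pi / (3 / (2 * (1 + τ))) = Real.pi * (2 / (3 * (√3 - 1))) := by
      have : (√3 - 1) ≠ 0 := by linarith
      field_simp
      rw [hτ]
      linear_combination (1 / 2) * hsq
    have h4 : τ * ((1 - τ)⁻¹ * (1 - τ)⁻¹) = (1 + √3) / 3 := by
      have : 1 - τ ≠ 0 := by linarith
      field_simp
      rw [hτ]
      linear_combination (-√3 / 4 + 5 / 4) * hsq
    rw [h3, h4, Real.sqrt_mul hpi.le]
    conv_rhs => rw [h1]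
    rw [Real.sqrt_mul_self h2.le]
    field_simp

theorem isEquivalent_of_stepSeries_one {a : ℕ → ℝ}
    (ha : ∀ N, 0 < N → a (N + 1) = (stepSeries 1 ^ N * weightSeries).coeff (N - 1) / N) :
    a ~[atTop] fun n : ℕ => 8 ^ n * (n : ℝ) ^ (-(3 / 2) : ℝ) / (36 * √Real.pi) := by
  have hpi := Real.sqrt_pos.2 Real.pi_pos
  refine (isEquivalent_of_tendsto (by positivity) (by norm_num) ha
    tendsto_coeff_stepSeries_one).congr_right (Eventually.of_forall fun n => ?_)
  simp only [one_div, inv_pow, inv_inv]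
  field_simp
  norm_num
  ring

theorem isEquivalent_of_stepSeries_two {a : ℕ → ℝ}
    (ha : ∀ N, 0 < N → a (N + 1) = (stepSeries 2 ^ N * weightSeries).coeff (N - 1) / N) :
    a ~[atTop] fun n : ℕ => (2 * √3 - 3) * √2 / (9 * √(Real.pi * (√3 - 1))) *
        ((3 * √3 - 5) ^ n)⁻¹ * (n : ℝ) ^ (-(3 / 2) : ℝ) := by
  have hsq : √3 * √3 = (3 : ℝ) := Real.mul_self_sqrt (by norm_num)
  have hlo : (1.7 : ℝ) < √3 := Real.lt_sqrt_of_sq_lt (by norm_num)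
  have hpi := Real.sqrt_pos.2 Real.pi_pos
  have h1 : 0 < √3 - 1 := by linarith
  have h2 : 0 < √(√3 - 1) := Real.sqrt_pos.2 h1
  have hL : (1 + √3) / 3 * √(2 / (3 * (√3 - 1))) / (2 * √Real.pi) ≠ 0 := by positivity
  have h := isEquivalent_of_tendsto hL (by linarith) ha tendsto_coeff_stepSeries_two
  have hC : (1 + √3) / 3 * √(2 / (3 * (√3 - 1))) / (2 * √Real.pi) * (3 * √3 - 5) =
      (2 * √3 - 3) * √2 / (9 * √(Real.pi * (√3 - 1))) := by
    rw [Real.sqrt_mul Real.pi_pos.le, Real.sqrt_div zero_le_two, Real.sqrt_mul zero_le_three]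
    have h3 : √3 ≠ 0 := by linarith
    field_simp
    linear_combination (15 : ℝ) * hsq
  rwa [hC] at h

/-! ### Noncrossing graphs and their enumeration -/

/-- A set of edges `u < v` between the vertices `0, …, n - 1` encodes a rooted simple outerplanar
map, with the vertices numbered in the order in which the boundary walk of the outer face first
visits them: no two edges cross when the vertices are placed on a circle, and every vertex but `0`
has a smaller neighbour. -/
structure IsGood (n : ℕ) (E : Finset (ℕ × ℕ)) : Prop where
  lt : ∀ {u v}, (u, v) ∈ E → u < v ∧ v < n
  noncrossing : ∀ {a b x y}, (a, b) ∈ E → (x, y) ∈ E → a < x → x < b → y ≤ b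
  exists_lower : ∀ v, 0 < v → v < n → ∃ u, (u, v) ∈ E

/-- The vertices have labels in `ℤ/d` that increase by one along every edge. For `d = 1` this says
nothing, and for `d = 2` that the graph is bipartite. -/
def IsShifted (d : ℕ) (E : Finset (ℕ × ℕ)) : Prop :=
  ∃ h : ℕ → ZMod d, ∀ u v, (u, v) ∈ E → h v = h u + 1

/-- The vertices that a new vertex, placed after all others, can be joined to without crossings. -/
def visible (n : ℕ) (E : Finset (ℕ × ℕ)) : Finset ℕ :=
  (Finset.range n).filter fun i => ∀ p ∈ E, ¬ (p.1 < i ∧ i < p.2)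

theorem mem_visible {n : ℕ} {E : Finset (ℕ × ℕ)} {i : ℕ} :
    i ∈ visible n E ↔ i < n ∧ ∀ u v, (u, v) ∈ E → u < i → v ≤ i := by
  simp [visible]

open Classical in
/-- The codes of the maps with `n` vertices (for `d = 1`), or of the bipartite ones
(for `d = 2`). -/
noncomputable def goodSets (d n : ℕ) : Finset (Finset (ℕ × ℕ)) :=
  (Finset.range n ×ˢ Finset.range n).powerset.filter fun E => IsGood n E ∧ IsShifted d E

theorem mem_goodSets {d n : ℕ} {E : Finset (ℕ × ℕ)} :
    E ∈ goodSets d n ↔ IsGood n E ∧ IsShifted d E := by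
  simp only [goodSets, Finset.mem_filter, Finset.mem_powerset, and_iff_right_iff_imp]
  rintro ⟨h, -⟩ ⟨u, v⟩ huv
  have := h.lt huv
  simp
  omega

theorem zero_mem_visible {n : ℕ} {E : Finset (ℕ × ℕ)} (hn : 0 < n) : 0 ∈ visible n E :=
  mem_visible.2 ⟨hn, fun _ _ _ h => absurd h (Nat.not_lt_zero _)⟩

/-- Successive visible vertices are adjacent. -/
theorem IsGood.label_visible {d n : ℕ} {E : Finset (ℕ × ℕ)} (hE : IsGood n E) {h : ℕ → ZMod d}
    (hh : ∀ u v, (u, v) ∈ E → h v = h u + 1) :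
    ∀ x ∈ visible n E, h x = h 0 + ((visible n E).filter (· < x)).card := by
  intro x
  induction x using Nat.strong_induction_on with
  | _ x ih =>
  intro hx
  have hx' := mem_visible.1 hx
  rcases Nat.eq_zero_or_pos x with rfl | hx0
  · simp
  classical
  have hex := hE.exists_lower x hx0 hx'.1
  set q := Nat.find hex with hq
  have hqx : (q, x) ∈ E := Nat.find_spec hex
  have hqlt := (hE.lt hqx).1
  have hqv : q ∈ visible n E := by
    refine mem_visible.2 ⟨by omega, fun a b hab haq => ?_⟩
    by_contra! hqb
    have h1 : x ≤ b := hE.noncrossing hab hqx haq hqb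
    rcases h1.eq_or_lt with rfl | h1
    · exact Nat.find_min hex haq hab
    · have := hx'.2 a b hab (by omega)
      omega
  have hcount : (visible n E).filter (· < x) = insert q ((visible n E).filter (· < q)) := by
    ext y
    simp only [Finset.mem_filter, Finset.mem_insert]
    constructor
    · rintro ⟨hy, hyx⟩
      have := (mem_visible.1 hy).2 q x hqx
      by_cases hyq : y < q
      · exact Or.inr ⟨hy, hyq⟩
      · left; by_contra; omega
    · rintro (rfl | ⟨hy, hyq⟩)
      · exact ⟨hqv, hqlt⟩
      · exact ⟨hy, by omega⟩
  rw [hh _ _ hqx, ih q hqlt hqv, hcount, Finset.card_insert_of_notMem (by simp)]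
  push_cast
  ring

/-- The sum over the sets `S` of visible vertices that a new vertex can be joined to, by the number
of vertices that stay visible. If `S` hides `m` vertices, then its elements other than the smallest
one are chosen among the `⌊m / d⌋` hidden vertices with the same label as the smallest one. -/
theorem sum_attachments {d : ℕ} (P : Finset ℕ) (h : ℕ → ZMod d) (h0 : ZMod d)
    (hP : ∀ x ∈ P, h x = h0 + (P.filter (· < x)).card) (f : ℕ → ℝ) :
    ∑ S ∈ P.powerset with S.Nonempty ∧ ∀ x ∈ S, ∀ y ∈ S, h x = h y,
        f (P.filter fun p => ∀ s ∈ S, p ≤ s).card =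
      ∑ j ∈ Finset.range P.card, 2 ^ ((P.card - 1 - j) / d) * f (j + 1) := by
  classical
  induction P using Finset.induction_on_max generalizing f with
  | empty => simp
  | insert x P hx ih =>
    have hxP : x ∉ P := fun h => (hx x h).false
    have hfilt : ∀ y ∈ P, (insert x P).filter (· < y) = P.filter (· < y) := fun y hy => by
      rw [Finset.filter_insert, if_neg (by have := hx y hy; omega)]
    have hP' : ∀ y ∈ P, h y = h0 + (P.filter (· < y)).card := fun y hy => by
      rw [← hfilt y hy]
      exact hP y (Finset.mem_insert_of_mem hy)
    have hxh : h x = h0 + P.card := by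
      rw [hP x (Finset.mem_insert_self _ _), Finset.filter_insert, if_neg (lt_irrefl x),
        Finset.filter_true_of_mem hx]
    -- adding the new largest element `x` to `T` is allowed if the labels agree
    set f' : ℕ → ℝ := fun c => (1 + if d ∣ P.card + 1 - c then 1 else 0) * f c with hf'
    have key : ∀ T ∈ P.powerset, T.Nonempty → (∀ y ∈ T, ∀ z ∈ T, h y = h z) →
        ((∀ y ∈ insert x T, ∀ z ∈ insert x T, h y = h z) ↔
          d ∣ P.card + 1 - (P.filter fun p => ∀ s ∈ T, p ≤ s).card) := by
      intro T hT hTne hTh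
      rw [Finset.mem_powerset] at hT
      set m := T.min' hTne with hm
      have hmT : m ∈ T := T.min'_mem hTne
      have hc : P.filter (fun p => ∀ s ∈ T, p ≤ s) = insert m (P.filter (· < m)) := by
        ext p
        simp only [Finset.mem_filter, Finset.mem_insert]
        constructor
        · rintro ⟨hp, hps⟩
          rcases (hps m hmT).eq_or_lt with h | h
          · exact Or.inl h
          · exact Or.inr ⟨hp, h⟩
        · rintro (rfl | ⟨hp, hpm⟩)
          · exact ⟨hT hmT, fun s hs => T.min'_le s hs⟩
          · exact ⟨hp, fun s hs => hpm.le.trans (T.min'_le s hs)⟩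
      have hle : (P.filter (· < m)).card ≤ P.card := Finset.card_filter_le _ _
      rw [hc, Finset.card_insert_of_notMem (by simp), Nat.add_sub_add_right]
      have h1 : (d ∣ P.card - (P.filter (· < m)).card) ↔ h x = h m := by
        rw [hxh, hP' m (hT hmT), add_right_inj, ← sub_eq_zero, ← Nat.cast_sub hle,
          ZMod.natCast_eq_zero_iff]
      rw [h1]
      constructor
      · intro H
        exact H x (Finset.mem_insert_self _ _) m (Finset.mem_insert_of_mem hmT)
      · intro H y hy z hz
        have : ∀ y ∈ insert x T, h y = h m := fun y hy => by
          rcases Finset.mem_insert.1 hy with rfl | hy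
          · exact H
          · exact hTh y hy m hmT
        rw [this y hy, this z hz]
    have hcard : ∀ T ∈ P.powerset, T.Nonempty → (insert x P).filter (fun p => ∀ s ∈ T, p ≤ s) =
        P.filter fun p => ∀ s ∈ T, p ≤ s := by
      intro T hT hTne
      rw [Finset.filter_insert, if_neg]
      intro H
      obtain ⟨t, ht⟩ := hTne
      have h1 := H t ht
      have h2 := hx t (Finset.mem_powerset.1 hT ht)
      omega
    have hcard' : ∀ T ∈ P.powerset, T.Nonempty →
        (insert x P).filter (fun p => ∀ s ∈ insert x T, p ≤ s) =
        P.filter fun p => ∀ s ∈ T, p ≤ s := by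
      intro T hT hTne
      rw [← hcard T hT hTne]
      refine Finset.filter_congr fun p hp => ?_
      simp only [Finset.mem_insert, forall_eq_or_imp, and_iff_right_iff_imp]
      intro _
      rcases Finset.mem_insert.1 hp with rfl | hp
      · exact le_rfl
      · exact (hx p hp).le
    rw [Finset.sum_filter, Finset.sum_powerset_insert hxP, ← Finset.sum_add_distrib]
    have hsplit : ∀ T ∈ P.powerset,
        ((if T.Nonempty ∧ ∀ y ∈ T, ∀ z ∈ T, h y = h z then
          f ((insert x P).filter fun p => ∀ s ∈ T, p ≤ s).card else 0) +
        if (insert x T).Nonempty ∧ ∀ y ∈ insert x T, ∀ z ∈ insert x T, h y = h z then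
          f ((insert x P).filter fun p => ∀ s ∈ insert x T, p ≤ s).card else 0) =
        (if T.Nonempty ∧ ∀ y ∈ T, ∀ z ∈ T, h y = h z then
          f' (P.filter fun p => ∀ s ∈ T, p ≤ s).card else 0) +
        if T = ∅ then f (P.card + 1) else 0 := by
      intro T hT
      rcases T.eq_empty_or_nonempty with rfl | hTne
      · have : (insert x P).filter (fun p => p ≤ x) = insert x P :=
          Finset.filter_true_of_mem fun p hp => by
            rcases Finset.mem_insert.1 hp with rfl | hp
            · exact le_rfl
            · exact (hx p hp).le
        simp [this, Finset.card_insert_of_notMem hxP]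
      · rw [if_neg hTne.ne_empty, add_zero, hcard T hT hTne, hcard' T hT hTne]
        by_cases hTh : ∀ y ∈ T, ∀ z ∈ T, h y = h z
        · have h1 : T.Nonempty ∧ ∀ y ∈ T, ∀ z ∈ T, h y = h z := ⟨hTne, hTh⟩
          simp only [if_pos h1, hf', key T hT hTne hTh, Finset.insert_nonempty, true_and]
          split_ifs <;> ring
        · have h1 : ¬ (T.Nonempty ∧ ∀ y ∈ T, ∀ z ∈ T, h y = h z) := fun H => hTh H.2
          have h2 : ¬ ((insert x T).Nonempty ∧ ∀ y ∈ insert x T, ∀ z ∈ insert x T, h y = h z) :=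
            fun H => hTh fun y hy z hz => H.2 y (Finset.mem_insert_of_mem hy) z
              (Finset.mem_insert_of_mem hz)
          simp only [if_neg h1, if_neg h2, add_zero]
    rw [Finset.sum_congr rfl hsplit, Finset.sum_add_distrib, ← Finset.sum_filter, ih hP' f',
      Finset.sum_ite_eq' , if_pos (Finset.empty_mem_powerset _), Finset.card_insert_of_notMem hxP,
      Finset.sum_range_succ]
    congr 1
    · refine Finset.sum_congr rfl fun j hj => ?_
      have hj := Finset.mem_range.1 hj
      have h1 : P.card + 1 - 1 - j = (P.card - 1 - j) + 1 := by omega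
      have h2 : P.card + 1 - (j + 1) = (P.card - 1 - j) + 1 := by omega
      rw [hf']
      simp only
      rw [h1, h2, Nat.succ_div]
      split_ifs
      · rw [pow_add]; ring
      · ring
    · simp

/-- Adding the vertex `n`, joined to the vertices of `S`. -/
def attach (n : ℕ) (E : Finset (ℕ × ℕ)) (S : Finset ℕ) : Finset (ℕ × ℕ) :=
  E ∪ S.image fun u => (u, n)

theorem mem_attach {n : ℕ} {E : Finset (ℕ × ℕ)} {S : Finset ℕ} {u v : ℕ} :
    (u, v) ∈ attach n E S ↔ (u, v) ∈ E ∨ u ∈ S ∧ v = n := by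
  simp [attach, eq_comm]

theorem isGood_attach {n : ℕ} (hn : 0 < n) {E : Finset (ℕ × ℕ)} {S : Finset ℕ}
    (hE : IsGood n E) (hS : S ⊆ visible n E) (hne : S.Nonempty) :
    IsGood (n + 1) (attach n E S) where
  lt := by
    intro u v h
    rcases mem_attach.1 h with h' | ⟨hu, rfl⟩
    · have := hE.lt h'
      omega
    · have := (mem_visible.1 (hS hu)).1
      omega
  noncrossing := by
    intro a b x y hab hxy hax hxb
    rcases mem_attach.1 hab with hab' | ⟨ha, rfl⟩
    · rcases mem_attach.1 hxy with hxy' | ⟨hx, rfl⟩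
      · exact hE.noncrossing hab' hxy' hax hxb
      · have := (mem_visible.1 (hS hx)).2 a b hab' hax
        omega
    · rcases mem_attach.1 hxy with hxy' | ⟨hx, rfl⟩
      · exact (hE.lt hxy').2.le
      · exact le_rfl
  exists_lower := by
    intro v hv0 hv
    rcases (Nat.lt_succ_iff.1 hv).eq_or_lt with rfl | hv
    · obtain ⟨s, hs⟩ := hne
      exact ⟨s, mem_attach.2 (Or.inr ⟨hs, rfl⟩)⟩
    · obtain ⟨u, hu⟩ := hE.exists_lower v hv0 hv
      exact ⟨u, mem_attach.2 (Or.inl hu)⟩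

/-- Labels that increase along the edges are unique up to a constant. -/
theorem IsGood.label_sub_eq {d n : ℕ} {E : Finset (ℕ × ℕ)} (hE : IsGood n E) {h h' : ℕ → ZMod d}
    (hh : ∀ u v, (u, v) ∈ E → h v = h u + 1) (hh' : ∀ u v, (u, v) ∈ E → h' v = h' u + 1) :
    ∀ v < n, h' v - h v = h' 0 - h 0 := by
  intro v
  induction v using Nat.strong_induction_on with
  | _ v ih =>
  intro hv
  rcases Nat.eq_zero_or_pos v with rfl | hv0
  · rfl
  obtain ⟨u, hu⟩ := hE.exists_lower v hv0 hv
  have := (hE.lt hu).1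
  rw [← ih u this (by omega), hh _ _ hu, hh' _ _ hu]
  ring

theorem isShifted_attach_iff {d n : ℕ} {E : Finset (ℕ × ℕ)} {S : Finset ℕ} (hE : IsGood n E)
    (hS : S ⊆ visible n E) {h : ℕ → ZMod d}
    (hh : ∀ u v, (u, v) ∈ E → h v = h u + 1) :
    IsShifted d (attach n E S) ↔ ∀ x ∈ S, ∀ y ∈ S, h x = h y := by
  constructor
  · rintro ⟨h', hh'⟩ x hx y hy
    have hE' : ∀ u v, (u, v) ∈ E → h' v = h' u + 1 := fun u v huv =>
      hh' u v (mem_attach.2 (Or.inl huv))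
    have h1 := hE.label_sub_eq hh hE' x (mem_visible.1 (hS hx)).1
    have h2 := hE.label_sub_eq hh hE' y (mem_visible.1 (hS hy)).1
    have h3 := hh' x n (mem_attach.2 (Or.inr ⟨hx, rfl⟩))
    have h4 := hh' y n (mem_attach.2 (Or.inr ⟨hy, rfl⟩))
    linear_combination h4 - h3 - h1 + h2
  · intro H
    rcases S.eq_empty_or_nonempty with rfl | ⟨s, hs⟩
    · exact ⟨h, by simpa [mem_attach] using hh⟩
    · refine ⟨Function.update h n (h s + 1), fun u v huv => ?_⟩
      rcases mem_attach.1 huv with huv | ⟨hu, rfl⟩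
      · have := hE.lt huv
        rw [Function.update_of_ne (by omega), Function.update_of_ne (by omega), hh _ _ huv]
      · have := (mem_visible.1 (hS hu)).1
        rw [Function.update_self, Function.update_of_ne (by omega), H s hs u hu]

theorem card_visible_attach {n : ℕ} {E : Finset (ℕ × ℕ)} {S : Finset ℕ} (hE : IsGood n E)
    (hS : S ⊆ visible n E) : (visible (n + 1) (attach n E S)).card =
      ((visible n E).filter fun p => ∀ s ∈ S, p ≤ s).card + 1 := by
  have : visible (n + 1) (attach n E S) =
      insert n ((visible n E).filter fun p => ∀ s ∈ S, p ≤ s) := by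
    ext i
    simp only [mem_visible, Finset.mem_insert, Finset.mem_filter, mem_attach]
    constructor
    · rintro ⟨hi, H⟩
      rcases (Nat.lt_succ_iff.1 hi).eq_or_lt with rfl | hi
      · exact Or.inl rfl
      · refine Or.inr ⟨⟨hi, fun u v huv => H u v (Or.inl huv)⟩, fun s hs => ?_⟩
        by_contra! hsi
        have := H s n (Or.inr ⟨hs, rfl⟩) hsi
        omega
    · rintro (rfl | ⟨⟨hi, H⟩, hs⟩)
      · refine ⟨by omega, fun u v huv _ => ?_⟩
        rcases huv with huv | ⟨hu, rfl⟩
        · exact (hE.lt huv).2.le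
        · exact le_rfl
      · refine ⟨by omega, fun u v huv hui => ?_⟩
        rcases huv with huv | ⟨hu, rfl⟩
        · exact H u v huv hui
        · have := hs u hu
          omega
  rw [this, Finset.card_insert_of_notMem]
  simp [mem_visible]

/-- The recursion for the codes: the last vertex is joined to some of the visible vertices. -/
theorem sum_goodSets_succ (d n : ℕ) (hn : 0 < n) (f : ℕ → ℝ) :
    ∑ E ∈ goodSets d (n + 1), f (visible (n + 1) E).card =
      ∑ E ∈ goodSets d n, ∑ j ∈ Finset.range (visible n E).card,
        2 ^ (((visible n E).card - 1 - j) / d) * f (j + 2) := by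
  classical
  have hinner : ∀ E ∈ goodSets d n, ∑ j ∈ Finset.range (visible n E).card,
      2 ^ (((visible n E).card - 1 - j) / d) * f (j + 2) =
      ∑ S ∈ (visible n E).powerset with S.Nonempty ∧ IsShifted d (attach n E S),
        f (visible (n + 1) (attach n E S)).card := by
    intro E hE
    obtain ⟨hE, h, hh⟩ := mem_goodSets.1 hE
    have := sum_attachments (visible n E) h (h 0) (hE.label_visible hh) (fun c => f (c + 1))
    rw [← this]
    refine Finset.sum_congr (Finset.filter_congr fun S hS => ?_) fun S hS => ?_
    · rw [isShifted_attach_iff hE (Finset.mem_powerset.1 hS) hh]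
    · rw [card_visible_attach hE (Finset.mem_powerset.1 (Finset.mem_filter.1 hS).1)]
  rw [Finset.sum_congr rfl hinner, Finset.sum_sigma']
  refine Finset.sum_bij' (fun E _ => ⟨E.filter fun p => p.2 < n,
      (Finset.range n).filter fun u => (u, n) ∈ E⟩) (fun p _ => attach n p.1 p.2) ?_ ?_ ?_ ?_ ?_
  case refine_3 =>
    intro E hE
    obtain ⟨hE, -⟩ := mem_goodSets.1 hE
    ext ⟨u, v⟩
    simp only [mem_attach, Finset.mem_filter, Finset.mem_range]
    constructor
    · rintro (⟨h, -⟩ | ⟨⟨-, h⟩, rfl⟩) <;> exact h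
    · intro h
      have := hE.lt h
      rcases (Nat.lt_succ_iff.1 this.2).eq_or_lt with rfl | hv
      · exact Or.inr ⟨⟨this.1, h⟩, rfl⟩
      · exact Or.inl ⟨h, hv⟩
  case refine_4 =>
    rintro ⟨E, S⟩ hp
    simp only [Finset.mem_sigma, Finset.mem_filter, Finset.mem_powerset, mem_goodSets] at hp
    obtain ⟨⟨hE, -⟩, hS, -⟩ := hp
    simp only
    congr 1
    · ext ⟨u, v⟩
      simp only [Finset.mem_filter, mem_attach]
      constructor
      · rintro ⟨h | ⟨-, rfl⟩, hv⟩
        · exact h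
        · exact absurd hv (lt_irrefl _)
      · intro h
        exact ⟨Or.inl h, (hE.lt h).2⟩
    · ext u
      simp only [Finset.mem_filter, mem_attach, Finset.mem_range, and_true]
      constructor
      · rintro ⟨-, h | h⟩
        · exact absurd (hE.lt h).2 (lt_irrefl _)
        · exact h
      · intro h
        exact ⟨(mem_visible.1 (hS h)).1, Or.inr h⟩
  case refine_5 =>
    intro E hE
    obtain ⟨hE, -⟩ := mem_goodSets.1 hE
    congr 3
    ext ⟨u, v⟩
    simp only [mem_attach, Finset.mem_filter, Finset.mem_range]
    constructor
    · intro h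
      have := hE.lt h
      rcases (Nat.lt_succ_iff.1 this.2).eq_or_lt with rfl | hv
      · exact Or.inr ⟨⟨this.1, h⟩, rfl⟩
      · exact Or.inl ⟨h, hv⟩
    · rintro (⟨h, -⟩ | ⟨⟨-, h⟩, rfl⟩) <;> exact h
  case refine_2 =>
    rintro ⟨E, S⟩ hp
    simp only [Finset.mem_sigma, Finset.mem_filter, Finset.mem_powerset, mem_goodSets] at hp ⊢
    obtain ⟨⟨hE, -⟩, hS, hne, hsh⟩ := hp
    exact ⟨isGood_attach hn hE hS hne, hsh⟩
  case refine_1 =>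
    intro E hE
    obtain ⟨hE, hsh⟩ := mem_goodSets.1 hE
    have hatt : attach n (E.filter fun p => p.2 < n) ((Finset.range n).filter fun u => (u, n) ∈ E) =
        E := by
      ext ⟨u, v⟩
      simp only [mem_attach, Finset.mem_filter, Finset.mem_range]
      constructor
      · rintro (⟨h, -⟩ | ⟨⟨-, h⟩, rfl⟩) <;> exact h
      · intro h
        have := hE.lt h
        rcases (Nat.lt_succ_iff.1 this.2).eq_or_lt with rfl | hv
        · exact Or.inr ⟨⟨this.1, h⟩, rfl⟩
        · exact Or.inl ⟨h, hv⟩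
    simp only [Finset.mem_sigma, Finset.mem_filter, Finset.mem_powerset, mem_goodSets, hatt]
    refine ⟨⟨⟨?_, ?_, ?_⟩, ?_⟩, ?_, ?_, hsh⟩
    · intro u v h
      obtain ⟨h, hv⟩ := Finset.mem_filter.1 h
      exact ⟨(hE.lt h).1, hv⟩
    · intro a b x y hab hxy
      exact hE.noncrossing (Finset.mem_filter.1 hab).1 (Finset.mem_filter.1 hxy).1
    · intro v hv0 hv
      obtain ⟨u, hu⟩ := hE.exists_lower v hv0 (by omega)
      exact ⟨u, Finset.mem_filter.2 ⟨hu, hv⟩⟩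
    · obtain ⟨h, hh⟩ := hsh
      exact ⟨h, fun u v huv => hh u v (Finset.mem_filter.1 huv).1⟩
    · intro s hs
      obtain ⟨hsn, hs⟩ := Finset.mem_filter.1 hs
      refine mem_visible.2 ⟨Finset.mem_range.1 hsn, fun u v huv hus => ?_⟩
      obtain ⟨huv, hv⟩ := Finset.mem_filter.1 huv
      by_contra! hsv
      have := hE.noncrossing huv hs hus hsv
      simp only at hv
      omega
    · obtain ⟨u, hu⟩ := hE.exists_lower n hn (by omega)
      exact ⟨u, Finset.mem_filter.2 ⟨Finset.mem_range.2 (hE.lt hu).1, hu⟩⟩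

theorem goodSets_one (d : ℕ) : goodSets d 1 = {∅} := by
  ext E
  rw [mem_goodSets, Finset.mem_singleton]
  constructor
  · rintro ⟨hE, -⟩
    refine Finset.eq_empty_of_forall_notMem ?_
    rintro ⟨u, v⟩ h
    have := hE.lt h
    omega
  · rintro rfl
    exact ⟨⟨by simp, by simp, fun v h0 h1 => by omega⟩, 0, by simp⟩

open PowerSeries in
/-- The step of the ballot theorem: an identity between coefficients of powers of `Φ`, which follows
from `t (Φ ^ N)' Φ = N / (N + 1) * t (Φ ^ (N + 1))'`. -/
theorem sum_antidiagonal_coeff_pow (Φ : PowerSeries ℝ) (N m : ℕ) (hN : 0 < N) :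
    ∑ p ∈ Finset.HasAntidiagonal.antidiagonal m,
        ((N : ℝ) - p.1) / N * (Φ ^ N).coeff p.1 * Φ.coeff p.2 =
      ((N : ℝ) + 1 - m) / (N + 1) * (Φ ^ (N + 1)).coeff m := by
  have hN' : (N : ℝ) ≠ 0 := by positivity
  have hN1 : (N : ℝ) + 1 ≠ 0 := by positivity
  have hXD : ∀ (F : PowerSeries ℝ) (k : ℕ), (X * derivative ℝ F).coeff k = k * F.coeff k := by
    intro F k
    cases k with
    | zero => simp
    | succ k => rw [coeff_succ_X_mul, coeff_derivative]; push_cast; ring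
  have h1 : ∑ p ∈ Finset.HasAntidiagonal.antidiagonal m,
        ((N : ℝ) - p.1) / N * (Φ ^ N).coeff p.1 * Φ.coeff p.2 =
      (Φ ^ N * Φ).coeff m - 1 / N * (X * derivative ℝ (Φ ^ N) * Φ).coeff m := by
    rw [coeff_mul, coeff_mul, Finset.mul_sum, ← Finset.sum_sub_distrib]
    refine Finset.sum_congr rfl fun p _ => ?_
    rw [hXD]
    field_simp
  have h2 : X * derivative ℝ (Φ ^ N) * Φ =
      C ((N : ℝ) / (N + 1)) * (X * derivative ℝ (Φ ^ (N + 1))) := by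
    rw [Derivation.leibniz_pow, Derivation.leibniz_pow]
    simp only [nsmul_eq_mul, smul_eq_mul, Nat.add_sub_cancel]
    have h3 : (C ((N : ℝ) / (N + 1)) : PowerSeries ℝ) * ((N + 1 : ℕ) : PowerSeries ℝ) =
        (N : PowerSeries ℝ) := by
      rw [← map_natCast (C (R := ℝ)) (N + 1), ← map_natCast (C (R := ℝ)) N, ← map_mul]
      congr 1
      push_cast
      field_simp
    have h4 : Φ ^ N = Φ ^ (N - 1) * Φ := by rw [← pow_succ, Nat.sub_add_cancel hN]
    rw [← h3, h4]
    ring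
  rw [h1, h2, coeff_C_mul, hXD, ← pow_succ]
  field_simp

/-- The ballot theorem for the codes, counted by the number of visible vertices; `k` is the number
of visible vertices other than the last one. -/
theorem sum_goodSets (d N : ℕ) (hN : 0 < N) (f : ℕ → ℝ) :
    ∑ E ∈ goodSets d (N + 1), f ((visible (N + 1) E).card - 1) =
      ∑ k ∈ Finset.range (N + 1), (k : ℝ) / N * (stepSeries d ^ N).coeff (N - k) * f k := by
  induction N, hN using Nat.le_induction generalizing f with
  | base =>
    rw [sum_goodSets_succ d 1 one_pos (fun c => f (c - 1)), goodSets_one]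
    have : (visible 1 ∅).card = 1 := by simp [visible]
    simp [this, stepSeries, Finset.sum_range_succ]
  | succ N hN ih =>
    rw [sum_goodSets_succ d (N + 1) (by omega) (fun c => f (c - 1))]
    have h1 : ∀ E ∈ goodSets d (N + 1), ∑ j ∈ Finset.range (visible (N + 1) E).card,
        2 ^ (((visible (N + 1) E).card - 1 - j) / d) * f (j + 2 - 1) =
        (fun k => ∑ j ∈ Finset.range (k + 1), 2 ^ ((k - j) / d) * f (j + 1))
          ((visible (N + 1) E).card - 1) := by
      intro E _
      have : 0 < (visible (N + 1) E).card := Finset.card_pos.2 ⟨0, zero_mem_visible (by omega)⟩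
      simp only [Nat.sub_add_cancel this]
      rfl
    rw [Finset.sum_congr rfl h1,
      ih (fun k => ∑ j ∈ Finset.range (k + 1), 2 ^ ((k - j) / d) * f (j + 1)),
      Finset.sum_range_succ' _ (N + 1)]
    simp only [Finset.mul_sum]
    rw [Finset.sum_comm' (t' := Finset.range (N + 1)) (s' := fun j => Finset.Ico j (N + 1))
      (by intro k j; simp only [Finset.mem_range, Finset.mem_Ico]; omega)]
    simp only [Nat.cast_zero, zero_div, zero_mul, add_zero]
    refine Finset.sum_congr rfl fun j hj => ?_
    have hj := Finset.mem_range.1 hj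
    have h2 := sum_antidiagonal_coeff_pow (stepSeries d) N (N - j) hN
    rw [show N + 1 - (j + 1) = N - j by omega]
    have h3 : ((j + 1 : ℕ) : ℝ) / (N + 1 : ℕ) * (stepSeries d ^ (N + 1)).coeff (N - j) =
        ((N : ℝ) + 1 - (N - j : ℕ)) / (N + 1) * (stepSeries d ^ (N + 1)).coeff (N - j) := by
      rw [Nat.cast_sub (by omega)]
      push_cast
      ring
    rw [h3, ← h2, Finset.sum_mul]
    refine Finset.sum_bij' (fun k _ => (N - k, k - j)) (fun p _ => p.2 + j) ?_ ?_ ?_ ?_ ?_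
    · intro k hk
      rw [Finset.mem_Ico] at hk
      simp only [Finset.HasAntidiagonal.mem_antidiagonal]
      omega
    · rintro ⟨a, b⟩ hp
      simp only [Finset.HasAntidiagonal.mem_antidiagonal] at hp
      simp only [Finset.mem_Ico]
      omega
    · intro k hk
      rw [Finset.mem_Ico] at hk
      simp only
      omega
    · rintro ⟨a, b⟩ hp
      simp only [Finset.HasAntidiagonal.mem_antidiagonal] at hp
      simp only [Prod.mk.injEq]
      omega
    · intro k hk
      rw [Finset.mem_Ico] at hk
      simp only
      rw [Nat.cast_sub (by omega), sub_sub_cancel,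
        show (stepSeries d).coeff (k - j) = 2 ^ ((k - j) / d) from PowerSeries.coeff_mk _ _]
      ring

theorem card_goodSets (d N : ℕ) (hN : 0 < N) :
    ((goodSets d (N + 1)).card : ℝ) =
      (stepSeries d ^ N * weightSeries).coeff (N - 1) / N := by
  have h := sum_goodSets d N hN fun _ => 1
  simp only [Finset.sum_const, nsmul_eq_mul, mul_one] at h
  rw [h, PowerSeries.coeff_mul, Finset.sum_range_succ']
  simp only [Nat.cast_zero, zero_div, zero_mul, add_zero]
  rw [Finset.Nat.sum_antidiagonal_eq_sum_range_succ_mk, ← Finset.sum_range_reflect, Finset.sum_div]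
  rw [show (N - 1).succ = N by omega]
  refine Finset.sum_congr rfl fun j hj => ?_
  have hj := Finset.mem_range.1 hj
  simp only [weightSeries, PowerSeries.coeff_mk]
  rw [show N - (N - 1 - j + 1) = j by omega]
  push_cast
  ring

/-! ### The planar map of a noncrossing graph -/

/-- In the cyclic order of the naturals, `y` is the first element of `S` after `x`. -/
def IsNext (S : Finset ℕ) (x y : ℕ) : Prop :=
  y ∈ S ∧ ((x < y ∧ ∀ z ∈ S, x < z → y ≤ z) ∨ ((∀ z ∈ S, z ≤ x) ∧ ∀ z ∈ S, y ≤ z))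

theorem exists_isNext {S : Finset ℕ} (hS : S.Nonempty) (x : ℕ) : ∃ y, IsNext S x y := by
  classical
  by_cases h : ∃ z ∈ S, x < z
  · have h' : (S.filter (x < ·)).Nonempty := by
      obtain ⟨z, hz, hxz⟩ := h
      exact ⟨z, Finset.mem_filter.2 ⟨hz, hxz⟩⟩
    have := Finset.mem_filter.1 (Finset.min'_mem _ h')
    exact ⟨_, this.1, Or.inl ⟨this.2, fun z hz hxz => Finset.min'_le _ _
      (Finset.mem_filter.2 ⟨hz, hxz⟩)⟩⟩
  · push Not at h
    exact ⟨S.min' hS, S.min'_mem hS, Or.inr ⟨h, fun z hz => S.min'_le z hz⟩⟩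

theorem IsNext.unique {S : Finset ℕ} {x y y' : ℕ} (h : IsNext S x y) (h' : IsNext S x y') :
    y = y' := by
  obtain ⟨hy, h⟩ := h
  obtain ⟨hy', h'⟩ := h'
  rcases h with ⟨h1, h2⟩ | ⟨h1, h2⟩ <;> rcases h' with ⟨h1', h2'⟩ | ⟨h1', h2'⟩
  · exact le_antisymm (h2 _ hy' h1') (h2' _ hy h1)
  · have := h1' _ hy; omega
  · have := h1 _ hy'; omega
  · exact le_antisymm (h2 _ hy') (h2' _ hy)

theorem IsNext.injective {S : Finset ℕ} {x x' y : ℕ} (hx : x ∈ S) (hx' : x' ∈ S)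
    (h : IsNext S x y) (h' : IsNext S x' y) : x = x' := by
  obtain ⟨-, h⟩ := h
  obtain ⟨-, h'⟩ := h'
  by_contra hne
  rcases h with ⟨h1, h2⟩ | ⟨h1, h2⟩ <;> rcases h' with ⟨h1', h2'⟩ | ⟨h1', h2'⟩
  · rcases Nat.lt_or_gt_of_ne hne with h | h
    · have := h2 _ hx' h; omega
    · have := h2' _ hx h; omega
  · have := h2' _ hx; omega
  · have := h2 _ hx'; omega
  · have := h1 _ hx'; have := h1' _ hx; omega

theorem IsNext.congr {S : Finset ℕ} {x x' y : ℕ} (h : IsNext S x y) (hxx : x' ≤ x)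
    (hS : ∀ z ∈ S, x' < z → x < z) : IsNext S x' y := by
  obtain ⟨hy, h⟩ := h
  refine ⟨hy, h.imp ?_ ?_⟩
  · rintro ⟨h1, h2⟩
    exact ⟨by omega, fun z hz hxz => h2 z hz (hS z hz hxz)⟩
  · rintro ⟨h1, h2⟩
    refine ⟨fun z hz => ?_, h2⟩
    by_contra! h
    have := hS z hz h
    have := h1 z hz
    omega

/-- Adjacency in the graph with the edges `E`. -/
def EdgeAdj (E : Finset (ℕ × ℕ)) (u v : ℕ) : Prop := (u, v) ∈ E ∨ (v, u) ∈ E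

theorem EdgeAdj.symm {E : Finset (ℕ × ℕ)} {u v : ℕ} (h : EdgeAdj E u v) : EdgeAdj E v u := Or.symm h

/-- The neighbours of a vertex. -/
def nbrs (E : Finset (ℕ × ℕ)) (u : ℕ) : Finset ℕ :=
  (E.filter (·.1 = u)).image Prod.snd ∪ (E.filter (·.2 = u)).image Prod.fst

theorem mem_nbrs {E : Finset (ℕ × ℕ)} {u v : ℕ} : v ∈ nbrs E u ↔ EdgeAdj E u v := by
  simp only [nbrs, EdgeAdj, Finset.mem_union, Finset.mem_image, Finset.mem_filter, Prod.exists,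
    exists_and_right, exists_eq_right]

namespace IsGood

variable {n : ℕ} {E : Finset (ℕ × ℕ)}

theorem ne_of_adj (hE : IsGood n E) {u v : ℕ} (h : EdgeAdj E u v) : u ≠ v := by
  rcases h with h | h <;> have := hE.lt h <;> omega

theorem left_lt (hE : IsGood n E) {u v : ℕ} (h : EdgeAdj E u v) : u < n := by
  rcases h with h | h <;> have := hE.lt h <;> omega

theorem mem_of_adj (hE : IsGood n E) {u v : ℕ} (h : EdgeAdj E u v) (huv : u < v) :
    (u, v) ∈ E := by
  rcases h with h | h
  · exact h
  · have := hE.lt h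
    omega

/-- Vertices separated by an edge are not adjacent. -/
theorem adj_le_of_between (hE : IsGood n E) {u v x y : ℕ} (huv : (u, v) ∈ E) (hux : u < x)
    (hxv : x < v) (hxy : EdgeAdj E x y) : u ≤ y ∧ y ≤ v := by
  have h1 := hE.lt huv
  constructor
  · by_contra! h
    have := hE.noncrossing (hE.mem_of_adj hxy.symm (by omega)) huv h hux
    omega
  · by_contra! h
    have := hE.noncrossing huv (hE.mem_of_adj hxy (by omega)) hux hxv
    omega

theorem nbrs_nonempty (hE : IsGood n E) (hn : 2 ≤ n) {u : ℕ} (hu : u < n) :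
    (nbrs E u).Nonempty := by
  rcases Nat.eq_zero_or_pos u with rfl | h0
  · obtain ⟨w, hw⟩ := hE.exists_lower 1 one_pos (by omega)
    have := hE.lt hw
    obtain rfl : w = 0 := by omega
    exact ⟨1, mem_nbrs.2 (Or.inl hw)⟩
  · obtain ⟨w, hw⟩ := hE.exists_lower u h0 hu
    exact ⟨w, mem_nbrs.2 (Or.inr hw)⟩

theorem zero_one_mem (hE : IsGood n E) (hn : 2 ≤ n) : (0, 1) ∈ E := by
  obtain ⟨w, hw⟩ := hE.exists_lower 1 one_pos (by omega)
  have := hE.lt hw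
  obtain rfl : w = 0 := by omega
  exact hw

end IsGood

/-- The darts of the graph with the edges `E`. -/
abbrev EdgeDart (E : Finset (ℕ × ℕ)) : Type := {p : ℕ × ℕ // EdgeAdj E p.1 p.2}

instance (E : Finset (ℕ × ℕ)) : Finite (EdgeDart E) := by
  refine Set.Finite.subset (E ∪ E.image Prod.swap).finite_toSet ?_
  rintro ⟨u, v⟩ (h | h)
  · simpa using Or.inl h
  · simpa using Or.inr h

theorem exists_isNext_nbrs {E : Finset (ℕ × ℕ)} (d : EdgeDart E) :
    ∃ w, IsNext (nbrs E d.1.1) d.1.2 w :=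
  exists_isNext ⟨_, mem_nbrs.2 d.2⟩ _

/-- The next dart around the origin: the targets are in increasing cyclic order. -/
noncomputable def rotDart {E : Finset (ℕ × ℕ)} (d : EdgeDart E) : EdgeDart E :=
  ⟨(d.1.1, (exists_isNext_nbrs d).choose), mem_nbrs.1 (exists_isNext_nbrs d).choose_spec.1⟩

theorem rotDart_eq {E : Finset (ℕ × ℕ)} {u v w : ℕ} (h : EdgeAdj E u v)
    (hw : IsNext (nbrs E u) v w) : rotDart ⟨(u, v), h⟩ = ⟨(u, w), mem_nbrs.1 hw.1⟩ := by
  have := (exists_isNext_nbrs (⟨(u, v), h⟩ : EdgeDart E)).choose_spec.unique hw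
  simp only [rotDart]
  congr

theorem isNext_rotDart {E : Finset (ℕ × ℕ)} (d : EdgeDart E) :
    IsNext (nbrs E d.1.1) d.1.2 (rotDart d).1.2 := (exists_isNext_nbrs d).choose_spec

theorem rotDart_injective (E : Finset (ℕ × ℕ)) : Function.Injective (rotDart (E := E)) := by
  intro d e h
  have h1 : d.1.1 = e.1.1 := by
    have := congrArg (fun x : EdgeDart E => x.1.1) h
    exact this
  have h2 := isNext_rotDart d
  have h3 := isNext_rotDart e
  rw [← h, ← h1] at h3
  have := h2.injective (mem_nbrs.2 d.2) (by rw [h1]; exact mem_nbrs.2 e.2) h3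
  exact Subtype.ext (Prod.ext h1 this)

/-- The rotation as a permutation. -/
noncomputable def rotPerm (E : Finset (ℕ × ℕ)) : Equiv.Perm (EdgeDart E) :=
  Equiv.ofBijective rotDart (Finite.injective_iff_bijective.1 (rotDart_injective E))

theorem rotPerm_apply {E : Finset (ℕ × ℕ)} (d : EdgeDart E) : rotPerm E d = rotDart d := rfl

theorem rotPerm_sameCycle_iff {E : Finset (ℕ × ℕ)} (d e : EdgeDart E) :
    (rotPerm E).SameCycle d e ↔ d.1.1 = e.1.1 := by
  constructor
  · intro h
    exact h.mem_of_forall_apply_mem (s := {e : EdgeDart E | d.1.1 = e.1.1}) (fun e he => he) rfl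
  · obtain ⟨⟨u, v⟩, hd⟩ := d
    obtain ⟨⟨u', v'⟩, he⟩ := e
    rintro (rfl : u = u')
    have hne : (nbrs E u).Nonempty := ⟨v, mem_nbrs.2 hd⟩
    have hm := (nbrs E u).min'_mem hne
    have key : ∀ v (hv : EdgeAdj E u v), (rotPerm E).SameCycle
        ⟨(u, (nbrs E u).min' hne), mem_nbrs.1 hm⟩ ⟨(u, v), hv⟩ := by
      intro v
      induction v using Nat.strong_induction_on with
      | _ v ih =>
      intro hv
      rcases ((nbrs E u).min'_le v (mem_nbrs.2 hv)).eq_or_lt with h | h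
      · have : (⟨(u, (nbrs E u).min' hne), mem_nbrs.1 hm⟩ : EdgeDart E) = ⟨(u, v), hv⟩ :=
          Subtype.ext (Prod.ext rfl h)
        rw [this]
      · have hne' : ((nbrs E u).filter (· < v)).Nonempty := ⟨_, Finset.mem_filter.2 ⟨hm, h⟩⟩
        have hp := Finset.mem_filter.1 (Finset.max'_mem _ hne')
        set p := ((nbrs E u).filter (· < v)).max' hne' with hpdef
        have hnext : IsNext (nbrs E u) p v := by
          refine ⟨mem_nbrs.2 hv, Or.inl ⟨hp.2, fun z hz hpz => ?_⟩⟩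
          by_contra! hzv
          have := Finset.le_max' ((nbrs E u).filter (· < v)) z (Finset.mem_filter.2 ⟨hz, hzv⟩)
          omega
        have := ih p hp.2 (mem_nbrs.1 hp.1)
        rw [← Equiv.Perm.sameCycle_apply_right, rotPerm_apply, rotDart_eq _ hnext] at this
        exact this
    exact (key v hd).symm.trans (key v' he)

/-- The map encoded by a good set of edges. -/
noncomputable def modelMap {n : ℕ} {E : Finset (ℕ × ℕ)} (hE : IsGood n E) : CombMap where
  Vertex := Fin n
  Dart := EdgeDart E
  finite_vertex := inferInstance
  finite_dart := inferInstance
  origin d := ⟨d.1.1, hE.left_lt d.2⟩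
  rev := ⟨fun d => ⟨d.1.swap, d.2.symm⟩, fun d => ⟨d.1.swap, d.2.symm⟩, fun _ => rfl, fun _ => rfl⟩
  rot := rotPerm E
  rev_rev _ := rfl
  rev_ne d h := hE.ne_of_adj d.2 (congrArg (fun x : EdgeDart E => x.1.2) h)
  origin_eq_iff d e := by
    rw [rotPerm_sameCycle_iff, Fin.mk.injEq]

namespace IsGood

variable {n : ℕ} {E : Finset (ℕ × ℕ)}

theorem faceNext_eq (hE : IsGood n E) {u v w : ℕ} (h : EdgeAdj E u v)
    (hw : IsNext (nbrs E v) u w) :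
    (modelMap hE).faceNext (⟨(u, v), h⟩ : EdgeDart E) = (⟨(v, w), mem_nbrs.1 hw.1⟩ : EdgeDart E) :=
  rotDart_eq h.symm hw

theorem sameCycle_faceNext (hE : IsGood n E) {u v w : ℕ} (h : EdgeAdj E u v)
    (hw : IsNext (nbrs E v) u w) :
    (modelMap hE).faceNext.SameCycle (⟨(u, v), h⟩ : EdgeDart E)
      (⟨(v, w), mem_nbrs.1 hw.1⟩ : EdgeDart E) := by
  rw [← hE.faceNext_eq h hw]
  exact Equiv.Perm.sameCycle_apply_right.2 (Equiv.Perm.SameCycle.refl _ _)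

/-- A walk along the outer face that has come back to the edge from `a` down to `b` and has visited
exactly the vertices up to `i` arrives at `i + 1`. -/
theorem descend (hE : IsGood n E) {i : ℕ} (hi : i + 1 < n) {w : ℕ}
    (hw : IsNext (nbrs E (i + 1)) (i + 1) w) (b : ℕ) :
    ∀ a (hab : EdgeAdj E a b), b < a → a ≤ i → (∀ y ∈ nbrs E b, a < y → i < y) →
      (∀ x, b < x → x ≤ i → ∀ y ∈ nbrs E x, b ≤ y ∧ y ≤ i) →
      (modelMap hE).faceNext.SameCycle (⟨(a, b), hab⟩ : EdgeDart E)
        (⟨(i + 1, w), mem_nbrs.1 hw.1⟩ : EdgeDart E) := by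
  induction b using Nat.strong_induction_on with
  | _ b ih =>
  intro a hab hba hai hgap hJ
  obtain ⟨q, hq⟩ := hE.exists_lower (i + 1) (by omega) hi
  have hqi := (hE.lt hq).1
  have hqb : q ≤ b := by
    by_contra! h
    have := (hJ q h (by omega) (i + 1) (mem_nbrs.2 (Or.inl hq))).2
    omega
  by_cases hex : ∃ y ∈ nbrs E b, i < y
  · obtain ⟨y, hy, hiy⟩ := hex
    have hbi : (b, i + 1) ∈ E := by
      rcases hqb.eq_or_lt with rfl | h
      · exact hq
      · have hby := hE.mem_of_adj (mem_nbrs.1 hy) (by omega)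
        have := hE.noncrossing hq hby h (by omega)
        obtain rfl : y = i + 1 := by omega
        exact hby
    have h1 : IsNext (nbrs E b) a (i + 1) :=
      ⟨mem_nbrs.2 (Or.inl hbi), Or.inl ⟨by omega, fun z hz haz => hgap z hz haz⟩⟩
    have h2 : IsNext (nbrs E (i + 1)) b w := by
      refine hw.congr (by omega) fun z hz hbz => ?_
      by_contra! hz'
      have hz1 := hE.ne_of_adj (mem_nbrs.1 hz)
      have := (hJ z hbz (by omega) (i + 1) (mem_nbrs.2 (mem_nbrs.1 hz).symm)).2
      omega
    exact (hE.sameCycle_faceNext hab h1).trans (hE.sameCycle_faceNext _ h2)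
  · push Not at hex
    have hb0 : 0 < b := by
      rcases Nat.eq_zero_or_pos b with rfl | h
      · obtain rfl : q = 0 := by omega
        have := hex (i + 1) (mem_nbrs.2 (Or.inl hq))
        omega
      · exact h
    have hne : (nbrs E b).Nonempty := ⟨a, mem_nbrs.2 hab.symm⟩
    set b' := (nbrs E b).min' hne with hb'
    have hb'm := (nbrs E b).min'_mem hne
    have hb'b : b' < b := by
      obtain ⟨u, hu⟩ := hE.exists_lower b hb0 (by omega)
      have := (nbrs E b).min'_le u (mem_nbrs.2 (Or.inr hu))
      have := (hE.lt hu).1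
      omega
    have hE' : (b', b) ∈ E := hE.mem_of_adj (mem_nbrs.1 hb'm).symm hb'b
    have h1 : IsNext (nbrs E b) a b' := by
      refine ⟨hb'm, Or.inr ⟨fun z hz => ?_, fun z hz => (nbrs E b).min'_le z hz⟩⟩
      by_contra! h
      have := hgap z hz h
      have := hex z hz
      omega
    refine (hE.sameCycle_faceNext hab h1).trans (ih b' hb'b b _ hb'b (by omega) ?_ ?_)
    · intro y hy hby
      by_contra! hyi
      have := (hJ y hby hyi b' (mem_nbrs.2 (mem_nbrs.1 hy).symm)).1
      omega
    · intro x hx hxi y hy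
      rcases Nat.lt_trichotomy x b with h | rfl | h
      · have := hE.adj_le_of_between hE' hx h (mem_nbrs.1 hy)
        omega
      · exact ⟨(nbrs E x).min'_le y hy, hex y hy⟩
      · have := hJ x h hxi y hy
        omega

/-- The outer walk leaves the vertices for the first time in the order of their numbers. -/
theorem sameCycle_start (hE : IsGood n E) {i : ℕ} (hi : i + 1 < n) {v w : ℕ}
    (hv : IsNext (nbrs E i) i v) (hw : IsNext (nbrs E (i + 1)) (i + 1) w) :
    (modelMap hE).faceNext.SameCycle (⟨(i, v), mem_nbrs.1 hv.1⟩ : EdgeDart E)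
      (⟨(i + 1, w), mem_nbrs.1 hw.1⟩ : EdgeDart E) := by
  obtain ⟨q, hq⟩ := hE.exists_lower (i + 1) (by omega) hi
  have hqi := (hE.lt hq).1
  by_cases hex : ∃ y ∈ nbrs E i, i < y
  · obtain ⟨y, hy, hiy⟩ := hex
    have hii : (i, i + 1) ∈ E := by
      rcases (Nat.lt_succ_iff.1 hqi).eq_or_lt with rfl | h
      · exact hq
      · have hby := hE.mem_of_adj (mem_nbrs.1 hy) hiy
        have := hE.noncrossing hq hby h (by omega)
        obtain rfl : y = i + 1 := by omega
        exact hby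
    obtain rfl : v = i + 1 := hv.unique
      ⟨mem_nbrs.2 (Or.inl hii), Or.inl ⟨by omega, fun z _ h => h⟩⟩
    refine hE.sameCycle_faceNext _ (hw.congr (by omega) fun z hz hiz => ?_)
    have := hE.ne_of_adj (mem_nbrs.1 hz)
    omega
  · push Not at hex
    obtain ⟨hvm, ⟨h, -⟩ | ⟨-, hmin⟩⟩ := hv
    · have := hex v hvm
      omega
    have hvi : v < i := by
      have h1 := hE.ne_of_adj (mem_nbrs.1 hvm)
      have := hex v hvm
      omega
    have hvE : (v, i) ∈ E := hE.mem_of_adj (mem_nbrs.1 hvm).symm hvi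
    refine hE.descend hi hw v i _ hvi le_rfl (fun _ _ h => h) fun x hx hxi y hy => ?_
    rcases hxi.eq_or_lt with rfl | h
    · exact ⟨hmin y hy, hex y hy⟩
    · exact hE.adj_le_of_between hvE hx h (mem_nbrs.1 hy)

theorem isNext_zero (hE : IsGood n E) (hn : 2 ≤ n) : IsNext (nbrs E 0) 0 1 :=
  ⟨mem_nbrs.2 (Or.inl (hE.zero_one_mem hn)), Or.inl ⟨one_pos, fun _ _ h => h⟩⟩

theorem sameCycle_root_start (hE : IsGood n E) (hn : 2 ≤ n) (i : ℕ) (hi : i < n) :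
    ∃ w, ∃ hw : IsNext (nbrs E i) i w, (modelMap hE).faceNext.SameCycle
      (⟨(0, 1), Or.inl (hE.zero_one_mem hn)⟩ : EdgeDart E)
      (⟨(i, w), mem_nbrs.1 hw.1⟩ : EdgeDart E) := by
  induction i with
  | zero => exact ⟨1, hE.isNext_zero hn, Equiv.Perm.SameCycle.refl _ _⟩
  | succ i ih =>
    obtain ⟨v, hv, h⟩ := ih (by omega)
    obtain ⟨w, hw⟩ := exists_isNext (hE.nbrs_nonempty hn hi) (i + 1)
    exact ⟨w, hw, h.trans (hE.sameCycle_start hi hv hw)⟩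

/-- The edges whose lower end is not the largest smaller neighbour of the upper end. Each of
them is the longest edge of an inner face. -/
def lids (E : Finset (ℕ × ℕ)) : Finset (ℕ × ℕ) :=
  E.filter fun p => ∃ q ∈ E, p.1 < q.1 ∧ q.2 = p.2

theorem mem_lids {u v : ℕ} : (u, v) ∈ lids E ↔ (u, v) ∈ E ∧ ∃ u', u < u' ∧ (u', v) ∈ E := by
  simp only [lids, Finset.mem_filter, Prod.exists]
  refine and_congr_right fun _ => ⟨?_, ?_⟩
  · rintro ⟨a, b, h, hab, rfl⟩
    exact ⟨a, hab, h⟩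
  · rintro ⟨a, h, hab⟩
    exact ⟨a, v, hab, h, rfl⟩

/-- The darts of the inner face under the edge `u < v`: the edge itself, and the maximal edges below
it, directed downwards. -/
def underLid (E : Finset (ℕ × ℕ)) (u v : ℕ) : Set (EdgeDart E) :=
  {d | d.1 = (u, v) ∨ d.1.2 < d.1.1 ∧ u ≤ d.1.2 ∧ d.1.1 ≤ v ∧ (d.1.2, d.1.1) ≠ (u, v) ∧
    ∀ p ∈ E, u ≤ p.1 → p.1 ≤ d.1.2 → d.1.1 ≤ p.2 → p.2 ≤ v → p ≠ (u, v) → p = (d.1.2, d.1.1)}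

theorem faceNext_mem_underLid (hE : IsGood n E) {u v : ℕ} (huv : (u, v) ∈ lids E)
    (d : EdgeDart E) (hd : d ∈ underLid E u v) :
    (modelMap hE).faceNext d ∈ underLid E u v := by
  obtain ⟨huv, u', huu', hu'v⟩ := mem_lids.1 huv
  obtain ⟨⟨a, b⟩, hab⟩ := d
  obtain ⟨w, hw⟩ := exists_isNext (S := nbrs E b) ⟨a, mem_nbrs.2 hab.symm⟩ a
  have huv' := (hE.lt huv).1
  have hu'v' := (hE.lt hu'v).1
  rw [hE.faceNext_eq hab hw]
  rcases hd with h | ⟨hba, hub, hav, hne, hmax⟩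
  · -- the first step, from `v` to its next smaller neighbour
    obtain ⟨rfl, rfl⟩ : a = u ∧ b = v := Prod.ext_iff.1 h
    right
    have hu'm : u' ∈ nbrs E b := mem_nbrs.2 (Or.inr hu'v)
    obtain ⟨hwm, ⟨haw, hwmin⟩ | ⟨h, -⟩⟩ := hw
    · have hwu' := hwmin u' hu'm huu'
      refine ⟨by simp only; omega, haw.le, le_rfl, by simp; omega, ?_⟩
      rintro ⟨x, y⟩ hxy h1 h2 h3 h4 h5
      simp only at h1 h2 h3 h4
      obtain rfl : y = b := by omega
      have hxa : x ≠ a := fun h => h5 (by rw [h])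
      have := hwmin x (mem_nbrs.2 (Or.inr hxy)) (by omega)
      obtain rfl : x = w := by omega
      rfl
    · have := h u' hu'm
      omega
  · simp only at hba hub hav hmax
    have hbaE := hE.mem_of_adj hab.symm hba
    rcases hub.eq_or_lt with rfl | hub
    · -- the walk returns to `u`
      left
      simp only [ne_eq, Prod.mk.injEq, true_and] at hne
      have : w = v := hw.unique ⟨mem_nbrs.2 (Or.inl huv), Or.inl ⟨by omega, fun z hz haz => ?_⟩⟩
      · simp only
        rw [this]
      · by_contra! hzv
        have hz := hmax (u, z) (hE.mem_of_adj (mem_nbrs.1 hz) (by omega)) le_rfl le_rfl haz.le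
          hzv.le (by simp; omega)
        simp only [Prod.mk.injEq] at hz
        omega
    · right
      have hbetween : ∀ z ∈ nbrs E b, u ≤ z ∧ z ≤ v := fun z hz =>
        hE.adj_le_of_between huv hub (by omega) (mem_nbrs.1 hz)
      have hle : ∀ z ∈ nbrs E b, z ≤ a := fun z hz => by
        by_contra! haz
        have hz' := hmax (b, z) (hE.mem_of_adj (mem_nbrs.1 hz) (by omega)) hub.le le_rfl haz.le
          (hbetween z hz).2 (by simp; omega)
        simp only [Prod.mk.injEq] at hz'
        omega
      obtain ⟨hwm, ⟨haw, -⟩ | ⟨-, hmin⟩⟩ := hw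
      · have := hle w hwm
        omega
      have hwb : w < b := by
        obtain ⟨x, hx⟩ := hE.exists_lower b (by omega) (by have := hE.lt hbaE; omega)
        have := hmin x (mem_nbrs.2 (Or.inr hx))
        have := (hE.lt hx).1
        omega
      refine ⟨hwb, (hbetween w hwm).1, by simp only; omega, by simp; omega, ?_⟩
      rintro ⟨x, y⟩ hxy h1 h2 h3 h4 h5
      simp only at h1 h2 h3 h4
      rcases h3.eq_or_lt with rfl | h3
      · have := hmin x (mem_nbrs.2 (Or.inr hxy))
        obtain rfl : x = w := by omega
        rfl
      · exfalso
        by_cases hya : a ≤ y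
        · have := hmax (x, y) hxy h1 (by simp only; omega) hya h4 h5
          simp only [Prod.mk.injEq] at this
          omega
        · have := hE.noncrossing hxy hbaE (by omega) h3
          omega

/-- The only upward dart of the face under an edge of `lids E` is that edge. -/
theorem eq_of_sameCycle_lid (hE : IsGood n E) {u v a b : ℕ} (huv : (u, v) ∈ lids E)
    (hab : (a, b) ∈ E)
    (h : (modelMap hE).faceNext.SameCycle
      (⟨(u, v), Or.inl (mem_lids.1 huv).1⟩ : EdgeDart E) (⟨(a, b), Or.inl hab⟩ : EdgeDart E)) :
    (a, b) = (u, v) := by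
  have := h.mem_of_forall_apply_mem (hs := hE.faceNext_mem_underLid huv) (Or.inl rfl)
  rcases this with h | ⟨h, -⟩
  · exact h
  · have := hE.lt hab
    simp only at h
    omega

/-- Every face other than the outer one lies under an edge of `lids E`. -/
theorem exists_sameCycle (hE : IsGood n E) (hn : 2 ≤ n) (d : EdgeDart E) :
    (modelMap hE).faceNext.SameCycle
      (⟨(0, 1), Or.inl (hE.zero_one_mem hn)⟩ : EdgeDart E) d ∨
    ∃ p : lids E, (modelMap hE).faceNext.SameCycle
      (⟨p.1, Or.inl (mem_lids.1 p.2).1⟩ : EdgeDart E) d := by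
  have hup : ∀ u v (huv : (u, v) ∈ E), (modelMap hE).faceNext.SameCycle
      (⟨(0, 1), Or.inl (hE.zero_one_mem hn)⟩ : EdgeDart E) (⟨(u, v), Or.inl huv⟩ : EdgeDart E) ∨
      ∃ p : lids E, (modelMap hE).faceNext.SameCycle
        (⟨p.1, Or.inl (mem_lids.1 p.2).1⟩ : EdgeDart E) (⟨(u, v), Or.inl huv⟩ : EdgeDart E) := by
    intro u v huv
    by_cases h : (u, v) ∈ lids E
    · exact Or.inr ⟨⟨_, h⟩, Equiv.Perm.SameCycle.refl _ _⟩
    · left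
      have h' : ∀ u', (u', v) ∈ E → u' ≤ u := fun u' hu' => by
        by_contra! hlt
        exact h (mem_lids.2 ⟨huv, u', hlt, hu'⟩)
      obtain ⟨w, hw, hs⟩ := hE.sameCycle_root_start hn v (hE.lt huv).2
      refine hs.trans (hE.sameCycle_faceNext (Or.inl huv) (hw.congr (hE.lt huv).1.le ?_)).symm
      intro z hz huz
      by_contra! hzv
      have := hE.ne_of_adj (mem_nbrs.1 hz)
      have := h' z (hE.mem_of_adj (mem_nbrs.1 hz).symm (by omega))
      omega
  obtain ⟨⟨a, b⟩, hab⟩ := d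
  induction b using Nat.strong_induction_on generalizing a with
  | _ b ih =>
  rcases Nat.lt_or_gt_of_ne (hE.ne_of_adj hab) with h | h
  · exact hup a b (hE.mem_of_adj hab h)
  · obtain ⟨w, hw⟩ := exists_isNext (S := nbrs E b) ⟨a, mem_nbrs.2 hab.symm⟩ a
    have hs := (hE.sameCycle_faceNext hab hw).symm
    have hbw : EdgeAdj E b w := mem_nbrs.1 hw.1
    have key : (modelMap hE).faceNext.SameCycle
        (⟨(0, 1), Or.inl (hE.zero_one_mem hn)⟩ : EdgeDart E) (⟨(b, w), hbw⟩ : EdgeDart E) ∨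
        ∃ p : lids E, (modelMap hE).faceNext.SameCycle
          (⟨p.1, Or.inl (mem_lids.1 p.2).1⟩ : EdgeDart E) (⟨(b, w), hbw⟩ : EdgeDart E) := by
      rcases Nat.lt_or_gt_of_ne (hE.ne_of_adj hbw) with h' | h'
      · exact hup b w (hE.mem_of_adj hbw h')
      · exact ih w h' b hbw
    exact key.imp (fun h => h.trans hs) fun ⟨p, hp⟩ => ⟨p, hp.trans hs⟩

/-- The faces are the outer one and one for every edge in `lids E`. -/
theorem numFaces_modelMap (hE : IsGood n E) (hn : 2 ≤ n) :
    (modelMap hE).numFaces = (lids E).card + 1 := by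
  let r : EdgeDart E := ⟨(0, 1), Or.inl (hE.zero_one_mem hn)⟩
  have hne : ¬ IsEmpty (modelMap hE).Dart := fun h => h.elim r
  rw [CombMap.numFaces, if_neg hne]
  let G : Option (lids E) → Quotient (Equiv.Perm.SameCycle.setoid (modelMap hE).faceNext) :=
    fun o => o.elim (Quotient.mk _ r)
      fun p => Quotient.mk _ (⟨p.1, Or.inl (mem_lids.1 p.2).1⟩ : EdgeDart E)
  have hroot : ∀ p : lids E, ¬ (modelMap hE).faceNext.SameCycle
      (⟨p.1, Or.inl (mem_lids.1 p.2).1⟩ : EdgeDart E) r := by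
    rintro ⟨⟨u, v⟩, hp⟩ h
    have := hE.eq_of_sameCycle_lid hp (hE.zero_one_mem hn) h
    obtain ⟨rfl, rfl⟩ : 0 = u ∧ 1 = v := Prod.ext_iff.1 this
    obtain ⟨-, u', h1, h2⟩ := mem_lids.1 hp
    have := (hE.lt h2).1
    omega
  have hG : Function.Bijective G := by
    constructor
    · rintro (_ | p) (_ | q) h
      · rfl
      · exact absurd (Quotient.exact h).symm (hroot q)
      · exact absurd (Quotient.exact h) (hroot p)
      · congr 1
        obtain ⟨⟨u, v⟩, hp⟩ := p
        obtain ⟨⟨a, b⟩, hq⟩ := q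
        exact Subtype.ext (hE.eq_of_sameCycle_lid hp (mem_lids.1 hq).1 (Quotient.exact h)).symm
    · intro q
      induction q using Quotient.inductionOn with | _ d
      rcases hE.exists_sameCycle hn d with h | ⟨p, h⟩
      · exact ⟨none, Quotient.sound h⟩
      · exact ⟨some p, Quotient.sound h⟩
  rw [← Nat.card_congr (Equiv.ofBijective G hG), Finite.card_option, Nat.card_eq_fintype_card,
    Fintype.card_coe]

/-- The edges that are not in `lids E` correspond to their upper ends, the vertices
`1, …, n - 1`. -/
theorem card_lids (hE : IsGood n E) (hn : 0 < n) : (lids E).card + n = E.card + 1 := by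
  classical
  have h1 : (E \ lids E).card = (Finset.Ioo 0 n).card := by
    refine Finset.card_bij (fun p _ => p.2) ?_ ?_ ?_
    · rintro ⟨u, v⟩ h
      have := hE.lt (Finset.mem_sdiff.1 h).1
      simp
      omega
    · rintro ⟨u, v⟩ h ⟨u', v'⟩ h' (rfl : v = v')
      obtain ⟨h1, h2⟩ := Finset.mem_sdiff.1 h
      obtain ⟨h1', h2'⟩ := Finset.mem_sdiff.1 h'
      rw [mem_lids] at h2 h2'
      rcases Nat.lt_trichotomy u u' with h | rfl | h
      · exact absurd ⟨h1, u', h, h1'⟩ h2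
      · rfl
      · exact absurd ⟨h1', u, h, h1⟩ h2'
    · intro v hv
      rw [Finset.mem_Ioo] at hv
      have hne : ((nbrs E v).filter (· < v)).Nonempty := by
        obtain ⟨u, hu⟩ := hE.exists_lower v hv.1 hv.2
        exact ⟨u, Finset.mem_filter.2 ⟨mem_nbrs.2 (Or.inr hu), (hE.lt hu).1⟩⟩
      have hm := Finset.mem_filter.1 (Finset.max'_mem _ hne)
      refine ⟨(_, v), Finset.mem_sdiff.2
        ⟨hE.mem_of_adj (mem_nbrs.1 hm.1).symm hm.2, fun h => ?_⟩, rfl⟩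
      obtain ⟨-, u', h1, h2⟩ := mem_lids.1 h
      have := Finset.le_max' ((nbrs E v).filter (· < v)) u'
        (Finset.mem_filter.2 ⟨mem_nbrs.2 (Or.inr h2), (hE.lt h2).1⟩)
      omega
  have h2 : lids E ⊆ E := Finset.filter_subset _ _
  rw [Finset.card_sdiff_of_subset h2, Nat.card_Ioo] at h1
  have := Finset.card_le_card h2
  omega

theorem card_edgeDart (hE : IsGood n E) : Nat.card (EdgeDart E) = 2 * E.card := by
  have h : {p : ℕ × ℕ | EdgeAdj E p.1 p.2} =
      ((E ∪ E.image Prod.swap : Finset (ℕ × ℕ)) : Set (ℕ × ℕ)) := by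
    ext ⟨u, v⟩
    simp [EdgeAdj]
  have h1 : Nat.card (EdgeDart E) = Set.ncard {p : ℕ × ℕ | EdgeAdj E p.1 p.2} := rfl
  rw [h1, h, Set.ncard_coe_finset, Finset.card_union_of_disjoint,
    Finset.card_image_of_injective _ Prod.swap_injective, two_mul]
  rw [Finset.disjoint_left]
  rintro ⟨u, v⟩ h1 h2
  simp only [Finset.mem_image, Prod.exists, Prod.swap_prod_mk, Prod.mk.injEq] at h2
  obtain ⟨a, b, h3, rfl, rfl⟩ := h2
  have := hE.lt h1
  have := hE.lt h3
  omega

theorem numEdges_modelMap (hE : IsGood n E) : (modelMap hE).numEdges = E.card := by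
  have : Finite (modelMap hE).Dart := (modelMap hE).finite_dart
  have h1 : 2 * (modelMap hE).numEdges = Nat.card (EdgeDart E) :=
    Equiv.Perm.two_mul_numCycles_involution (modelMap hE).rev_rev (modelMap hE).rev_ne
  rw [hE.card_edgeDart] at h1
  omega

theorem isPlanar_modelMap (hE : IsGood n E) (hn : 2 ≤ n) : (modelMap hE).IsPlanar := by
  constructor
  · have h0 : ∀ v (hv : v < n), (modelMap hE).graph.Reachable (⟨0, by omega⟩ : Fin n)
        (⟨v, hv⟩ : Fin n) := by
      intro v
      induction v using Nat.strong_induction_on with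
      | _ v ih =>
      intro hv
      rcases Nat.eq_zero_or_pos v with rfl | hv0
      · rfl
      · obtain ⟨u, hu⟩ := hE.exists_lower v hv0 hv
        have huv := (hE.lt hu).1
        refine (ih u huv (by omega)).trans (SimpleGraph.Adj.reachable ?_)
        refine (SimpleGraph.fromRel_adj _ _ _).2 ⟨fun h => ?_,
          Or.inl ⟨(⟨(u, v), Or.inl hu⟩ : EdgeDart E), rfl, rfl⟩⟩
        have := Fin.mk.inj_iff.1 h
        omega
    have : Nonempty (modelMap hE).Vertex := ⟨(⟨0, by omega⟩ : Fin n)⟩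
    exact ⟨fun a b => (h0 a.1 a.2).symm.trans (h0 b.1 b.2)⟩
  · have h1 : (modelMap hE).numVertices = n := by
      rw [CombMap.numVertices]
      exact Nat.card_fin n
    rw [h1, hE.numFaces_modelMap hn, hE.numEdges_modelMap]
    have := hE.card_lids (by omega)
    omega

/-- The rooted map encoded by a good set of edges; its root goes from `0` to `1`. -/
noncomputable def model (hE : IsGood n E) (hn : 2 ≤ n) : RootedMap where
  toCombMap := modelMap hE
  planar := hE.isPlanar_modelMap hn
  root := some (⟨(0, 1), Or.inl (hE.zero_one_mem hn)⟩ : EdgeDart E)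
  root_eq_none_iff := by
    constructor
    · intro h; cases h
    · intro h; exact h.elim (⟨(0, 1), Or.inl (hE.zero_one_mem hn)⟩ : EdgeDart E)

theorem model_mem_outerplanarMaps (hE : IsGood n E) (hn : 2 ≤ n) :
    hE.model hn ∈ RootedMap.outerplanarMaps n := by
  refine ⟨⟨fun d h => ?_, fun d e h1 h2 => ?_⟩, ?_, Nat.card_fin n⟩
  · exact hE.ne_of_adj d.2 (Fin.mk.inj_iff.1 h).symm
  · exact Subtype.ext (Prod.ext (Fin.mk.inj_iff.1 h1) (Fin.mk.inj_iff.1 h2))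
  · rintro r hr v
    obtain rfl := Option.some_injective _ hr
    obtain ⟨w, hw, hs⟩ := hE.sameCycle_root_start hn v.1 v.2
    exact ⟨_, hs, rfl⟩

theorem isBipartite_model_iff (hE : IsGood n E) (hn : 2 ≤ n) :
    (hE.model hn).IsBipartite ↔ IsShifted 2 E := by
  constructor
  · rintro ⟨c', hc⟩
    let c : Fin n → Bool := c'
    refine ⟨fun v => if h : v < n then (if c (⟨v, h⟩ : Fin n) then 1 else 0) else 0,
      fun u v huv => ?_⟩
    have h1 := hE.lt huv
    have h2 := hc (⟨(u, v), Or.inl huv⟩ : EdgeDart E)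
    have h3 : c (⟨u, by omega⟩ : Fin n) ≠ c (⟨v, h1.2⟩ : Fin n) := h2
    simp only [dif_pos h1.2, dif_pos (show u < n by omega)]
    revert h3
    cases c (⟨u, by omega⟩ : Fin n) <;> cases c (⟨v, h1.2⟩ : Fin n) <;> decide
  · rintro ⟨h, hh⟩
    have key : ∀ a b : ZMod 2, b = a + 1 → decide (a = 1) ≠ decide (b = 1) := by decide
    refine ⟨fun v : Fin n => decide (h v.1 = 1), ?_⟩
    rintro ⟨⟨u, v⟩, huv | huv⟩
    · exact key _ _ (hh u v huv)
    · exact (key _ _ (hh v u huv)).symm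

end IsGood

/-! ### Isomorphic maps come from equal graphs -/

namespace IsGood

variable {n : ℕ} {E E' : Finset (ℕ × ℕ)}

/-- The last vertex among `0, …, m` that is joined to a larger vertex than `m` is joined to `m + 1`,
and `m + 1` comes next after one of its neighbours among `0, …, m`. -/
theorem exists_pivot (hE : IsGood n E) {m : ℕ} (hm : 1 ≤ m) (hmn : m + 1 < n) :
    ∃ q t, q ≤ m ∧ t ≤ m ∧ EdgeAdj E q t ∧ IsNext (nbrs E q) t (m + 1) ∧
      ∀ x ≤ m, ∀ y ∈ nbrs E x, m < y → x ≤ q := by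
  classical
  obtain ⟨p, hp⟩ := hE.exists_lower (m + 1) (by omega) hmn
  have hpm := (hE.lt hp).1
  have hne : ((Finset.range (m + 1)).filter fun x => ∃ y ∈ nbrs E x, m < y).Nonempty :=
    ⟨p, Finset.mem_filter.2 ⟨Finset.mem_range.2 hpm, m + 1, mem_nbrs.2 (Or.inl hp), by omega⟩⟩
  obtain ⟨q, hq, hmax⟩ := Finset.exists_max_image _ id hne
  simp only [Finset.mem_filter, Finset.mem_range, id] at hq hmax
  obtain ⟨hqm, y, hy, hmy⟩ := hq
  have hmax' : ∀ x ≤ m, ∀ y ∈ nbrs E x, m < y → x ≤ q := fun x hx y hy hmy =>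
    hmax x ⟨by omega, y, hy, hmy⟩
  have hqE : (q, m + 1) ∈ E := by
    rcases (hmax' p (by omega) (m + 1) (mem_nbrs.2 (Or.inl hp)) (by omega)).eq_or_lt with rfl | h
    · exact hp
    · have hqy := hE.mem_of_adj (mem_nbrs.1 hy) (by omega)
      have := hE.noncrossing hp hqy h hqm
      obtain rfl : y = m + 1 := by omega
      exact hqy
  have hne' : ((nbrs E q).filter (· ≤ m)).Nonempty := by
    rcases Nat.eq_zero_or_pos q with rfl | h0
    · exact ⟨1, Finset.mem_filter.2 ⟨mem_nbrs.2 (Or.inl (hE.zero_one_mem (by omega))), hm⟩⟩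
    · obtain ⟨u, hu⟩ := hE.exists_lower q h0 (by omega)
      have := (hE.lt hu).1
      exact ⟨u, Finset.mem_filter.2 ⟨mem_nbrs.2 (Or.inr hu), by omega⟩⟩
  obtain ⟨ht, htm⟩ := Finset.mem_filter.1 (Finset.max'_mem _ hne')
  refine ⟨q, _, by omega, htm, mem_nbrs.1 ht,
    ⟨mem_nbrs.2 (Or.inl hqE), Or.inl ⟨by omega, fun z hz htz => ?_⟩⟩, hmax'⟩
  by_contra! hzm
  have := Finset.le_max' ((nbrs E q).filter (· ≤ m)) z (Finset.mem_filter.2 ⟨hz, by omega⟩)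
  omega

section Iso

variable (hE : IsGood n E) (hE' : IsGood n E') (hn : 2 ≤ n)

/-- The bijection of the vertices in an isomorphism between encoded maps. -/
def isoVertex {hE : IsGood n E} {hE' : IsGood n E'} {hn : 2 ≤ n}
    (f : RootedMap.Iso (hE.model hn) (hE'.model hn)) : Fin n ≃ Fin n := f.vertexEquiv

/-- The bijection of the darts in an isomorphism between encoded maps. -/
def isoDart {hE : IsGood n E} {hE' : IsGood n E'} {hn : 2 ≤ n}
    (f : RootedMap.Iso (hE.model hn) (hE'.model hn)) : EdgeDart E ≃ EdgeDart E' := f.dartEquiv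

variable {hE hE' hn} (f : RootedMap.Iso (hE.model hn) (hE'.model hn))

theorem isoDart_fst {u v : Fin n} (h : EdgeAdj E u v) :
    (isoDart f ⟨(u, v), h⟩).1.1 = isoVertex f u :=
  Fin.ext_iff.1 (f.map_origin (⟨(u, v), h⟩ : EdgeDart E))

theorem isoDart_snd {u v : Fin n} (h : EdgeAdj E u v) :
    (isoDart f ⟨(u, v), h⟩).1.2 = isoVertex f v := by
  have h1 := isoDart_fst f (u := v) (v := u) h.symm
  have h2 : (hE'.model hn).rev (isoDart f ⟨(u, v), h⟩) = isoDart f ⟨(v, u), h.symm⟩ :=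
    f.map_rev (⟨(u, v), h⟩ : EdgeDart E)
  rw [← h2] at h1
  exact h1

theorem isNext_isoVertex {u v w : Fin n} (h : EdgeAdj E u v) (hw : IsNext (nbrs E u) v w) :
    IsNext (nbrs E' (isoVertex f u)) (isoVertex f v) (isoVertex f w) := by
  have h1 := isNext_rotDart (isoDart f ⟨(u, v), h⟩)
  have h2 : rotDart (isoDart f ⟨(u, v), h⟩) = isoDart f (rotDart ⟨(u, v), h⟩) :=
    f.map_rot (⟨(u, v), h⟩ : EdgeDart E)
  rw [h2, rotDart_eq h hw, isoDart_fst f h, isoDart_snd f h, isoDart_snd f] at h1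
  exact h1

theorem isoVertex_root :
    (isoVertex f ⟨0, by omega⟩ : ℕ) = 0 ∧ (isoVertex f ⟨1, by omega⟩ : ℕ) = 1 := by
  have h1 : EdgeAdj E ((⟨0, by omega⟩ : Fin n) : ℕ) ((⟨1, by omega⟩ : Fin n) : ℕ) :=
    Or.inl (hE.zero_one_mem hn)
  have h := Option.some_injective _ (f.map_root)
  have h' : (⟨(0, 1), Or.inl (hE'.zero_one_mem hn)⟩ : EdgeDart E') = isoDart f ⟨(_, _), h1⟩ := h
  have h2 := isoDart_fst f h1
  have h3 := isoDart_snd f h1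
  rw [← h'] at h2 h3
  exact ⟨h2.symm, h3.symm⟩

/-- An isomorphism preserves the order of the outer walk, so that it is the identity. -/
theorem isoVertex_eq (v : ℕ) (hv : v < n) : (isoVertex f ⟨v, hv⟩ : ℕ) = v := by
  induction v using Nat.strong_induction_on with
  | _ v ih =>
  rcases Nat.lt_or_ge v 2 with h2 | h2
  · interval_cases v
    · exact (isoVertex_root f).1
    · exact (isoVertex_root f).2
  obtain ⟨m, rfl⟩ : ∃ m, v = m + 1 := ⟨v - 1, by omega⟩
  have hinv : ∀ k (hk : k < m + 1), (isoVertex f.symm ⟨k, by omega⟩ : ℕ) = k := by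
    intro k hk
    have h1 : isoVertex f ⟨k, by omega⟩ = ⟨k, by omega⟩ := Fin.ext (ih k hk (by omega))
    have h2 : isoVertex f.symm (isoVertex f ⟨k, by omega⟩) = ⟨k, by omega⟩ :=
      f.vertexEquiv.symm_apply_apply (⟨k, by omega⟩ : Fin n)
    rw [h1] at h2
    exact congrArg Fin.val h2
  have hlt : ∀ {E E' : Finset (ℕ × ℕ)} {hE : IsGood n E} {hE' : IsGood n E'}
      (f : RootedMap.Iso (hE.model hn) (hE'.model hn)),
      (∀ k (hk : k < m + 1), (isoVertex f ⟨k, by omega⟩ : ℕ) = k) →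
      m < isoVertex f ⟨m + 1, hv⟩ := by
    intro E E' hE hE' f hf
    by_contra! h
    have h1 : isoVertex f (isoVertex f ⟨m + 1, hv⟩) = isoVertex f ⟨m + 1, hv⟩ :=
      Fin.ext (hf _ (Nat.lt_succ_of_le h))
    have h2 := congrArg Fin.val ((isoVertex f).injective h1)
    simp only at h2
    omega
  have hfix : ∀ k (hk : k < m + 1), (isoVertex f ⟨k, by omega⟩ : ℕ) = k := fun k hk =>
    ih k hk (by omega)
  obtain ⟨q, t, hq, ht, hqt, hnext, hmax⟩ := hE.exists_pivot (m := m) (by omega) hv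
  obtain ⟨q', t', hq', ht', hqt', hnext', hmax'⟩ := hE'.exists_pivot (m := m) (by omega) hv
  have h1 := isNext_isoVertex f (u := ⟨q, by omega⟩) (v := ⟨t, by omega⟩) (w := ⟨m + 1, hv⟩)
    hqt hnext
  have h1' := isNext_isoVertex f.symm (u := ⟨q', by omega⟩) (v := ⟨t', by omega⟩)
    (w := ⟨m + 1, hv⟩) hqt' hnext'
  rw [hfix q (by omega), hfix t (by omega)] at h1
  rw [hinv q' (by omega), hinv t' (by omega)] at h1'
  have hl := hlt f hfix
  have hqq' : q = q' := le_antisymm (hmax' q hq _ h1.1 hl)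
    (hmax q' hq' _ h1'.1 (hlt f.symm hinv))
  subst hqq'
  obtain ⟨-, ⟨h3, h4⟩ | ⟨h3, -⟩⟩ := h1
  · have := h4 _ hnext'.1 (by omega)
    omega
  · have := h3 _ hnext'.1
    omega

theorem subset_of_iso (f : RootedMap.Iso (hE.model hn) (hE'.model hn)) : E ⊆ E' := by
  rintro ⟨u, v⟩ huv
  have hlt := hE.lt huv
  have h1 : EdgeAdj E ((⟨u, by omega⟩ : Fin n) : ℕ) ((⟨v, hlt.2⟩ : Fin n) : ℕ) := Or.inl huv
  have h2 := (isoDart f ⟨(_, _), h1⟩).2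
  rw [isoDart_fst f h1, isoDart_snd f h1, isoVertex_eq f, isoVertex_eq f] at h2
  exact hE'.mem_of_adj h2 hlt.1

theorem eq_of_iso (f : RootedMap.Iso (hE.model hn) (hE'.model hn)) : E = E' :=
  (subset_of_iso f).antisymm (subset_of_iso f.symm)

end Iso

end IsGood

/-! ### The walk around the outer face -/

/-- A criterion for successors in the cyclic order, in terms of the ranks of the elements when they
are counted from the point `l` on. -/
theorem isNext_of_rank {S : Finset ℕ} {l n x y : ℕ} (hl : l ∉ S) (hS : ∀ z ∈ S, z < n)
    (hx : x ∈ S) (hy : y ∈ S) {ρ : ℕ → ℕ} (hρ : ∀ z, ρ z = if l < z then z else z + n)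
    (h : (ρ x < ρ y ∧ ∀ z ∈ S, ρ z ≤ ρ x ∨ ρ y ≤ ρ z) ∨ ∀ z ∈ S, ρ y ≤ ρ z ∧ ρ z ≤ ρ x) :
    IsNext S x y := by
  have hne : ∀ z ∈ S, z ≠ l := fun z hz h => hl (h ▸ hz)
  have hx1 := hne x hx
  have hy1 := hne y hy
  have hxn := hS x hx
  have hyn := hS y hy
  have hρx := hρ x
  have hρy := hρ y
  refine ⟨hy, ?_⟩
  by_cases hc : (l < x ∧ x < y) ∨ (x < y ∧ y < l) ∨ (x < l ∧ l < y)
  · left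
    refine ⟨by omega, fun z hz hxz => ?_⟩
    have hρz := hρ z
    have := hne z hz
    have := hS z hz
    rcases h with ⟨h1, h2⟩ | h2 <;> have := h2 z hz <;> split_ifs at * <;> omega
  · right
    refine ⟨fun z hz => ?_, fun z hz => ?_⟩
    all_goals
      have hρz := hρ z
      have := hne z hz
      have := hS z hz
      rcases h with ⟨h1, h2⟩ | h2 <;> have := h2 z hz <;> split_ifs at * <;> omega

/-- A finite type can be numbered in the order of an injective function. -/
theorem exists_equiv_fin_lt {V : Type*} [Finite V] {n : ℕ} (hn : Nat.card V = n) {t : V → ℕ}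
    (ht : Function.Injective t) : ∃ e : Fin n ≃ V, ∀ i j, i < j ↔ t (e i) < t (e j) := by
  let := Fintype.ofFinite V
  let : LinearOrder V := LinearOrder.lift' t ht
  let e : Fin n ≃o V := monoEquivOfFin V (by rw [← hn, Nat.card_eq_fintype_card])
  exact ⟨e.toEquiv, fun i j => (e.lt_iff_lt (x := i) (y := j)).symm⟩

namespace CombMap

variable (M : CombMap) (r : M.Dart)

instance : Finite M.Dart := M.finite_dart

instance : Finite M.Vertex := M.finite_vertex

/-- The boundary walk of the face to the right of `r` visits all vertices. -/
def VisitsAll : Prop := ∀ v, ∃ d, M.faceNext.SameCycle r d ∧ M.origin d = v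

/-- The boundary walk of the face to the right of `r`. -/
def walk (k : ℕ) : M.Dart := (M.faceNext ^ k) r

/-- The time at which the boundary walk of the face to the right of `r` first visits a vertex. -/
noncomputable def firstVisit (v : M.Vertex) : ℕ := sInf {k | M.origin (M.walk r k) = v}

/-- The dart by which the boundary walk leaves a vertex for the first time. -/
noncomputable def startDart (v : M.Vertex) : M.Dart := M.walk r (M.firstVisit r v)

/-- The position of a dart around its origin, counted counterclockwise from `startDart`. -/
noncomputable def position (d : M.Dart) : ℕ :=
  sInf {k | (M.rot ^ k) (M.startDart r (M.origin d)) = d}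

theorem origin_rot (d : M.Dart) : M.origin (M.rot d) = M.origin d :=
  (M.origin_eq_iff _ _).2 (Equiv.Perm.sameCycle_apply_left.2 (Equiv.Perm.SameCycle.refl _ _))

theorem origin_rev (d : M.Dart) : M.origin (M.rev d) = M.target d := rfl

theorem target_rev (d : M.Dart) : M.target (M.rev d) = M.origin d := by
  rw [target, M.rev_rev]

theorem walk_succ (k : ℕ) : M.walk r (k + 1) = M.faceNext (M.walk r k) := by
  rw [walk, pow_succ', Equiv.Perm.mul_apply, walk]

theorem origin_walk_succ (k : ℕ) : M.origin (M.walk r (k + 1)) = M.target (M.walk r k) := by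
  rw [walk_succ, faceNext, Equiv.Perm.mul_apply, origin_rot, origin_rev]

theorem walk_add_congr (k l : ℕ) (x : ℕ) (h : M.walk r k = M.walk r l) :
    M.walk r (k + x) = M.walk r (l + x) := by
  rw [walk, walk, add_comm k, add_comm l, pow_add, pow_add, Equiv.Perm.mul_apply,
    Equiv.Perm.mul_apply]
  exact congrArg _ h

variable {M r}

theorem origin_startDart (hout : M.VisitsAll r) (v : M.Vertex) :
    M.origin (M.startDart r v) = v := by
  obtain ⟨d, hd, rfl⟩ := hout v
  obtain ⟨k, -, hk⟩ := hd.exists_pow_eq'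
  exact Nat.sInf_mem (s := {k | M.origin (M.walk r k) = M.origin d})
    ⟨k, congrArg M.origin hk⟩

theorem firstVisit_le (k : ℕ) : M.firstVisit r (M.origin (M.walk r k)) ≤ k :=
  Nat.sInf_le rfl

theorem firstVisit_injective (hout : M.VisitsAll r) :
    Function.Injective (M.firstVisit r) := fun u v h => by
  rw [← origin_startDart hout u, ← origin_startDart hout v, startDart, startDart, h]

/-- The walk does not repeat a dart before it has visited all vertices. -/
theorem walk_injOn (hout : M.VisitsAll r) (v : M.Vertex) :
    ∀ k ≤ M.firstVisit r v, ∀ l ≤ M.firstVisit r v, M.walk r k = M.walk r l → k = l := by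
  have key : ∀ k l, k < l → l ≤ M.firstVisit r v → M.walk r k ≠ M.walk r l := by
    intro k l hkl hl h
    have h1 := M.walk_add_congr r k l (M.firstVisit r v - l) h
    rw [show l + (M.firstVisit r v - l) = M.firstVisit r v by omega] at h1
    have h2 := M.firstVisit_le (r := r) (k + (M.firstVisit r v - l))
    rw [h1] at h2
    have h3 := origin_startDart hout v
    rw [startDart] at h3
    rw [h3] at h2
    omega
  intro k hk l hl h
  rcases Nat.lt_trichotomy k l with h' | h' | h'
  · exact absurd h (key k l h' hl)
  · exact h'
  · exact absurd h.symm (key l k h' hk)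

theorem rot_pow_position (hout : M.VisitsAll r) (d : M.Dart) :
    (M.rot ^ M.position r d) (M.startDart r (M.origin d)) = d := by
  have h : M.rot.SameCycle (M.startDart r (M.origin d)) d :=
    (M.origin_eq_iff _ _).1 (origin_startDart hout _)
  obtain ⟨k, -, hk⟩ := h.exists_pow_eq'
  exact Nat.sInf_mem (s := {k | (M.rot ^ k) (M.startDart r (M.origin d)) = d}) ⟨k, hk⟩

theorem position_le {d : M.Dart} {k : ℕ} (h : (M.rot ^ k) (M.startDart r (M.origin d)) = d) :
    M.position r d ≤ k := Nat.sInf_le h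

theorem position_rot (hout : M.VisitsAll r) {d : M.Dart}
    (h : M.rot d ≠ M.startDart r (M.origin d)) :
    M.position r (M.rot d) = M.position r d + 1 := by
  have hd := rot_pow_position hout d
  refine le_antisymm (position_le ?_) ?_
  · rw [origin_rot, pow_succ', Equiv.Perm.mul_apply, hd]
  · have h1 := rot_pow_position hout (M.rot d)
    rw [origin_rot] at h1
    rcases hk : M.position r (M.rot d) with _ | k
    · rw [hk] at h1
      exact absurd h1.symm h
    · rw [hk, pow_succ', Equiv.Perm.mul_apply] at h1
      have := position_le (M.rot.injective h1)
      omega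

theorem position_le_of_rot_eq (hout : M.VisitsAll r) {d d' : M.Dart}
    (h : M.rot d = M.startDart r (M.origin d))
    (ho : M.origin d' = M.origin d) : M.position r d' ≤ M.position r d := by
  by_contra! hlt
  have h1 := rot_pow_position hout d
  have h2 := rot_pow_position hout d'
  have h3 : (M.rot ^ (M.position r d + 1)) (M.startDart r (M.origin d)) =
      M.startDart r (M.origin d) := by
    rw [pow_succ', Equiv.Perm.mul_apply, h1, h]
  rw [show M.position r d' = M.position r d' - (M.position r d + 1) + (M.position r d + 1) by omega,
    pow_add, Equiv.Perm.mul_apply, ho, h3, ← ho] at h2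
  have := position_le h2
  omega

theorem position_startDart (hout : M.VisitsAll r) (v : M.Vertex) :
    M.position r (M.startDart r v) = 0 := by
  refine Nat.le_zero.1 (position_le ?_)
  rw [origin_startDart hout, pow_zero, Equiv.Perm.one_apply]

theorem eq_of_position_eq (hout : M.VisitsAll r) {d d' : M.Dart} (ho : M.origin d = M.origin d')
    (h : M.position r d = M.position r d') : d = d' := by
  rw [← rot_pow_position hout d, ← rot_pow_position hout d', ho, h]

end CombMap

/-! ### Every outerplanar map comes from a noncrossing graph -/

namespace CombMap

/-- The numbering of the vertices in the order in which the boundary walk of the face to the right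
of `r`, which visits all vertices, first meets them. -/
structure VisitOrder (M : CombMap) (r : M.Dart) (n : ℕ) where
  visitsAll : M.VisitsAll r
  equiv : Fin n ≃ M.Vertex
  lt_iff : ∀ i j, i < j ↔ M.firstVisit r (equiv i) < M.firstVisit r (equiv j)

theorem exists_visitOrder {M : CombMap} {r : M.Dart} (h : M.VisitsAll r) :
    Nonempty (M.VisitOrder r M.numVertices) := by
  obtain ⟨e, he⟩ := exists_equiv_fin_lt (V := M.Vertex) rfl (firstVisit_injective h)
  exact ⟨h, e, he⟩

namespace VisitOrder

variable {M : CombMap} {r : M.Dart} {n : ℕ} (L : M.VisitOrder r n)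

/-- The number of a vertex. -/
def label (v : M.Vertex) : ℕ := L.equiv.symm v

theorem label_lt (v : M.Vertex) : L.label v < n := (L.equiv.symm v).2

theorem label_injective : Function.Injective L.label := fun _ _ h =>
  L.equiv.symm.injective (Fin.ext h)

theorem label_lt_label {u v : M.Vertex} :
    L.label u < L.label v ↔ M.firstVisit r u < M.firstVisit r v := by
  have := L.lt_iff (L.equiv.symm u) (L.equiv.symm v)
  rw [L.equiv.apply_symm_apply, L.equiv.apply_symm_apply] at this
  exact this

theorem exists_label_eq {i : ℕ} (hi : i < n) : ∃ v, L.label v = i :=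
  ⟨L.equiv ⟨i, hi⟩, congrArg Fin.val (L.equiv.symm_apply_apply ⟨i, hi⟩)⟩

/-- The vertex with a given number (or the origin of `r`, if there is none). -/
noncomputable def vertex (i : ℕ) : M.Vertex := if h : i < n then L.equiv ⟨i, h⟩ else M.origin r

theorem label_vertex {i : ℕ} (hi : i < n) : L.label (L.vertex i) = i := by
  rw [vertex, dif_pos hi, label, L.equiv.symm_apply_apply]

theorem vertex_label (v : M.Vertex) : L.vertex (L.label v) = v :=
  L.label_injective (L.label_vertex (L.label_lt v))

theorem label_origin_root : L.label (M.origin r) = 0 := by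
  by_contra h
  obtain ⟨v, hv⟩ := L.exists_label_eq (i := 0) (by have := L.label_lt (M.origin r); omega)
  have h1 : L.label v < L.label (M.origin r) := by omega
  have h2 := M.firstVisit_le (r := r) 0
  have h3 : M.walk r 0 = r := rfl
  rw [h3] at h2
  have := L.label_lt_label.1 h1
  omega

theorem firstVisit_vertex_zero : M.firstVisit r (L.vertex 0) = 0 := by
  have h2 := M.firstVisit_le (r := r) 0
  have h3 : M.walk r 0 = r := rfl
  have h4 : L.vertex 0 = M.origin r := by
    have h5 := L.vertex_label (M.origin r)
    rwa [L.label_origin_root] at h5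
  rw [h3] at h2
  rw [h4]
  omega

/-- The key of the linear order of the darts: around a circle that passes through the corners
of the outer face, with the vertices in decreasing order. -/
noncomputable def dartKey (d : M.Dart) : ℕ ×ₗ ℕ :=
  toLex (n - 1 - L.label (M.origin d), M.position r d)

theorem dartKey_lt_iff {d e : M.Dart} : L.dartKey d < L.dartKey e ↔
    L.label (M.origin e) < L.label (M.origin d) ∨
      L.label (M.origin d) = L.label (M.origin e) ∧ M.position r d < M.position r e := by
  have h1 := L.label_lt (M.origin d)
  have h2 := L.label_lt (M.origin e)
  rw [dartKey, dartKey, Prod.Lex.toLex_lt_toLex]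
  simp only
  omega

theorem dartKey_le_iff {d e : M.Dart} : L.dartKey d ≤ L.dartKey e ↔
    L.label (M.origin e) < L.label (M.origin d) ∨
      L.label (M.origin d) = L.label (M.origin e) ∧ M.position r d ≤ M.position r e := by
  rw [← not_lt, dartKey_lt_iff]
  omega

theorem dartKey_injective : Function.Injective L.dartKey := by
  intro d e h
  have h1 : n - 1 - L.label (M.origin d) = n - 1 - L.label (M.origin e) :=
    congrArg (fun p : ℕ ×ₗ ℕ => (ofLex p).1) h
  have h2 : M.position r d = M.position r e := congrArg (fun p : ℕ ×ₗ ℕ => (ofLex p).2) h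
  have h3 := L.label_lt (M.origin d)
  have h4 := L.label_lt (M.origin e)
  exact eq_of_position_eq L.visitsAll (L.label_injective (by omega)) h2

open Classical in
/-- The rotations of all vertices joined into one cycle, which runs through the corners of
the outer face. -/
noncomputable def joined : Equiv.Perm M.Dart :=
  Equiv.Perm.swapProd (fun i => M.startDart r (L.vertex i)) (n - 1) * M.rot

theorem startDart_vertex_ne {i k : ℕ} (hik : i < k) (hk : k ≤ n - 1) :
    M.startDart r (L.vertex i) ≠ M.startDart r (L.vertex k) := by
  intro h
  have h0 : 0 < n := (Nat.zero_le _).trans_lt (L.label_lt (M.origin r))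
  have h1 := congrArg (fun d => L.label (M.origin d)) h
  simp only [origin_startDart L.visitsAll] at h1
  rw [L.label_vertex (by omega), L.label_vertex (by omega)] at h1
  omega

theorem joined_apply_of_ne {d : M.Dart} (h : M.rot d ≠ M.startDart r (M.origin d)) :
    L.joined d = M.rot d := by
  classical
  refine Equiv.Perm.swapProd_apply_of_ne fun i _ h' => h ?_
  have h1 : M.origin d = L.vertex i := by
    rw [← M.origin_rot d, h', origin_startDart L.visitsAll]
  rw [h', h1]

theorem joined_apply_of_eq {d : M.Dart} (h : M.rot d = M.startDart r (M.origin d))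
    (h0 : 0 < L.label (M.origin d)) :
    L.joined d = M.startDart r (L.vertex (L.label (M.origin d) - 1)) := by
  classical
  have h1 := L.label_lt (M.origin d)
  have h2 := Equiv.Perm.swapProd_apply_succ (s := fun i => M.startDart r (L.vertex i))
    (j := n - 1) (i := L.label (M.origin d) - 1)
    (fun i k hik hk => L.startDart_vertex_ne hik hk) (by omega)
  rw [Nat.sub_add_cancel h0, L.vertex_label] at h2
  rw [joined, Equiv.Perm.mul_apply, h]
  convert h2

/-- In the linear order of the darts, `joined` maps every dart but the last to its successor. -/
theorem joined_isSucc {x y : M.Dart} (hxy : L.dartKey x < L.dartKey y) :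
    L.dartKey x < L.dartKey (L.joined x) ∧ L.dartKey (L.joined x) ≤ L.dartKey y := by
  have hxn := L.label_lt (M.origin x)
  rw [dartKey_lt_iff] at hxy
  rw [dartKey_lt_iff, dartKey_le_iff]
  by_cases h : M.rot x = M.startDart r (M.origin x)
  · have hlt : L.label (M.origin y) < L.label (M.origin x) := by
      rcases hxy with h' | ⟨h1, h2⟩
      · exact h'
      · have := position_le_of_rot_eq L.visitsAll h (L.label_injective h1).symm
        omega
    rw [L.joined_apply_of_eq h (by omega), origin_startDart L.visitsAll,
      L.label_vertex (by omega), position_startDart L.visitsAll]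
    omega
  · rw [L.joined_apply_of_ne h, M.origin_rot, position_rot L.visitsAll h]
    omega

/-- The product of `joined` and `rev` has the faces of the map as its cycles, except that the outer
face is split into `n` cycles. -/
theorem numCycles_joined_mul_rev :
    (L.joined * M.rev).numCycles = M.faceNext.numCycles + (n - 1) := by
  classical
  have h0 : 0 < n := (Nat.zero_le _).trans_lt (L.label_lt (M.origin r))
  rw [joined, mul_assoc]
  have := Equiv.Perm.numCycles_swapProd_mul (s := fun i => M.startDart r (L.vertex i))
    (t := fun i => M.firstVisit r (L.vertex i)) (w := M.walk r) (j := n - 1) M.faceNext ?_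
    L.firstVisit_vertex_zero (fun _ _ => rfl) (walk_injOn L.visitsAll _)
    (fun k _ => (M.walk_succ r k).symm)
  · exact this
  · intro i hi
    rw [← L.label_lt_label, L.label_vertex (by omega), L.label_vertex (by omega)]
    omega

theorem numVertices_eq (L : M.VisitOrder r n) : M.numVertices = n := by
  rw [numVertices, ← Nat.card_congr L.equiv, Nat.card_fin]

/-- In a planar map, the edges do not cross when the darts are placed on a circle. -/
theorem noncrossing (hM : M.IsPlanar) {a x : M.Dart} (h1 : L.dartKey a < L.dartKey x)
    (h2 : L.dartKey x < L.dartKey (M.rev a)) (h3 : L.dartKey (M.rev a) < L.dartKey (M.rev x)) :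
    False := by
  classical
  let _ : Fintype M.Dart := Fintype.ofFinite _
  let _ : LinearOrder M.Dart := LinearOrder.lift' L.dartKey L.dartKey_injective
  refine Equiv.Perm.noncrossing_of_numCycles (c := L.joined) (α := M.rev)
    (fun x y hxy => L.joined_isSucc hxy) M.rev_rev ?_ h1 h2 h3
  have h0 : 0 < n := (Nat.zero_le _).trans_lt (L.label_lt (M.origin r))
  have h4 := hM.2
  have h5 : 2 * M.numEdges = Nat.card M.Dart :=
    Equiv.Perm.two_mul_numCycles_involution M.rev_rev M.rev_ne
  have h6 : M.numFaces = M.faceNext.numCycles := by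
    rw [numFaces, if_neg fun h => h.elim r]
    rfl
  rw [numCycles_joined_mul_rev, ← Nat.card_eq_fintype_card]
  rw [L.numVertices_eq] at h4
  omega

open Classical in
/-- The edges of the graph of the map, between the numbers of the vertices. -/
noncomputable def edges : Finset (ℕ × ℕ) :=
  (Finset.range n ×ˢ Finset.range n).filter fun p => p.1 < p.2 ∧
    ∃ d, L.label (M.origin d) = p.1 ∧ L.label (M.target d) = p.2

theorem mem_edges {i j : ℕ} : (i, j) ∈ L.edges ↔
    i < j ∧ ∃ d, L.label (M.origin d) = i ∧ L.label (M.target d) = j := by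
  simp only [edges, Finset.mem_filter, Finset.mem_product, Finset.mem_range,
    and_iff_right_iff_imp]
  rintro ⟨-, d, rfl, rfl⟩
  exact ⟨L.label_lt _, L.label_lt _⟩

theorem edgeAdj_iff (hM : M.IsSimple) {i j : ℕ} : EdgeAdj L.edges i j ↔
    ∃ d, L.label (M.origin d) = i ∧ L.label (M.target d) = j := by
  simp only [EdgeAdj, mem_edges]
  constructor
  · rintro (⟨-, d, h⟩ | ⟨-, d, h1, h2⟩)
    · exact ⟨d, h⟩
    · exact ⟨M.rev d, by rw [origin_rev, h2], by rw [target_rev, h1]⟩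
  · rintro ⟨d, h1, h2⟩
    have hne : i ≠ j := by
      rintro rfl
      exact hM.1 d (L.label_injective (h2.trans h1.symm))
    rcases Nat.lt_or_gt_of_ne hne with h | h
    · exact Or.inl ⟨h, d, h1, h2⟩
    · exact Or.inr ⟨h, M.rev d, by rw [origin_rev, h2], by rw [target_rev, h1]⟩

/-- A smaller neighbour of a vertex is the one from which the walk first enters the vertex. -/
theorem isGood_edges (hM : M.IsPlanar) : IsGood n L.edges where
  lt := by
    intro i j h
    obtain ⟨h, d, rfl, rfl⟩ := L.mem_edges.1 h
    exact ⟨h, L.label_lt _⟩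
  noncrossing := by
    intro a b x y hab hxy hax hxb
    obtain ⟨-, d, rfl, rfl⟩ := L.mem_edges.1 hab
    obtain ⟨-, e, rfl, rfl⟩ := L.mem_edges.1 hxy
    by_contra! hby
    refine L.noncrossing hM (a := M.rev e) (x := M.rev d) ?_ ?_ ?_ <;>
      rw [dartKey_lt_iff] <;> simp only [M.rev_rev, origin_rev] <;> exact Or.inl (by assumption)
  exists_lower := by
    intro i h0 hi
    have h1 : 0 < M.firstVisit r (L.vertex i) := by
      rw [← L.firstVisit_vertex_zero, ← L.label_lt_label, L.label_vertex hi,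
        L.label_vertex (by omega)]
      exact h0
    -- the dart by which the walk enters the vertex for the first time
    set k := M.firstVisit r (L.vertex i) - 1 with hk
    have h2 : M.target (M.walk r k) = L.vertex i := by
      rw [← origin_walk_succ, hk, Nat.sub_add_cancel h1]
      exact origin_startDart L.visitsAll _
    have h3 := M.firstVisit_le (r := r) k
    refine ⟨L.label (M.origin (M.walk r k)), L.mem_edges.2 ⟨?_, M.walk r k, rfl, ?_⟩⟩
    · rw [← L.label_vertex hi, L.label_lt_label]
      omega
    · rw [h2, L.label_vertex hi]

/-- Around a vertex, the targets of the darts are in increasing cyclic order, counted from the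
vertex itself on: that is the order of the ranks `ρ`. -/
theorem rank_target_lt (hM : M.IsPlanar) (hM' : M.IsSimple) {ρ : ℕ → ℕ} {d d' : M.Dart}
    (ho : M.origin d = M.origin d')
    (hρ : ∀ z, ρ z = if L.label (M.origin d) < z then z else z + n)
    (h : M.position r d < M.position r d') :
    ρ (L.label (M.target d)) < ρ (L.label (M.target d')) := by
  have ho' := congrArg L.label ho
  have hne : L.label (M.target d) ≠ L.label (M.target d') := fun h' => by
    have := hM'.2 d d' ho (L.label_injective h')
    rw [this] at h
    exact lt_irrefl _ h
  have hne1 : L.label (M.target d) ≠ L.label (M.origin d) := fun h' =>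
    hM'.1 d (L.label_injective h')
  have hne2 : L.label (M.target d') ≠ L.label (M.origin d') := fun h' =>
    hM'.1 d' (L.label_injective h')
  have hn := L.label_lt (M.target d)
  have hn' := L.label_lt (M.target d')
  -- the three ways in which the edges of `d` and `d'` might cross
  have hc1 : ¬ (L.label (M.origin d) < L.label (M.target d') ∧
      L.label (M.target d') < L.label (M.target d)) := by
    rintro ⟨h1, h2⟩
    refine L.noncrossing hM (a := M.rev d) (x := M.rev d') ?_ ?_ ?_ <;>
      rw [dartKey_lt_iff] <;> (try simp only [M.rev_rev, origin_rev]) <;> omega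
  have hc2 : ¬ (L.label (M.target d') < L.label (M.target d) ∧
      L.label (M.target d) < L.label (M.origin d)) := by
    rintro ⟨h1, h2⟩
    refine L.noncrossing hM (a := d) (x := d') ?_ ?_ ?_ <;>
      rw [dartKey_lt_iff] <;> (try simp only [origin_rev]) <;> omega
  have hc3 : ¬ (L.label (M.target d) < L.label (M.origin d) ∧
      L.label (M.origin d) < L.label (M.target d')) := by
    rintro ⟨h1, h2⟩
    refine L.noncrossing hM (a := M.rev d') (x := d) ?_ ?_ ?_ <;>
      rw [dartKey_lt_iff] <;> (try simp only [M.rev_rev, origin_rev]) <;> omega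
  rw [hρ, hρ]
  split_ifs <;> omega

/-- The rotation of the map is that of the graph `edges`. -/
theorem isNext_rot (hM : M.IsPlanar) (hM' : M.IsSimple) (d : M.Dart) :
    IsNext (nbrs L.edges (L.label (M.origin d))) (L.label (M.target d))
      (L.label (M.target (M.rot d))) := by
  have hmem : ∀ e, M.origin e = M.origin d →
      L.label (M.target e) ∈ nbrs L.edges (L.label (M.origin d)) := fun e he =>
    mem_nbrs.2 ((L.edgeAdj_iff hM').2 ⟨e, by rw [he], rfl⟩)
  have hdart : ∀ z ∈ nbrs L.edges (L.label (M.origin d)),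
      ∃ e, M.origin e = M.origin d ∧ L.label (M.target e) = z := by
    intro z hz
    obtain ⟨e, h1, h2⟩ := (L.edgeAdj_iff hM').1 (mem_nbrs.1 hz)
    exact ⟨e, L.label_injective h1, h2⟩
  have hor := M.origin_rot d
  set ρ : ℕ → ℕ := fun z => if L.label (M.origin d) < z then z else z + n with hρ
  have hmono : ∀ e e', M.origin e = M.origin d → M.origin e' = M.origin d →
      M.position r e < M.position r e' → ρ (L.label (M.target e)) < ρ (L.label (M.target e')) :=
    fun e e' he he' h => L.rank_target_lt hM hM' (he.trans he'.symm)
      (fun z => by rw [he]) h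
  have hmono' : ∀ e e', M.origin e = M.origin d → M.origin e' = M.origin d →
      M.position r e ≤ M.position r e' → ρ (L.label (M.target e)) ≤ ρ (L.label (M.target e')) := by
    intro e e' he he' h
    rcases h.eq_or_lt with h | h
    · rw [eq_of_position_eq L.visitsAll (he.trans he'.symm) h]
    · exact (hmono e e' he he' h).le
  refine isNext_of_rank (n := n) (ρ := ρ) ?_ ?_ (hmem d rfl) (hmem _ hor) (fun _ => rfl) ?_
  · intro h
    obtain ⟨e, h1, h2⟩ := hdart _ h
    exact hM'.1 e (L.label_injective (h2.trans (by rw [h1])))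
  · intro z hz
    obtain ⟨e, -, rfl⟩ := hdart z hz
    exact L.label_lt _
  · by_cases h : M.rot d = M.startDart r (M.origin d)
    · right
      intro z hz
      obtain ⟨e, he, rfl⟩ := hdart z hz
      refine ⟨hmono' _ _ hor he ?_, hmono' _ _ he rfl (position_le_of_rot_eq L.visitsAll h he)⟩
      rw [h, position_startDart L.visitsAll]
      exact Nat.zero_le _
    · left
      have hp := position_rot L.visitsAll h
      refine ⟨hmono _ _ rfl hor (by omega), fun z hz => ?_⟩
      obtain ⟨e, he, rfl⟩ := hdart z hz
      rcases Nat.lt_or_ge (M.position r d) (M.position r e) with h' | h'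
      · exact Or.inr (hmono' _ _ hor he (by omega))
      · exact Or.inl (hmono' _ _ he rfl h')

theorem label_target_root (hM' : M.IsSimple) : L.label (M.target r) = 1 := by
  have h0 := L.label_origin_root
  have hne : L.label (M.target r) ≠ L.label (M.origin r) := fun h => hM'.1 r (L.label_injective h)
  have hlt := L.label_lt (M.target r)
  by_contra h1
  have h2 : L.label (L.vertex 1) < L.label (M.target r) := by
    rw [L.label_vertex (by omega)]
    omega
  have h3 : L.label (L.vertex 0) < L.label (L.vertex 1) := by
    rw [L.label_vertex (by omega), L.label_vertex (by omega)]
    omega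
  rw [label_lt_label] at h2 h3
  have h4 := M.firstVisit_le (r := r) 1
  rw [show M.walk r 1 = M.walk r (0 + 1) from rfl, origin_walk_succ] at h4
  have h5 : M.walk r 0 = r := rfl
  rw [h5] at h4
  omega

/-- The darts of the map, as pairs of numbers of vertices. -/
noncomputable def dartEquiv (hM' : M.IsSimple) : M.Dart ≃ EdgeDart L.edges :=
  Equiv.ofBijective (fun d => ⟨(L.label (M.origin d), L.label (M.target d)),
      (L.edgeAdj_iff hM').2 ⟨d, rfl, rfl⟩⟩) (by
    constructor
    · intro d e h
      have h1 : L.label (M.origin d) = L.label (M.origin e) :=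
        congrArg (fun x : EdgeDart L.edges => x.1.1) h
      have h2 : L.label (M.target d) = L.label (M.target e) :=
        congrArg (fun x : EdgeDart L.edges => x.1.2) h
      exact hM'.2 d e (L.label_injective h1) (L.label_injective h2)
    · rintro ⟨⟨i, j⟩, h⟩
      obtain ⟨d, h1, h2⟩ := (L.edgeAdj_iff hM').1 h
      exact ⟨d, Subtype.ext (Prod.ext h1 h2)⟩)

end VisitOrder

end CombMap

namespace RootedMap

/-- Every outerplanar map is encoded by a good set of edges. -/
theorem exists_iso_model {M : RootedMap} {n : ℕ} (hn : 2 ≤ n) (hM : M ∈ outerplanarMaps n) :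
    ∃ E, ∃ hE : IsGood n E, Nonempty (Iso M (hE.model hn)) := by
  obtain ⟨hsimple, hout, hcard⟩ := hM
  obtain ⟨r, hr⟩ : ∃ r, M.root = some r := by
    rw [← Option.ne_none_iff_exists']
    intro h
    have hempty := M.root_eq_none_iff.1 h
    have : Finite M.Vertex := M.finite_vertex
    have : Nontrivial M.Vertex := by
      rw [← Finite.one_lt_card_iff_nontrivial]
      have : Nat.card M.Vertex = n := hcard
      omega
    obtain ⟨u⟩ := M.planar.1.nonempty
    obtain ⟨v, hv⟩ := M.planar.1.preconnected.exists_adj_of_nontrivial u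
    rw [CombMap.graph, SimpleGraph.fromRel_adj] at hv
    obtain ⟨-, ⟨d, -⟩ | ⟨d, -⟩⟩ := hv <;> exact hempty.elim d
  obtain ⟨L⟩ := CombMap.exists_visitOrder (M := M.toCombMap) (r := r) (hout r hr)
  have hcard' : M.toCombMap.numVertices = n := hcard
  rw [hcard'] at L
  refine ⟨L.edges, L.isGood_edges M.planar, ⟨⟨L.equiv.symm, L.dartEquiv hsimple, fun _ => rfl,
    fun d => ?_, fun d => ?_, ?_⟩⟩⟩
  · refine Subtype.ext (Prod.ext rfl ?_)
    exact congrArg L.label (M.target_rev d).symm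
  · refine (rotDart_eq _ (L.isNext_rot M.planar hsimple d)).trans (Subtype.ext (Prod.ext ?_ rfl))
    exact congrArg L.label (M.origin_rot d).symm
  · rw [hr]
    refine congrArg some (Subtype.ext (Prod.ext ?_ ?_))
    · exact L.label_origin_root.symm
    · exact (L.label_target_root hsimple).symm

theorem Iso.isBipartite {M N : RootedMap} (f : Iso M N) (h : N.IsBipartite) : M.IsBipartite := by
  obtain ⟨c, hc⟩ := h
  refine ⟨fun v => c (f.vertexEquiv v), fun d => ?_⟩
  have h1 := hc (f.dartEquiv d)
  rw [CombMap.target, f.map_rev, f.map_origin, f.map_origin] at h1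
  exact h1

/-- The isomorphism classes of a set of outerplanar maps are counted by the codes; it is applied to
all of them with `d = 1`, and to the bipartite ones with `d = 2`. -/
theorem countUpToIso_eq {n d : ℕ} (hn : 2 ≤ n) {S : Set RootedMap} (hS : S ⊆ outerplanarMaps n)
    (h1 : ∀ {E} (hE : IsGood n E), IsShifted d E → hE.model hn ∈ S)
    (h2 : ∀ {E} (hE : IsGood n E) {M}, M ∈ S → Iso M (hE.model hn) → IsShifted d E) :
    countUpToIso S = (goodSets d n).card := by
  rw [countUpToIso, ← Set.ncard_coe_finset]
  symm
  refine Set.ncard_congr (fun E hE => Quotient.mk isoSetoid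
    ((mem_goodSets.1 (Finset.mem_coe.1 hE)).1.model hn)) ?_ ?_ ?_
  · intro E hE
    have := mem_goodSets.1 (Finset.mem_coe.1 hE)
    exact ⟨_, h1 this.1 this.2, rfl⟩
  · intro E E' hE hE' h
    obtain ⟨f⟩ := Quotient.exact h
    exact IsGood.eq_of_iso f
  · rintro _ ⟨M, hM, rfl⟩
    obtain ⟨E, hE, ⟨f⟩⟩ := exists_iso_model hn (hS hM)
    exact ⟨E, Finset.mem_coe.2 (mem_goodSets.2 ⟨hE, h2 hE hM f⟩), Quotient.sound ⟨f.symm⟩⟩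

theorem countUpToIso_outerplanarMaps {n : ℕ} (hn : 2 ≤ n) :
    countUpToIso (outerplanarMaps n) = (goodSets 1 n).card :=
  countUpToIso_eq hn subset_rfl (fun hE _ => hE.model_mem_outerplanarMaps hn)
    fun _ _ _ _ => ⟨0, fun _ _ _ => Subsingleton.elim _ _⟩

theorem countUpToIso_bipartiteOuterplanarMaps {n : ℕ} (hn : 2 ≤ n) :
    countUpToIso (bipartiteOuterplanarMaps n) = (goodSets 2 n).card :=
  countUpToIso_eq hn (fun _ h => h.1)
    (fun hE h => ⟨hE.model_mem_outerplanarMaps hn, (hE.isBipartite_model_iff hn).2 h⟩)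
    fun hE _ hM f => (hE.isBipartite_model_iff hn).1 (f.symm.isBipartite hM.2)

end RootedMap

theorem corollary5 :
    ((fun n : ℕ => (RootedMap.countUpToIso (RootedMap.outerplanarMaps n) : ℝ)) ~[atTop]
      (fun n : ℕ => 8 ^ n * (n : ℝ) ^ (-(3 / 2) : ℝ) / (36 * √Real.pi))) ∧
    ((fun n : ℕ => (RootedMap.countUpToIso (RootedMap.bipartiteOuterplanarMaps n) : ℝ)) ~[atTop]
      (fun n : ℕ => (2 * √3 - 3) * √2 / (9 * √(Real.pi * (√3 - 1))) *
        ((3 * √3 - 5) ^ n)⁻¹ * (n : ℝ) ^ (-(3 / 2) : ℝ))) := by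
  constructor
  · refine isEquivalent_of_stepSeries_one fun N hN => ?_
    rw [RootedMap.countUpToIso_outerplanarMaps (by omega), card_goodSets 1 N hN]
  · refine isEquivalent_of_stepSeries_two fun N hN => ?_
    rw [RootedMap.countUpToIso_bipartiteOuterplanarMaps (by omega), card_goodSets 2 N hN]
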